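/- **Setting.** Let $H\cong\mathbb R\times\mathrm{SO}(2)$ be the subgroup of $\mathrm{SL}(3,\mathbb R)$ consisting of the matrices $$\begin{pmatrix} e^t\cos s& e^t\sin s&0\\ -e^t\sin s&e^t\cos s&0\\ 0&0&e^{-2t}\end{pmatrix},\qquad t,s\in\mathbb R .$$ Let $E_{ij}$ be the matrix units and put $e_1=E_{11}-E_{22}$, $e_2=E_{12}+E_{21}$, $e_3=\sqrt2E_{13}$, $e_4=\sqrt2E_{23}$, $e_5=-\sqrt2E_{31}$, $e_6=-\sqrt2E_{32}$. Their span $\mathfrak m$ is an $\mathrm{Ad}(H)$-invariant complement of the Lie algebra of $H$ in $\mathfrak{sl}(3,\mathbb R)$, identified with the tangent space of $M=\mathrm{SL}(3,\mathbb R)/H$ at $[\mathrm{Id}]$. Let $g$ be the $\mathrm{SL}(3,\mathbb R)$-invariant pseudo-Riemannian metric on $M$ given on $\mathfrak m$ by $\langle X,Y\rangle=-\frac12\operatorname{Tr}(XY)$, and let $J$ be the $\mathrm{SL}(3,\mathbb R)$-invariant almost complex structure given on $\mathfrak m$ by $Je_1=-e_2$, $Je_3=e_4$, $Je_5=e_6$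 and $J^2=-\mathrm{id}$; $(M,g,J)$ is nearly Kähler. Let $\mathbb R^{n}_\nu$ be $\mathbb R^n$ with $\langle v,w\rangle=-\sum_{i\le\nu}v_iw_i+\sum_{i>\nu}v_iw_i$, and let $S^n_\nu(r)=\{p\in\mathbb R^{n+1}_\nu:\langle p,p\rangle=r^2\}$, $S^2(r)=S^2_0(r)$. Consider the following maps $\mathbb R^2\to M$, where $X_\pm=\frac1{\sqrt2}(e_3\pm e_5)$ and $X_0=\frac1{\sqrt3}e_1+e_3-\frac13e_5$: - $f_1(u,v)=[\exp(u(\cos v\,e_1+\sin v\,e_2))]$; - $f_2(u,v)=[\exp(2u(\cos v\,X_++\sin v\,JX_+))]$; - $f_3(u,v)=[\exp(2u(\cos v\,X_-+\sin v\,JX_-))]$; - $f_4(u,v)=[\exp(u\,X_0+v\,JX_0)]$; - $f_5(u,v)=[\exp(\frac1{\sqrt2}(u\,e_3+v\,e_4))]$. **Theorem A.** The images of $f_1,\dots,f_5$ are the orbits through $[\mathrm{Id}]$ of, respectively, the subgroup $\mathrm{SL}(2,\mathbb R)$ (embedded as upper left block), the subgroup $\mathrm{SO}(3)$, the subgroup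 $\mathrm{SO}^+(2,1)$ (the identity component of the group of matrices of determinant $1$ that preserve $x^2+y^2-z^2$), the subgroup isomorphic to $\mathbb R^2$ generated by $\exp(\mathrm{span}\{X_0,JX_0\})$, and the subgroup isomorphic to $\mathbb R^2$ generated by $\exp(\mathrm{span}\{e_3,e_4\})$. Let $\Sigma$ be a connected smooth surface and $f:\Sigma\to M$ a smooth immersion, whose induced metric $f^*g$ may be degenerate. Suppose that $f$ is almost complex ($J$ preserves the tangent spaces of $f$) and totally geodesic (each geodesic of $(M,g)$ that is initially tangent to $f$ initially stays in $f$). Then one of the following holds: 1. $(\Sigma,f^*g)$ is locally isometric to $S^2_2(\frac12)$ and $f$ is locally congruent to $f_1$; 2. $(\Sigma,f^*g)$ is locally isometric to $S^2(1)$ and $f$ is locally congruent to $f_2$; 3. $(\Sigma,f^*g)$ is locally isometric to $S^2_2(1)$ and $f$ is locally congruent to $f_3$; 4. $(\Sigma,f^*g)$ is locally isometric to $\mathbb R^2_2$ and $f$ is locally congruent to $f_4$; 5. $f^*g$ is degenerate at each point and $f$ is locally congruent to $f_5$. Here $f$ is locally congruent to $f_i$ if each point of $\Sigma$ has a neighbourhood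 with local coordinates $\psi=(u,v)$ on which $f=\Phi\circ f_i\circ\psi$ for some isometry $\Phi$ of $(M,g)$. -/

import Mathlib

open scoped Manifold ContDiff Topology

namespace SL3NK

/-! ### The homogeneous space `SL(3,ℝ) / (ℝ × SO(2))` -/

/-- Real `3 × 3` matrices. -/
abbrev Mat3 := Matrix (Fin 3) (Fin 3) ℝ

/-- The group `SL(3,ℝ)`. -/
abbrev SL3 := Matrix.SpecialLinearGroup (Fin 3) ℝ

/-- The model space `ℝⁿ`. -/
abbrev E (n : ℕ) := EuclideanSpace ℝ (Fin n)

/-- The general element of the isotropy group. -/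
noncomputable def isoMat (t s : ℝ) : Mat3 :=
  !![Real.exp t * Real.cos s, Real.exp t * Real.sin s, 0;
     -(Real.exp t * Real.sin s), Real.exp t * Real.cos s, 0;
     0, 0, Real.exp (-2 * t)]

theorem isoMat_mul (t s t' s' : ℝ) :
    isoMat t s * isoMat t' s' = isoMat (t + t') (s + s') := by
  ext i j
  fin_cases i <;> fin_cases j <;>
    simp [isoMat, Matrix.mul_apply, Fin.sum_univ_three, Real.exp_add, Real.cos_add,
      Real.sin_add] <;> first | ring1 | (rw [← Real.exp_add]; ring_nf)

theorem isoMat_zero : isoMat 0 0 = 1 := by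
  ext i j
  fin_cases i <;> fin_cases j <;> simp [isoMat]

/-- The isotropy subgroup `H ≅ ℝ × SO(2)` of `SL(3,ℝ)`. -/
noncomputable def H : Subgroup SL3 where
  carrier := {a | ∃ t s : ℝ, (a : Mat3) = isoMat t s}
  one_mem' := ⟨0, 0, by rw [isoMat_zero]; rfl⟩
  mul_mem' := by
    rintro a b ⟨t, s, h⟩ ⟨t', s', h'⟩
    exact ⟨t + t', s + s', by rw [← isoMat_mul, ← h, ← h']; rfl⟩
  inv_mem' := by
    rintro a ⟨t, s, h⟩
    refine ⟨-t, -s, ?_⟩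
    have h1 : (a : Mat3) * isoMat (-t) (-s) = 1 := by
      rw [h, isoMat_mul, add_neg_cancel, add_neg_cancel, isoMat_zero]
    have h2 : ((a⁻¹ : SL3) : Mat3) * (a : Mat3) = 1 := by
      rw [← Matrix.SpecialLinearGroup.coe_mul, inv_mul_cancel]; rfl
    calc ((a⁻¹ : SL3) : Mat3)
        = ((a⁻¹ : SL3) : Mat3) * ((a : Mat3) * isoMat (-t) (-s)) := by rw [h1, mul_one]
      _ = isoMat (-t) (-s) := by rw [← mul_assoc, h2, one_mul]

/-- The homogeneous space `SL(3,ℝ) / H`, with the quotient topology. -/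
abbrev NKSpace := SL3 ⧸ H

/-- The class `[a]` of `a ∈ SL(3,ℝ)`. -/
noncomputable def cls (a : SL3) : NKSpace := QuotientGroup.mk a

/-! ### The smooth structure

The first two columns of `a` form a vector `z ∈ ℂ³` and the third a vector `l ∈ ℝ³`; the class
`[a]` is determined by the complex line of `z` and the real line of `l`. Near `[Id]` we use
the affine coordinates `z₂/z₁, z₃/z₁ ∈ ℂ` and `l₁/l₃, l₂/l₃ ∈ ℝ`; the other charts are the
translates of this one by elements of `SL(3,ℝ)`. -/

/-- The square norm of the first entry of `z`. -/
def nrm (A : Mat3) : ℝ := A 0 0 ^ 2 + A 0 1 ^ 2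

/-- The domain of the affine coordinates. -/
def dom (A : Mat3) : Prop := 0 < nrm A ∧ 0 < A 2 2

/-- The affine coordinates. -/
noncomputable def coordFun (A : Mat3) : E 6 :=
  !₂[(A 0 0 * A 1 0 + A 0 1 * A 1 1) / nrm A, (A 0 0 * A 1 1 - A 0 1 * A 1 0) / nrm A,
     (A 0 0 * A 2 0 + A 0 1 * A 2 1) / nrm A, (A 0 0 * A 2 1 - A 0 1 * A 2 0) / nrm A,
     A 0 2 / A 2 2, A 1 2 / A 2 2]

/-- The determinant of the matrix with columns `(1, y₀, y₂)`, `(0, y₁, y₃)`, `(y₄, y₅, 1)`. -/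
def detFun (y : E 6) : ℝ := (y 1 - y 5 * y 3) + y 4 * (y 0 * y 3 - y 1 * y 2)

/-- The matrix of determinant `1` with given affine coordinates. -/
noncomputable def secMat (y : E 6) : Mat3 :=
  !![1, 0, y 4 / detFun y; y 0, y 1, y 5 / detFun y; y 2, y 3, 1 / detFun y]

theorem det_secMat {y : E 6} (hy : detFun y ≠ 0) : (secMat y).det = 1 := by
  rw [Matrix.det_fin_three]
  simp only [secMat, Matrix.of_apply, Matrix.cons_val', Matrix.cons_val_zero, Matrix.cons_val_one,
    Matrix.cons_val, Matrix.cons_val_fin_one]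
  field_simp
  simp only [detFun]
  ring

open Classical in
/-- The section of `SL(3,ℝ) → SL(3,ℝ)/H` in affine coordinates (used where `detFun y > 0`). -/
noncomputable def secSL (y : E 6) : SL3 :=
  if h : detFun y ≠ 0 then ⟨secMat y, det_secMat h⟩ else 1

theorem coe_secSL {y : E 6} (hy : detFun y ≠ 0) : (secSL y : Mat3) = secMat y := by
  simp [secSL, hy]

theorem mem_H_of {h : SL3} {α β γ : ℝ} (hm : (h : Mat3) = !![α, β, 0; -β, α, 0; 0, 0, γ])
    (hd : (α ^ 2 + β ^ 2) * γ = 1) : h ∈ H := by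
  have hr : 0 < α ^ 2 + β ^ 2 := by
    rcases (add_nonneg (sq_nonneg α) (sq_nonneg β)).lt_or_eq with h | h
    · exact h
    · rw [← h] at hd; simp at hd
  set z : ℂ := ⟨α, β⟩ with hz
  have hn : ‖z‖ ^ 2 = α ^ 2 + β ^ 2 := by
    rw [Complex.sq_norm, Complex.normSq_apply]; ring
  have hzpos : 0 < ‖z‖ := by
    rcases (norm_nonneg z).lt_or_eq with h | h
    · exact h
    · rw [← h] at hn; simp at hn; linarith
  have h1 : ‖z‖ * Real.cos (Complex.arg z) = α := Complex.norm_mul_cos_arg z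
  have h2 : ‖z‖ * Real.sin (Complex.arg z) = β := Complex.norm_mul_sin_arg z
  refine ⟨Real.log ‖z‖, Complex.arg z, ?_⟩
  have h3 : Real.exp (-2 * Real.log ‖z‖) = γ := by
    have : Real.exp (2 * Real.log ‖z‖) = α ^ 2 + β ^ 2 := by
      rw [two_mul, Real.exp_add, Real.exp_log hzpos, ← hn]; ring
    rw [neg_mul, Real.exp_neg, this]
    exact inv_eq_of_mul_eq_one_right hd
  rw [hm, isoMat, Real.exp_log hzpos, h1, h2, h3]

theorem exists_of_cls_eq {a b : SL3} (h : cls a = cls b) :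
    ∃ α β γ : ℝ, 0 < α ^ 2 + β ^ 2 ∧ 0 < γ ∧
      (b : Mat3) = (a : Mat3) * !![α, β, 0; -β, α, 0; 0, 0, γ] := by
  obtain ⟨t, s, hts⟩ := QuotientGroup.eq.1 h
  refine ⟨Real.exp t * Real.cos s, Real.exp t * Real.sin s, Real.exp (-2 * t), ?_,
    Real.exp_pos _, ?_⟩
  · have := Real.sin_sq_add_cos_sq s
    have h2 : (Real.exp t * Real.cos s) ^ 2 + (Real.exp t * Real.sin s) ^ 2
        = Real.exp t ^ 2 := by
      linear_combination Real.exp t ^ 2 * this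
    rw [h2]; positivity
  · have : (b : Mat3) = ((a * (a⁻¹ * b) : SL3) : Mat3) := by rw [mul_inv_cancel_left]
    rw [this, Matrix.SpecialLinearGroup.coe_mul, hts]; rfl

theorem nrm_mul (A : Mat3) (α β γ : ℝ) :
    nrm (A * !![α, β, 0; -β, α, 0; 0, 0, γ]) = (α ^ 2 + β ^ 2) * nrm A := by
  simp [nrm, Matrix.mul_apply, Fin.sum_univ_three]; ring

theorem dom_congr {a b : SL3} (h : cls a = cls b) (hd : dom (a : Mat3)) : dom (b : Mat3) := by
  obtain ⟨α, β, γ, h1, h2, h3⟩ := exists_of_cls_eq h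
  rw [h3]
  refine ⟨by rw [nrm_mul]; exact mul_pos h1 hd.1, ?_⟩
  simpa [Matrix.mul_apply, Fin.sum_univ_three] using mul_pos hd.2 h2

theorem coordFun_congr {a b : SL3} (h : cls a = cls b) :
    coordFun (a : Mat3) = coordFun (b : Mat3) := by
  obtain ⟨α, β, γ, h1, h2, h3⟩ := exists_of_cls_eq h
  rw [h3]
  have h1' := h1.ne'
  have h2' := h2.ne'
  have key : ∀ u v w : ℝ, v = (α ^ 2 + β ^ 2) * u → u / w = v / ((α ^ 2 + β ^ 2) * w) := by
    intro u v w huv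
    rw [huv, mul_div_mul_left _ _ h1']
  have key2 : ∀ u w : ℝ, u / w = (u * γ) / (w * γ) := by
    intro u w
    rw [mul_div_mul_right _ _ h2']
  ext i
  fin_cases i
  all_goals simp only [coordFun, nrm_mul]
  all_goals simp [Matrix.mul_apply, Fin.sum_univ_three]
  · exact key _ _ _ (by ring)
  · exact key _ _ _ (by ring)
  · exact key _ _ _ (by ring)
  · exact key _ _ _ (by ring)
  · exact key2 _ _
  · exact key2 _ _

/-- The affine coordinates as a map on the quotient. -/
noncomputable def coordQ (p : NKSpace) : E 6 :=
  Quotient.liftOn' p (fun a : SL3 => coordFun (a : Mat3))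
    (fun _ _ h => coordFun_congr (Quotient.sound' h))

theorem coordQ_cls (a : SL3) : coordQ (cls a) = coordFun (a : Mat3) := rfl

theorem det_eq_detFun (a : SL3) (hd : dom (a : Mat3)) :
    detFun (coordFun (a : Mat3)) * (nrm (a : Mat3) * (a : Mat3) 2 2) = 1 := by
  have hdet := a.det_coe
  rw [Matrix.det_fin_three] at hdet
  have h1 := hd.1.ne'
  have h2 := hd.2.ne'
  have hn : nrm (a : Mat3) = (a : Mat3) 0 0 ^ 2 + (a : Mat3) 0 1 ^ 2 := rfl
  simp only [detFun, coordFun]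
  simp
  field_simp
  rw [hn]
  linear_combination ((a : Mat3) 0 0 ^ 2 + (a : Mat3) 0 1 ^ 2) * hdet

theorem detFun_pos (a : SL3) (hd : dom (a : Mat3)) : 0 < detFun (coordFun (a : Mat3)) := by
  have h := det_eq_detFun a hd
  have h2 : 0 < nrm (a : Mat3) * (a : Mat3) 2 2 := mul_pos hd.1 hd.2
  by_contra hc
  nlinarith [not_lt.1 hc]

theorem cls_secSL (a : SL3) (hd : dom (a : Mat3)) :
    cls (secSL (coordFun (a : Mat3))) = cls a := by
  symm
  refine QuotientGroup.eq.2 ?_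
  have hp := detFun_pos a hd
  have h1 := hd.1.ne'
  have h2 := hd.2.ne'
  have hD := det_eq_detFun a hd
  set A : Mat3 := (a : Mat3) with hA
  have hn : A 0 0 ^ 2 + A 0 1 ^ 2 = nrm A := rfl
  have hmat : (secSL (coordFun A) : Mat3)
      = A * !![A 0 0 / nrm A, -(A 0 1 / nrm A), 0; -(-(A 0 1 / nrm A)), A 0 0 / nrm A, 0;
          0, 0, nrm A] := by
    rw [coe_secSL hp.ne']
    have hdiv : ∀ x : ℝ, x / detFun (coordFun A) = x * (nrm A * A 2 2) := by
      intro x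
      rw [div_eq_iff hp.ne']
      linear_combination -x * hD
    have c0 : coordFun A 0 = (A 0 0 * A 1 0 + A 0 1 * A 1 1) / nrm A := rfl
    have c1 : coordFun A 1 = (A 0 0 * A 1 1 - A 0 1 * A 1 0) / nrm A := rfl
    have c2 : coordFun A 2 = (A 0 0 * A 2 0 + A 0 1 * A 2 1) / nrm A := rfl
    have c3 : coordFun A 3 = (A 0 0 * A 2 1 - A 0 1 * A 2 0) / nrm A := rfl
    have c4 : coordFun A 4 = A 0 2 / A 2 2 := rfl
    have c5 : coordFun A 5 = A 1 2 / A 2 2 := rfl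
    simp only [secMat, hdiv, c0, c1, c2, c3, c4, c5]
    ext i j
    fin_cases i <;> fin_cases j <;>
      simp [Matrix.mul_apply, Fin.sum_univ_three] <;> field_simp <;>
      first | linear_combination hn | linear_combination -hn | ring1
  refine mem_H_of (α := A 0 0 / nrm A) (β := -(A 0 1 / nrm A)) (γ := nrm A) ?_ ?_
  · have h3 : ((a⁻¹ : SL3) : Mat3) * A = 1 := by
      rw [hA, ← Matrix.SpecialLinearGroup.coe_mul, inv_mul_cancel]; rfl
    rw [Matrix.SpecialLinearGroup.coe_mul, hmat, ← mul_assoc, h3, one_mul]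
  · field_simp
    exact hn

theorem dom_secSL {y : E 6} (hy : 0 < detFun y) : dom (secSL y : Mat3) := by
  rw [coe_secSL hy.ne']
  refine ⟨by simp [nrm, secMat], by simpa [secMat] using hy⟩

theorem coordFun_secSL {y : E 6} (hy : 0 < detFun y) : coordFun (secSL y : Mat3) = y := by
  rw [coe_secSL hy.ne']
  have := hy.ne'
  ext i
  fin_cases i <;> simp [coordFun, secMat, nrm] <;> field_simp

theorem continuous_entry (i j : Fin 3) : Continuous fun a : SL3 => (a : Mat3) i j :=
  (continuous_apply_apply i j).comp continuous_subtype_val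

theorem isOpen_dom : IsOpen {a : SL3 | dom (a : Mat3)} := by
  have h1 : Continuous fun a : SL3 => nrm (a : Mat3) := by
    unfold nrm
    exact ((continuous_entry 0 0).pow 2).add ((continuous_entry 0 1).pow 2)
  exact (isOpen_lt continuous_const h1).inter (isOpen_lt continuous_const (continuous_entry 2 2))

theorem continuous_detFun : Continuous detFun := by
  unfold detFun; fun_prop

/-- The affine coordinate chart around `[Id]`. -/
noncomputable def baseChart : OpenPartialHomeomorph NKSpace (E 6) where
  toFun := coordQ
  invFun y := cls (secSL y)
  source := cls '' {a : SL3 | dom (a : Mat3)}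
  target := {y | 0 < detFun y}
  map_source' := by
    rintro _ ⟨a, ha, rfl⟩
    exact detFun_pos a ha
  map_target' := fun y hy => ⟨secSL y, dom_secSL hy, rfl⟩
  left_inv' := by
    rintro _ ⟨a, ha, rfl⟩
    exact cls_secSL a ha
  right_inv' := fun y hy => coordFun_secSL hy
  open_source := QuotientGroup.isOpenMap_coe _ isOpen_dom
  open_target := isOpen_lt continuous_const continuous_detFun
  continuousOn_toFun := by
    rintro _ ⟨a, ha, rfl⟩
    refine ContinuousAt.continuousWithinAt ?_
    refine (QuotientGroup.isOpenQuotientMap_mk (N := H)).continuousAt_comp_iff.1 ?_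
    have h1 : nrm (a : Mat3) ≠ 0 := ha.1.ne'
    have h2 : (a : Mat3) 2 2 ≠ 0 := ha.2.ne'
    have hc : ∀ i j, ContinuousAt (fun b : SL3 => (b : Mat3) i j) a :=
      fun i j => (continuous_entry i j).continuousAt
    have hn : ContinuousAt (fun b : SL3 => nrm (b : Mat3)) a :=
      ((hc 0 0).pow 2).add ((hc 0 1).pow 2)
    have : ContinuousAt (fun b : SL3 => coordFun (b : Mat3)) a := by
      unfold coordFun
      refine (PiLp.continuous_toLp 2 _).continuousAt.comp (continuousAt_pi.2 fun i => ?_)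
      fin_cases i
      · exact (((hc 0 0).mul (hc 1 0)).add ((hc 0 1).mul (hc 1 1))).div hn h1
      · exact (((hc 0 0).mul (hc 1 1)).sub ((hc 0 1).mul (hc 1 0))).div hn h1
      · exact (((hc 0 0).mul (hc 2 0)).add ((hc 0 1).mul (hc 2 1))).div hn h1
      · exact (((hc 0 0).mul (hc 2 1)).sub ((hc 0 1).mul (hc 2 0))).div hn h1
      · exact (hc 0 2).div (hc 2 2) h2
      · exact (hc 1 2).div (hc 2 2) h2
    exact this
  continuousOn_invFun := by
    refine (QuotientGroup.isOpenQuotientMap_mk (N := H)).continuous.comp_continuousOn ?_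
    intro y hy
    have hy' : detFun y ≠ 0 := ne_of_gt hy
    have hc : ContinuousOn (fun y => (secSL y : Mat3)) {y | 0 < detFun y} := by
      have : ContinuousOn secMat {y | 0 < detFun y} := by
        intro z hz
        have hz' : detFun z ≠ 0 := ne_of_gt hz
        have hD : ContinuousAt detFun z := continuous_detFun.continuousAt
        have hcoord : ∀ i : Fin 6, ContinuousAt (fun w : E 6 => w i) z := fun i => by fun_prop
        refine ContinuousAt.continuousWithinAt ?_
        refine continuousAt_pi.2 fun i => continuousAt_pi.2 fun j => ?_
        fin_cases i <;> fin_cases j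
        · exact continuousAt_const
        · exact continuousAt_const
        · exact (hcoord 4).div hD hz'
        · exact hcoord 0
        · exact hcoord 1
        · exact (hcoord 5).div hD hz'
        · exact hcoord 2
        · exact hcoord 3
        · exact continuousAt_const.div hD hz'
      exact this.congr fun z hz => coe_secSL (ne_of_gt hz)
    exact (Topology.IsInducing.subtypeVal.continuousWithinAt_iff).2 (hc y hy)

/-- The translate by `a` of the affine chart; it is defined around `[a]`. -/
noncomputable def chartFrom (a : SL3) : OpenPartialHomeomorph NKSpace (E 6) :=
  (Homeomorph.smul (a⁻¹ : SL3)).transOpenPartialHomeomorph baseChart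

theorem smul_cls (a b : SL3) : a • cls b = cls (a * b) := rfl

theorem cls_out (p : NKSpace) : cls p.out = p := Quotient.out_eq' p

theorem mem_chartFrom_source (p : NKSpace) : p ∈ (chartFrom p.out).source := by
  change p.out⁻¹ • p ∈ baseChart.source
  refine ⟨1, ⟨by simp [nrm], by simp⟩, ?_⟩
  conv_rhs => rw [← cls_out p]
  rw [cls_out, ← cls_out p, smul_cls, cls_out, inv_mul_cancel]

noncomputable instance : ChartedSpace (E 6) NKSpace where
  atlas := Set.range chartFrom
  chartAt p := chartFrom p.out
  mem_chart_source := mem_chartFrom_source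
  chart_mem_atlas p := ⟨p.out, rfl⟩

theorem contDiffAt_coordFun {X : Type*} [NormedAddCommGroup X] [NormedSpace ℝ X] {F : X → Mat3}
    {x : X} (hF : ∀ i j, ContDiffAt ℝ ∞ (fun y => F y i j) x) (hd : dom (F x)) :
    ContDiffAt ℝ ∞ (fun y => coordFun (F y)) x := by
  have h1 : nrm (F x) ≠ 0 := hd.1.ne'
  have h2 : F x 2 2 ≠ 0 := hd.2.ne'
  have hn : ContDiffAt ℝ ∞ (fun y => nrm (F y)) x := ((hF 0 0).pow 2).add ((hF 0 1).pow 2)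
  rw [contDiffAt_euclidean]
  intro i
  fin_cases i
  · exact (((hF 0 0).mul (hF 1 0)).add ((hF 0 1).mul (hF 1 1))).div hn h1
  · exact (((hF 0 0).mul (hF 1 1)).sub ((hF 0 1).mul (hF 1 0))).div hn h1
  · exact (((hF 0 0).mul (hF 2 0)).add ((hF 0 1).mul (hF 2 1))).div hn h1
  · exact (((hF 0 0).mul (hF 2 1)).sub ((hF 0 1).mul (hF 2 0))).div hn h1
  · exact (hF 0 2).div (hF 2 2) h2
  · exact (hF 1 2).div (hF 2 2) h2

theorem contDiffAt_secMat {y : E 6} (hy : detFun y ≠ 0) (i j : Fin 3) :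
    ContDiffAt ℝ ∞ (fun z => secMat z i j) y := by
  have hcoord : ∀ i : Fin 6, ContDiffAt ℝ ∞ (fun w : E 6 => w i) y :=
    fun i => (contDiffAt_euclidean.1 contDiffAt_id) i
  have hD : ContDiffAt ℝ ∞ detFun y :=
    ((hcoord 1).sub ((hcoord 5).mul (hcoord 3))).add
      ((hcoord 4).mul (((hcoord 0).mul (hcoord 3)).sub ((hcoord 1).mul (hcoord 2))))
  fin_cases i <;> fin_cases j
  · exact contDiffAt_const
  · exact contDiffAt_const
  · exact (hcoord 4).div hD hy
  · exact hcoord 0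
  · exact hcoord 1
  · exact (hcoord 5).div hD hy
  · exact hcoord 2
  · exact hcoord 3
  · exact contDiffAt_const.div hD hy

instance : IsManifold (𝓡 6) ∞ NKSpace := by
  refine isManifold_of_contDiffOn (𝓡 6) ∞ NKSpace ?_
  rintro _ _ ⟨a, rfl⟩ ⟨b, rfl⟩
  rintro y ⟨⟨hy1, hy2⟩, -⟩
  have hpos : 0 < detFun y := by
    rw [OpenPartialHomeomorph.symm_target] at hy1
    exact hy1
  have hopen : IsOpen {z : E 6 | 0 < detFun z} := isOpen_lt continuous_const continuous_detFun
  have hdomQ : cls (b⁻¹ * (a * secSL y)) ∈ cls '' {c : SL3 | dom (c : Mat3)} := by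
    have : b⁻¹ • ((a⁻¹)⁻¹ • cls (secSL y)) ∈ baseChart.source := hy2
    rwa [inv_inv, smul_cls, smul_cls] at this
  have hdom : dom ((b⁻¹ * (a * secSL y) : SL3) : Mat3) := by
    obtain ⟨c, hc, hcc⟩ := hdomQ
    exact dom_congr hcc hc
  refine ContDiffAt.contDiffWithinAt ?_
  have hev : (fun z : E 6 => coordFun (((b⁻¹ * a : SL3) : Mat3) * secMat z)) =ᶠ[𝓝 y]
      ((𝓡 6) ∘ ((chartFrom a).symm ≫ₕ chartFrom b) ∘ (𝓡 6).symm) := by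
    filter_upwards [hopen.mem_nhds hpos] with z hz
    change _ = coordQ (b⁻¹ • ((a⁻¹)⁻¹ • cls (secSL z)))
    rw [inv_inv, smul_cls, smul_cls, coordQ_cls, ← mul_assoc,
      Matrix.SpecialLinearGroup.coe_mul (b⁻¹ * a), coe_secSL (ne_of_gt hz)]
  refine ContDiffAt.congr_of_eventuallyEq ?_ hev.symm
  refine contDiffAt_coordFun (fun i j => ?_) ?_
  · simp only [Matrix.mul_apply]
    exact ContDiffAt.sum fun k _ => contDiffAt_const.mul (contDiffAt_secMat hpos.ne' k j)
  · rw [← mul_assoc, Matrix.SpecialLinearGroup.coe_mul (b⁻¹ * a), coe_secSL hpos.ne'] at hdom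
    exact hdom


/-! ### The metric and the almost complex structure -/

/-- The basis `e₁, …, e₆` of the complement `𝔪` of the Lie algebra of `H` in `𝔰𝔩(3,ℝ)`. -/
def e1 : Mat3 := !![1, 0, 0; 0, -1, 0; 0, 0, 0]
/-- The second basis vector. -/
def e2 : Mat3 := !![0, 1, 0; 1, 0, 0; 0, 0, 0]
/-- The third basis vector. -/
noncomputable def e3 : Mat3 := !![0, 0, √2; 0, 0, 0; 0, 0, 0]
/-- The fourth basis vector. -/
noncomputable def e4 : Mat3 := !![0, 0, 0; 0, 0, √2; 0, 0, 0]
/-- The fifth basis vector. -/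
noncomputable def e5 : Mat3 := !![0, 0, 0; 0, 0, 0; -√2, 0, 0]
/-- The sixth basis vector. -/
noncomputable def e6 : Mat3 := !![0, 0, 0; 0, 0, 0; 0, -√2, 0]

/-- The projection of `𝔰𝔩(3,ℝ) = 𝔥 ⊕ 𝔪` onto `𝔪`. -/
noncomputable def projM : Mat3 →ₗ[ℝ] Mat3 where
  toFun A := ((A 0 0 - A 1 1) / 2) • e1 + ((A 0 1 + A 1 0) / 2) • e2 + (A 0 2 / √2) • e3 +
    (A 1 2 / √2) • e4 + (-A 2 0 / √2) • e5 + (-A 2 1 / √2) • e6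
  map_add' A B := by simp only [Matrix.add_apply]; module
  map_smul' c A := by simp only [Matrix.smul_apply, smul_eq_mul, RingHom.id_apply]; module

theorem projM_eq (A : Mat3) :
    projM A = !![(A 0 0 - A 1 1) / 2, (A 0 1 + A 1 0) / 2, A 0 2;
      (A 0 1 + A 1 0) / 2, -((A 0 0 - A 1 1) / 2), A 1 2; A 2 0, A 2 1, 0] := by
  ext i j
  fin_cases i <;> fin_cases j <;> simp [projM, e1, e2, e3, e4, e5, e6]

/-- The complex structure on `𝔪`: `J e₁ = -e₂`, `J e₃ = e₄`, `J e₅ = e₆`, `J² = -1`. -/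
noncomputable def J0 (A : Mat3) : Mat3 :=
  -(((A 0 0 - A 1 1) / 2) • e2) + ((A 0 1 + A 1 0) / 2) • e1 + (A 0 2 / √2) • e4 -
    (A 1 2 / √2) • e3 + (-A 2 0 / √2) • e6 - (-A 2 1 / √2) • e5

/-- The smooth local section of `SL(3,ℝ) → SL(3,ℝ)/H` around `[Id]` given by the affine
coordinates; its value at `[Id]` is the identity matrix. -/
noncomputable def secBase (q : NKSpace) : Mat3 := secMat (coordQ q)

/-- The differential at `p = [a]` of `q ↦ σ(a⁻¹ • q)`, where `σ` is the local section `secBase`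
around `[Id]` and `a` is the chosen representative of `p`. -/
noncomputable def dsec (p : NKSpace) : TangentSpace (𝓡 6) p →ₗ[ℝ] Mat3 :=
  LinearMap.pi fun i => LinearMap.pi fun j =>
    (mfderiv (𝓡 6) 𝓘(ℝ, ℝ) (fun q : NKSpace => secBase (p.out⁻¹ • q) i j) p :
      TangentSpace (𝓡 6) p →L[ℝ] ℝ).toLinearMap

/-- The identification of the tangent space at `p = [a]` with `𝔪`: a tangent vector is moved to
`[Id]` by the differential of `q ↦ a⁻¹ • q`, lifted to `𝔰𝔩(3,ℝ)` by the differential of a local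
section, and projected to `𝔪`. (A different representative `a` changes the result by `Ad(h)`
for some `h ∈ H`; the local section does not matter.) -/
noncomputable def hor (p : NKSpace) : TangentSpace (𝓡 6) p →ₗ[ℝ] Mat3 :=
  projM ∘ₗ dsec p

/-- The affine coordinates of `[Id]`. -/
noncomputable def y0 : E 6 := !₂[0, 1, 0, 0, 0, 0]

theorem detFun_y0 : detFun y0 = 1 := by simp [detFun, y0]

theorem chart_self (p : NKSpace) : chartFrom p.out p = y0 := by
  change coordQ (p.out⁻¹ • p) = y0
  conv_lhs => rw [← cls_out p]
  rw [cls_out, ← cls_out p, smul_cls, cls_out, inv_mul_cancel, coordQ_cls]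
  ext i
  fin_cases i <;> simp [coordFun, y0, nrm]

/-- In affine coordinates, `dsec` is the differential of `secMat`. -/
theorem dsec_apply (p : NKSpace) (v : E 6) (i j : Fin 3) :
    dsec p v i j = fderiv ℝ (fun y => secMat y i j) y0 v := by
  have hev : (fun y : E 6 => secMat y i j) =ᶠ[𝓝 y0]
      fun y => secBase (p.out⁻¹ • (chartFrom p.out).symm y) i j := by
    have hopen : IsOpen {z : E 6 | 0 < detFun z} := isOpen_lt continuous_const continuous_detFun
    have hmem : y0 ∈ {z : E 6 | 0 < detFun z} := by simp [detFun_y0]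
    filter_upwards [hopen.mem_nhds hmem] with y hy
    change _ = secMat (coordQ (p.out⁻¹ • ((p.out⁻¹)⁻¹ • cls (secSL y)))) i j
    rw [smul_cls, smul_cls, inv_inv, inv_mul_cancel_left, coordQ_cls, coordFun_secSL hy]
  have hd : DifferentiableAt ℝ (fun y : E 6 => secMat y i j) y0 :=
    (contDiffAt_secMat (by simp [detFun_y0]) i j).differentiableAt (by simp)
  have hself := chart_self p
  have hmd : MDifferentiableAt (𝓡 6) 𝓘(ℝ, ℝ)
      (fun q : NKSpace => secBase (p.out⁻¹ • q) i j) p := by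
    have h1 : MDifferentiableAt (𝓡 6) (𝓡 6) (chartFrom p.out) p :=
      mdifferentiableAt_atlas (I := 𝓡 6) (chart_mem_atlas (E 6) p) (mem_chartFrom_source p)
    have h2 : MDifferentiableAt (𝓡 6) 𝓘(ℝ, ℝ) (fun y : E 6 => secMat y i j)
        (chartFrom p.out p) := by
      rw [hself]; exact hd.mdifferentiableAt
    exact h2.comp p h1
  have hm : mfderiv (𝓡 6) 𝓘(ℝ, ℝ) (fun q : NKSpace => secBase (p.out⁻¹ • q) i j) p
      = fderivWithin ℝ (writtenInExtChartAt (𝓡 6) 𝓘(ℝ, ℝ) p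
          (fun q : NKSpace => secBase (p.out⁻¹ • q) i j)) (Set.range (𝓡 6))
          (extChartAt (𝓡 6) p p) :=
    hmd.mfderiv
  change (mfderiv (𝓡 6) 𝓘(ℝ, ℝ) (fun q : NKSpace => secBase (p.out⁻¹ • q) i j) p) v = _
  rw [hm]
  have hx : extChartAt (𝓡 6) p p = y0 := hself
  have hr : Set.range (𝓡 6) = Set.univ := (𝓡 6).range_eq_univ
  rw [hx, hr, fderivWithin_univ, hev.fderiv_eq]
  rfl

/-- The identification with `𝔪` in affine coordinates. -/
theorem hor_apply (p : NKSpace) (v : E 6) :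
    hor p v = !![-(v 1) / 2, v 0 / 2, v 4; v 0 / 2, v 1 / 2, v 5; v 2, v 3, 0] := by
  have hcoord : ∀ i : Fin 6, HasFDerivAt (fun w : E 6 => w i)
      (EuclideanSpace.proj i : E 6 →L[ℝ] ℝ) y0 :=
    fun i => (EuclideanSpace.proj i : E 6 →L[ℝ] ℝ).hasFDerivAt
  have hD : HasFDerivAt detFun (EuclideanSpace.proj 1 : E 6 →L[ℝ] ℝ) y0 := by
    have h := ((hcoord 1).sub ((hcoord 5).mul (hcoord 3))).add
      ((hcoord 4).mul (((hcoord 0).mul (hcoord 3)).sub ((hcoord 1).mul (hcoord 2))))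
    refine h.congr_fderiv ?_
    ext w
    simp [y0]
  have hne : detFun y0 ≠ 0 := by simp [detFun_y0]
  have key : ∀ (i j : Fin 3) (L : E 6 →L[ℝ] ℝ),
      HasFDerivAt (fun y => secMat y i j) L y0 → dsec p v i j = L v := by
    intro i j L hL
    rw [dsec_apply, hL.fderiv]
  have hdiv : ∀ k : Fin 6, k ≠ 1 → HasFDerivAt (fun w : E 6 => w k / detFun w)
      (EuclideanSpace.proj k : E 6 →L[ℝ] ℝ) y0 := by
    intro k hk
    refine ((hcoord k).mul ((hasDerivAt_inv hne).comp_hasFDerivAt y0 hD)).congr_fderiv ?_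
    have hyk : y0 k = 0 := by fin_cases k <;> simp_all [y0]
    ext w
    simp [hyk, detFun_y0]
  have e00 : dsec p v 0 0 = 0 := key 0 0 0 (hasFDerivAt_const (1 : ℝ) y0)
  have e01 : dsec p v 0 1 = 0 := key 0 1 0 (hasFDerivAt_const (0 : ℝ) y0)
  have e10 : dsec p v 1 0 = v 0 := key 1 0 _ (hcoord 0)
  have e11 : dsec p v 1 1 = v 1 := key 1 1 _ (hcoord 1)
  have e20 : dsec p v 2 0 = v 2 := key 2 0 _ (hcoord 2)
  have e21 : dsec p v 2 1 = v 3 := key 2 1 _ (hcoord 3)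
  have e02 : dsec p v 0 2 = v 4 := key 0 2 _ (hdiv 4 (by decide))
  have e12 : dsec p v 1 2 = v 5 := key 1 2 _ (hdiv 5 (by decide))
  change projM (dsec p v) = _
  rw [projM_eq, e00, e01, e10, e11, e02, e12, e20, e21]
  ext i j
  fin_cases i <;> fin_cases j <;> simp
  all_goals ring1

theorem hor_injective (p : NKSpace) : Function.Injective (hor p) := by
  intro (v : E 6) (w : E 6) h
  rw [hor_apply, hor_apply] at h
  have h' := fun i j => congrFun (congrFun h i) j
  have h0 := h' 0 1
  have h1 := h' 1 1
  have h2 := h' 2 0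
  have h3 := h' 2 1
  have h4 := h' 0 2
  have h5 := h' 1 2
  simp at h0 h1 h2 h3 h4 h5
  change v = w
  ext i
  fin_cases i <;> assumption

/-- Every element of `𝔪` represents a tangent vector. -/
theorem hor_surjective (p : NKSpace) (A : Mat3) : ∃ v, hor p v = projM A := by
  refine ⟨(!₂[A 0 1 + A 1 0, A 1 1 - A 0 0, A 2 0, A 2 1, A 0 2, A 1 2] : E 6), ?_⟩
  rw [hor_apply, projM_eq]
  ext i j
  fin_cases i <;> fin_cases j <;> simp
  all_goals ring1

/-- The `SL(3,ℝ)`-invariant metric `g` on `SL(3,ℝ)/H` induced by `⟨X, Y⟩ = -½ Tr(XY)` on `𝔪`. -/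
noncomputable def g (p : NKSpace) : LinearMap.BilinForm ℝ (TangentSpace (𝓡 6) p) :=
  LinearMap.mk₂ ℝ (fun v w => -(1 / 2) * (hor p v * hor p w).trace)
    (fun u v w => by simp [add_mul, mul_add])
    (fun c v w => by simp; ring)
    (fun u v w => by simp [mul_add])
    (fun c v w => by simp; ring)

/-- The `SL(3,ℝ)`-invariant almost complex structure `J` on `SL(3,ℝ)/H`. -/
noncomputable def J (p : NKSpace) (v : TangentSpace (𝓡 6) p) : TangentSpace (𝓡 6) p :=
  Function.invFun (hor p) (J0 (hor p v))

/-- `J` corresponds to `J0` on `𝔪`. -/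
theorem hor_J (p : NKSpace) (v : TangentSpace (𝓡 6) p) : hor p (J p v) = J0 (hor p v) := by
  refine Function.invFun_eq (f := hor p) ?_
  have : J0 (hor p v) = projM (J0 (hor p v)) := by
    rw [projM_eq]
    ext i j
    fin_cases i <;> fin_cases j <;> simp [J0, e1, e2, e3, e4, e5, e6]
  rw [this]
  exact hor_surjective p _

/-! ### Pseudo-Riemannian notions

Here `g` is a field of bilinear forms on the tangent spaces of a manifold modelled on `ℝⁿ`. -/

/-- The coefficients `g_y(u, v)` of `g` in the chart around `p`, at the point with
coordinates `y`. -/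
noncomputable def coeff {n : ℕ} {N : Type*} [TopologicalSpace N] [ChartedSpace (E n) N]
    (g : ∀ p : N, LinearMap.BilinForm ℝ (TangentSpace (𝓡 n) p)) (p : N) (y u v : E n) : ℝ :=
  g ((extChartAt (𝓡 n) p).symm y)
    (mfderiv (𝓡 n) (𝓡 n) (extChartAt (𝓡 n) p).symm y u)
    (mfderiv (𝓡 n) (𝓡 n) (extChartAt (𝓡 n) p).symm y v)

/-- The curve `γ` is smooth near `t` and its Levi-Civita covariant acceleration at time `t`
vanishes: in the chart around `γ t`, where `γ` becomes the curve `c`, one has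
`g(c'', w) + (∂_{c'} g)(c', w) - ½ (∂_w g)(c', c') = 0` for all `w`. This is the geodesic
equation `(c'')ᵏ + Γᵏᵢⱼ (c')ⁱ (c')ʲ = 0` with the index `k` lowered. -/
def IsGeodesicAt {n : ℕ} {N : Type*} [TopologicalSpace N] [ChartedSpace (E n) N]
    (g : ∀ p : N, LinearMap.BilinForm ℝ (TangentSpace (𝓡 n) p)) (γ : ℝ → N) (t : ℝ) : Prop :=
  ContMDiffAt 𝓘(ℝ, ℝ) (𝓡 n) ∞ γ t ∧
    ∀ w : E n,
      let c : ℝ → E n := fun s => extChartAt (𝓡 n) (γ t) (γ s)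
      coeff g (γ t) (c t) (deriv (deriv c) t) w
        + fderiv ℝ (fun y => coeff g (γ t) y (deriv c t) w) (c t) (deriv c t)
        - 1 / 2 * fderiv ℝ (fun y => coeff g (γ t) y (deriv c t) (deriv c t)) (c t) w = 0

/-- The immersion `f` is totally geodesic: each geodesic of the ambient space which is initially
tangent to `f` stays initially in `f` (that is, in the image under `f` of any given neighbourhood
of the initial point). -/
def IsTotallyGeodesic {m n : ℕ} {S N : Type*} [TopologicalSpace S] [ChartedSpace (E m) S]
    [TopologicalSpace N] [ChartedSpace (E n) N]
    (g : ∀ p : N, LinearMap.BilinForm ℝ (TangentSpace (𝓡 n) p)) (f : S → N) : Prop :=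
  ∀ (p : S) (v : TangentSpace (𝓡 m) p) (ε : ℝ) (γ : ℝ → N), 0 < ε →
    (∀ t ∈ Set.Ioo (-ε) ε, IsGeodesicAt g γ t) →
    (⟨γ 0, mfderiv 𝓘(ℝ, ℝ) (𝓡 n) γ 0 (1 : ℝ)⟩ : TangentBundle (𝓡 n) N)
      = ⟨f p, mfderiv (𝓡 m) (𝓡 n) f p v⟩ →
    ∀ U ∈ 𝓝 p, ∀ᶠ t in 𝓝 (0 : ℝ), γ t ∈ f '' U

/-- The tangent spaces of the immersion `f` are preserved by `J`. -/
def IsAlmostComplex {m n : ℕ} {S N : Type*} [TopologicalSpace S] [ChartedSpace (E m) S]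
    [TopologicalSpace N] [ChartedSpace (E n) N]
    (J : ∀ p : N, TangentSpace (𝓡 n) p → TangentSpace (𝓡 n) p) (f : S → N) : Prop :=
  ∀ (p : S) (v : TangentSpace (𝓡 m) p), ∃ w : TangentSpace (𝓡 m) p,
    J (f p) (mfderiv (𝓡 m) (𝓡 n) f p v) = mfderiv (𝓡 m) (𝓡 n) f p w

/-- `f` is a smooth immersion. -/
def IsSmoothImmersion {m n : ℕ} {S N : Type*} [TopologicalSpace S] [ChartedSpace (E m) S]
    [TopologicalSpace N] [ChartedSpace (E n) N] (f : S → N) : Prop :=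
  ContMDiff (𝓡 m) (𝓡 n) ∞ f ∧ ∀ p : S, Function.Injective (mfderiv (𝓡 m) (𝓡 n) f p)

/-- The induced (possibly degenerate) metric of the map `f`. -/
noncomputable def pullback {m n : ℕ} {S N : Type*} [TopologicalSpace S] [ChartedSpace (E m) S]
    [TopologicalSpace N] [ChartedSpace (E n) N]
    (g : ∀ p : N, LinearMap.BilinForm ℝ (TangentSpace (𝓡 n) p)) (f : S → N) (p : S) :
    LinearMap.BilinForm ℝ (TangentSpace (𝓡 m) p) :=
  (g (f p)).compl₁₂ (mfderiv (𝓡 m) (𝓡 n) f p).toLinearMap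
    (mfderiv (𝓡 m) (𝓡 n) f p).toLinearMap

/-- `Φ` is an isometry of `(N, g)`. -/
def IsIsom {n : ℕ} {N : Type*} [TopologicalSpace N] [ChartedSpace (E n) N]
    (g : ∀ p : N, LinearMap.BilinForm ℝ (TangentSpace (𝓡 n) p))
    (Φ : N ≃ₘ^∞⟮𝓡 n, 𝓡 n⟯ N) : Prop :=
  ∀ (p : N) (v w : TangentSpace (𝓡 n) p),
    g (Φ p) (mfderiv (𝓡 n) (𝓡 n) Φ p v) (mfderiv (𝓡 n) (𝓡 n) Φ p w) = g p v w

/-- `f` is locally congruent to the parametrized submanifold `F`: around each point there are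
coordinates `ψ` of `S` in which `f` is given by `F`, up to an isometry of the ambient space. -/
def IsLocallyCongruent {m n : ℕ} {S N : Type*} [TopologicalSpace S] [ChartedSpace (E m) S]
    [TopologicalSpace N] [ChartedSpace (E n) N]
    (g : ∀ p : N, LinearMap.BilinForm ℝ (TangentSpace (𝓡 n) p)) (f : S → N) (F : E m → N) :
    Prop :=
  ∀ p : S, ∃ Φ : N ≃ₘ^∞⟮𝓡 n, 𝓡 n⟯ N, IsIsom g Φ ∧
    ∃ ψ ∈ IsManifold.maximalAtlas (𝓡 m) ∞ S, p ∈ ψ.source ∧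
      ∀ x ∈ ψ.source, f x = Φ (F (ψ x))

/-- The scalar product `-v₁w₁ - ⋯ - v_ν w_ν + v_{ν+1} w_{ν+1} + ⋯ + v_n w_n` of the semi-Euclidean
space `ℝⁿ_ν`. -/
def semiEuclid {n : ℕ} (ν : ℕ) (v w : E n) : ℝ :=
  ∑ i : Fin n, (if (i : ℕ) < ν then -1 else 1) * (v i * w i)

/-- The pseudosphere `Sⁿ_ν(r)` in `ℝⁿ⁺¹_ν`. -/
def pseudosphere (n ν : ℕ) (r : ℝ) : Set (E (n + 1)) := {p | semiEuclid ν p p = r ^ 2}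

/-- `S` with the metric `h` is locally isometric to the submanifold `Q` of `ℝⁿ_ν`: each point of
`S` has an open neighbourhood that is mapped isometrically onto an open subset of `Q`. -/
def IsLocallyIsometricTo {m n : ℕ} {S : Type*} [TopologicalSpace S] [ChartedSpace (E m) S]
    (h : ∀ p : S, LinearMap.BilinForm ℝ (TangentSpace (𝓡 m) p)) (ν : ℕ) (Q : Set (E n)) : Prop :=
  ∀ p : S, ∃ (U : Set S) (ψ : S → E n), IsOpen U ∧ p ∈ U ∧
    ContMDiffOn (𝓡 m) (𝓡 n) ∞ ψ U ∧ Set.InjOn ψ U ∧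
    (∃ O : Set (E n), IsOpen O ∧ ψ '' U = O ∩ Q) ∧
    ∀ x ∈ U, ∀ v w : TangentSpace (𝓡 m) x,
      semiEuclid ν (mfderiv (𝓡 m) (𝓡 n) ψ x v : E n) (mfderiv (𝓡 m) (𝓡 n) ψ x w : E n) = h x v w

/-- The induced metric `h` is degenerate at each point. -/
def IsDegenerate {m : ℕ} {S : Type*} [TopologicalSpace S] [ChartedSpace (E m) S]
    (h : ∀ p : S, LinearMap.BilinForm ℝ (TangentSpace (𝓡 m) p)) : Prop :=
  ∀ p : S, ∃ v : TangentSpace (𝓡 m) p, v ≠ 0 ∧ ∀ w, h p v w = 0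

/-! ### The examples -/

theorem det_exp {X : Mat3} (hX : X.trace = 0) : (NormedSpace.exp X).det = 1 := by
  let _ : NormedRing Mat3 := Matrix.linftyOpNormedRing
  let _ : NormedAlgebra ℝ Mat3 := Matrix.linftyOpNormedAlgebra
  have hder : ∀ t : ℝ, HasDerivAt (fun u : ℝ => (NormedSpace.exp (u • X)).det) 0 t := by
    intro t
    have h := hasDerivAt_exp_smul_const (𝕂 := ℝ) X t
    set A : Mat3 := NormedSpace.exp (t • X) with hA
    have hij : ∀ i j, HasDerivAt (fun u : ℝ => NormedSpace.exp (u • X) i j) ((A * X) i j) t := by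
      intro i j
      exact ((Matrix.entryLinearMap ℝ ℝ i j).toContinuousLinearMap).hasFDerivAt.comp_hasDerivAt t h
    have hd := ((((((((hij 0 0).mul (hij 1 1)).mul (hij 2 2)).sub
      (((hij 0 0).mul (hij 1 2)).mul (hij 2 1))).sub
      (((hij 0 1).mul (hij 1 0)).mul (hij 2 2))).add
      (((hij 0 1).mul (hij 1 2)).mul (hij 2 0))).add
      (((hij 0 2).mul (hij 1 0)).mul (hij 2 1))).sub
      (((hij 0 2).mul (hij 1 1)).mul (hij 2 0)))
    have hfun : (fun u : ℝ => (NormedSpace.exp (u • X)).det) = _ :=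
      funext fun u => Matrix.det_fin_three (NormedSpace.exp (u • X))
    rw [hfun]
    refine hd.congr_deriv ?_
    rw [Matrix.trace_fin_three] at hX
    simp only [Matrix.mul_apply, Fin.sum_univ_three, ← hA, Pi.mul_apply]
    linear_combination A.det * hX + (X 0 0 + X 1 1 + X 2 2) * (- Matrix.det_fin_three A)
  have hconst := is_const_of_deriv_eq_zero (fun t => (hder t).differentiableAt)
    (fun t => (hder t).deriv) 1 0
  simpa using hconst

open Classical in
/-- The exponential map `𝔰𝔩(3,ℝ) → SL(3,ℝ)` (with value `1` outside of `𝔰𝔩(3,ℝ)`). -/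
noncomputable def expSL (X : Mat3) : SL3 :=
  if h : X.trace = 0 then ⟨NormedSpace.exp X, det_exp h⟩ else 1

/-- The first example, an orbit of `SL(2,ℝ)`. -/
noncomputable def f1 (y : E 2) : NKSpace :=
  cls (expSL (y 0 • (Real.cos (y 1) • e1 + Real.sin (y 1) • e2)))

/-- The second example, an orbit of `SO(3)`. -/
noncomputable def f2 (y : E 2) : NKSpace :=
  cls (expSL ((2 * y 0) • (Real.cos (y 1) • ((1 / √2) • (e3 + e5)) +
    Real.sin (y 1) • ((1 / √2) • (e4 + e6)))))

/-- The third example, an orbit of `SO⁺(2,1)`. -/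
noncomputable def f3 (y : E 2) : NKSpace :=
  cls (expSL ((2 * y 0) • (Real.cos (y 1) • ((1 / √2) • (e3 - e5)) +
    Real.sin (y 1) • ((1 / √2) • (e4 - e6)))))

/-- The tangent vector `X = e₁/√3 + e₃ - e₅/3`. -/
noncomputable def X4 : Mat3 := (1 / √3 : ℝ) • e1 + e3 - (1 / 3 : ℝ) • e5

/-- The fourth example, an orbit of `ℝ²`. -/
noncomputable def f4 (y : E 2) : NKSpace := cls (expSL (y 0 • X4 + y 1 • J0 X4))

/-- The fifth example, a degenerate orbit of `ℝ²`. -/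
noncomputable def f5 (y : E 2) : NKSpace :=
  cls (expSL ((1 / √2) • (y 0 • e3 + y 1 • e4)))

/-- The orbit through `[Id]` of a subgroup of `SL(3,ℝ)`. -/
def orbit (K : Subgroup SL3) : Set NKSpace := cls '' (K : Set SL3)

/-- The block embedding `SL(2,ℝ) → SL(3,ℝ)`. -/
def blockHom : Matrix.SpecialLinearGroup (Fin 2) ℝ →* SL3 where
  toFun b := ⟨!![b 0 0, b 0 1, 0; b 1 0, b 1 1, 0; 0, 0, 1], by
    have := b.det_coe
    rw [Matrix.det_fin_two] at this
    simp [Matrix.det_fin_three]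
    linarith⟩
  map_one' := by
    ext i j
    fin_cases i <;> fin_cases j <;> simp
  map_mul' a b := by
    refine Subtype.ext ?_
    change (_ : Mat3) = (!![a 0 0, a 0 1, 0; a 1 0, a 1 1, 0; 0, 0, 1] : Mat3) *
      !![b 0 0, b 0 1, 0; b 1 0, b 1 1, 0; 0, 0, 1]
    ext i j
    fin_cases i <;> fin_cases j <;>
      simp [Matrix.mul_apply, Fin.sum_univ_three, Fin.sum_univ_two]

/-- The subgroup `SL(2,ℝ)` of `SL(3,ℝ)`. -/
def K1 : Subgroup SL3 := blockHom.range

/-- The subgroup `SO(3)` of `SL(3,ℝ)`. -/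
def K2 : Subgroup SL3 where
  carrier := {a | (a : Mat3).transpose * (a : Mat3) = 1}
  one_mem' := by simp
  mul_mem' := by
    intro a b ha hb
    simp only [Set.mem_ofPred_eq, Matrix.SpecialLinearGroup.coe_mul, Matrix.transpose_mul] at *
    rw [Matrix.mul_assoc, ← Matrix.mul_assoc _ (a : Mat3), ha, Matrix.one_mul, hb]
  inv_mem' := by
    intro a ha
    have h1 : (a : Mat3) * ((a⁻¹ : SL3) : Mat3) = 1 := by
      rw [← Matrix.SpecialLinearGroup.coe_mul, mul_inv_cancel]; rfl
    have h2 : ((a⁻¹ : SL3) : Mat3) = (a : Mat3).transpose := by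
      rw [← Matrix.one_mul ((a⁻¹ : SL3) : Mat3), ← (show _ = _ from ha), Matrix.mul_assoc, h1,
        Matrix.mul_one]
    change ((a⁻¹ : SL3) : Mat3).transpose * ((a⁻¹ : SL3) : Mat3) = 1
    rw [h2, Matrix.transpose_transpose, ← h2, h1]

/-- The Gram matrix of the scalar product of signature `(2,1)`. -/
def eta : Mat3 := Matrix.diagonal ![1, 1, -1]

theorem eta_mul_eta : eta * eta = 1 := by
  rw [eta, Matrix.diagonal_mul_diagonal, ← Matrix.diagonal_one]
  congr 1
  ext i
  fin_cases i <;> simp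

theorem eta_dual {A : Mat3} (h : A.transpose * eta * A = eta) :
    A * eta * A.transpose = eta := by
  have h1 : (eta * A.transpose * eta) * A = 1 := by
    rw [Matrix.mul_assoc, Matrix.mul_assoc, ← Matrix.mul_assoc _ eta, h, eta_mul_eta]
  have h2 : A * (eta * A.transpose * eta) = 1 := mul_eq_one_comm.1 h1
  calc A * eta * A.transpose = A * (eta * A.transpose * eta) * eta := by
        simp only [Matrix.mul_assoc, eta_mul_eta, Matrix.mul_one]
    _ = eta := by rw [h2, Matrix.one_mul]

/-- The identity component `SO⁺(2,1)` of the group `SO(2,1)` in `SL(3,ℝ)`. -/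
def K3 : Subgroup SL3 where
  carrier := {a | (a : Mat3).transpose * eta * (a : Mat3) = eta ∧ 0 < (a : Mat3) 2 2}
  one_mem' := by simp
  mul_mem' := by
    rintro a b ⟨ha, ha'⟩ ⟨hb, hb'⟩
    constructor
    · rw [Matrix.SpecialLinearGroup.coe_mul, Matrix.transpose_mul]
      calc _ = (b : Mat3).transpose * ((a : Mat3).transpose * eta * (a : Mat3)) * (b : Mat3) := by
            simp only [Matrix.mul_assoc]
        _ = eta := by rw [ha, hb]
    · have h1 := congrFun (congrFun (eta_dual ha) 2) 2
      have h2 := congrFun (congrFun hb 2) 2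
      rw [Matrix.SpecialLinearGroup.coe_mul]
      generalize (a : Mat3) = A at *
      generalize (b : Mat3) = B at *
      simp [Matrix.mul_apply, Fin.sum_univ_three, eta, Matrix.diagonal_apply] at h1 h2 ⊢
      by_contra hc
      have hlt : A 2 2 * B 2 2 ≤ -(A 2 0 * B 0 2 + A 2 1 * B 1 2) := by linarith
      have hpos : 0 < A 2 2 * B 2 2 := mul_pos ha' hb'
      have hsq : (A 2 2 * B 2 2) ^ 2 ≤ (A 2 0 * B 0 2 + A 2 1 * B 1 2) ^ 2 := by
        nlinarith
      have e1 : A 2 2 ^ 2 = 1 + A 2 0 ^ 2 + A 2 1 ^ 2 := by linarith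
      have e2 : B 2 2 ^ 2 = 1 + B 0 2 ^ 2 + B 1 2 ^ 2 := by linarith
      rw [mul_pow, e1, e2] at hsq
      nlinarith [sq_nonneg (A 2 0 * B 1 2 - A 2 1 * B 0 2), sq_nonneg (A 2 0), sq_nonneg (A 2 1),
        sq_nonneg (B 0 2), sq_nonneg (B 1 2)]
  inv_mem' := by
    rintro a ⟨ha, ha'⟩
    have h1 : ((a⁻¹ : SL3) : Mat3) = eta * (a : Mat3).transpose * eta := by
      have h2 : (a : Mat3) * ((a⁻¹ : SL3) : Mat3) = 1 := by
        rw [← Matrix.SpecialLinearGroup.coe_mul, mul_inv_cancel]; rfl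
      have h3 : (eta * (a : Mat3).transpose * eta) * (a : Mat3) = 1 := by
        rw [Matrix.mul_assoc, Matrix.mul_assoc, ← Matrix.mul_assoc _ eta, ha, eta_mul_eta]
      calc ((a⁻¹ : SL3) : Mat3)
          = (eta * (a : Mat3).transpose * eta) * (a : Mat3) * ((a⁻¹ : SL3) : Mat3) := by
            rw [h3, Matrix.one_mul]
        _ = _ := by rw [Matrix.mul_assoc _ (a : Mat3), h2, Matrix.mul_one]
    have het : eta.transpose = eta := by simp [eta]
    constructor
    · rw [h1, Matrix.transpose_mul, Matrix.transpose_mul, het, Matrix.transpose_transpose]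
      calc _ = eta * ((a : Mat3) * (eta * eta * eta) * (a : Mat3).transpose) * eta := by
            simp only [Matrix.mul_assoc]
        _ = eta := by
            rw [eta_mul_eta, Matrix.one_mul, eta_dual ha, eta_mul_eta, Matrix.one_mul]
    · rw [h1]
      simpa [eta, Matrix.mul_apply, Fin.sum_univ_three, Matrix.diagonal_apply] using ha'

/-- The connected Lie subgroup of `SL(3,ℝ)` with Lie algebra spanned by `X` and `Y`, for commuting
trace-free `X` and `Y`. -/
noncomputable def expSpan (X Y : Mat3) : Subgroup SL3 :=
  Subgroup.closure {a | ∃ u v : ℝ, (a : Mat3) = NormedSpace.exp (u • X + v • Y)}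

/-- The subgroup `ℝ²` of the fourth example. -/
noncomputable def K4 : Subgroup SL3 := expSpan X4 (J0 X4)

/-- The subgroup `ℝ²` of the fifth example. -/
noncomputable def K5 : Subgroup SL3 := expSpan e3 e4

end SL3NK

open SL3NK

/-! The trace form is invariant under conjugation, so the metric is naturally reductive and the
curves `t ↦ [a exp (t X)]` with `X ∈ 𝔪` satisfy the geodesic equation (`isGeodesicAt_exp`). Total
geodesy is only ever applied to these curves, so no uniqueness theorem for geodesics is needed.

Locally the surface is lifted to `SL(3,ℝ)`; the `𝔪`-part of the Maurer-Cartan form of the lift turns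
its tangent planes into `J`-invariant planes `W ⊆ 𝔪`. A geodesic that starts tangentially stays in
the surface and keeps its direction `X` tangent to it (`tangent_transport`). As the plane is the
complex line of `X`, the whole translate of `W` stays tangent (`IsOnSurface.mul_expSL`). Hence all
`[exp X exp Y]` with small `X, Y ∈ W` lie on the surface, the surface is `[exp W]` near `[Id]`, and
differentiating `[exp (t X) exp (s Y)]` shows that `W` contains the `𝔪`-part of `[[X, Y], Y]`
(`IsSurfaceLift.local_structure_of_one`).

With `𝔪 ≅ ℂ³`, the bracket `[[J X, X], X]` has an `𝔪`-part that multiplies each of the three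
coordinates of `X` by a number, and for `W` to be a Lie triple these numbers must agree wherever the
coordinates are nonzero. Together with the phases and dilations coming from `H` this leaves six
complex lines (`IsComplexPlane.classification`). The lines of `e3` and `e5` are exchanged by the
isometry induced by `a ↦ (aᵀ)⁻¹`, so there are five cases. The conjugacy class of the plane is
locally constant, so on a connected surface it is constant (`exists_model`).

Each model orbit is described by functions on `SL(3,ℝ)` that are invariant under right
multiplication by `H`: the matrix `B Bᵀ` of the upper left block for `SL(2,ℝ)`, the normalized third
column for `SO(3)` and `SO⁺(2,1)`, logarithms of common eigenforms for the flat orbit, and affine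
coordinates of the third column for the degenerate one. They provide the local inverse of the
parametrization, the description of the orbit and, in the nondegenerate cases, the local isometry.
-/

namespace SL3NK

-- A norm of a normed algebra is needed to differentiate the exponential; all norms are equivalent
-- here, so the choice does not matter.
attribute [local instance] Matrix.linftyOpNormedRing Matrix.linftyOpNormedAlgebra

/-! ### The adjoint action of the isotropy group -/

/-- The adjoint action of `SL(3,ℝ)` on matrices. -/
def Ad (a : SL3) : Mat3 →ₗ[ℝ] Mat3 where
  toFun M := (a : Mat3) * M * ((a⁻¹ : SL3) : Mat3)
  map_add' M N := by rw [mul_add, add_mul]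
  map_smul' c M := by simp

theorem Ad_apply (a : SL3) (M : Mat3) : Ad a M = (a : Mat3) * M * ((a⁻¹ : SL3) : Mat3) := rfl

theorem coe_inv_mul (a : SL3) : ((a⁻¹ : SL3) : Mat3) * (a : Mat3) = 1 := by
  rw [← Matrix.SpecialLinearGroup.coe_mul, inv_mul_cancel]; rfl

theorem coe_mul_inv (a : SL3) : (a : Mat3) * ((a⁻¹ : SL3) : Mat3) = 1 := by
  rw [← Matrix.SpecialLinearGroup.coe_mul, mul_inv_cancel]; rfl

theorem coe_inv_mul_cancel (a : SL3) (M : Mat3) : ((a⁻¹ : SL3) : Mat3) * ((a : Mat3) * M) = M := by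
  rw [← mul_assoc, coe_inv_mul, one_mul]

theorem coe_mul_inv_cancel (a : SL3) (M : Mat3) : (a : Mat3) * (((a⁻¹ : SL3) : Mat3) * M) = M := by
  rw [← mul_assoc, coe_mul_inv, one_mul]

theorem coe_inv_eq {a : SL3} {M : Mat3} (h : (a : Mat3) * M = 1) : ((a⁻¹ : SL3) : Mat3) = M := by
  rw [← mul_one ((a⁻¹ : SL3) : Mat3), ← h, coe_inv_mul_cancel]

theorem Ad_one (M : Mat3) : Ad 1 M = M := by simp [Ad_apply]

theorem Ad_mul (a b : SL3) (M : Mat3) : Ad (a * b) M = Ad a (Ad b M) := by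
  simp only [Ad_apply, mul_inv_rev, Matrix.SpecialLinearGroup.coe_mul, mul_assoc]

theorem Ad_inv_Ad (a : SL3) (M : Mat3) : Ad a⁻¹ (Ad a M) = M := by
  rw [← Ad_mul, inv_mul_cancel, Ad_one]

theorem Ad_injective (a : SL3) : Function.Injective (Ad a) :=
  Function.LeftInverse.injective (Ad_inv_Ad a)

theorem Ad_matmul (a : SL3) (M N : Mat3) : Ad a (M * N) = Ad a M * Ad a N := by
  simp only [Ad_apply, mul_assoc, coe_inv_mul_cancel]

theorem trace_Ad (a : SL3) (M : Mat3) : (Ad a M).trace = M.trace := by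
  rw [Ad_apply, Matrix.trace_mul_comm, coe_inv_mul_cancel]

/-- Matrices commuting with the complex structure of the first two columns. -/
theorem projM_eq_zero_iff (M : Mat3) :
    projM M = 0 ↔ M = !![M 0 0, M 0 1, 0; -(M 0 1), M 0 0, 0; 0, 0, M 2 2] := by
  rw [projM_eq]
  constructor
  · intro h
    have h' := fun i j => congrFun (congrFun h i) j
    have h0 := h' 0 0
    have h1 := h' 0 1
    have h2 := h' 2 0
    have h3 := h' 2 1
    have h4 := h' 0 2
    have h5 := h' 1 2
    simp at h0 h1 h2 h3 h4 h5
    ext i j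
    fin_cases i <;> fin_cases j <;> simp <;> linarith
  · intro h
    rw [h]
    ext i j
    fin_cases i <;> fin_cases j <;> simp

/-- `ker projM` is more than the Lie algebra of `H`: it is the associative algebra `ℂ × ℝ` of
matrices that commute with the complex structure of the first two coordinates. This allows products
of such factors to be dropped in the derivative computations. -/
theorem projM_mul_eq_zero {M N : Mat3} (hM : projM M = 0) (hN : projM N = 0) :
    projM (M * N) = 0 := by
  rw [projM_eq_zero_iff] at hM hN
  rw [hM, hN, projM_eq]
  ext i j
  fin_cases i <;> fin_cases j <;> simp [Matrix.mul_apply, Fin.sum_univ_three] <;> ring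

theorem exists_of_mem_H {h : SL3} (hh : h ∈ H) :
    ∃ α β γ : ℝ, (α ^ 2 + β ^ 2) * γ = 1 ∧ (h : Mat3) = !![α, β, 0; -β, α, 0; 0, 0, γ] := by
  have hd := h.det_coe
  obtain ⟨t, s, hts⟩ := hh
  refine ⟨_, _, _, ?_, hts⟩
  rw [hts, Matrix.det_fin_three] at hd
  simp [isoMat] at hd ⊢
  linarith

theorem projM_of_mem_H {h : SL3} (hh : h ∈ H) : projM (h : Mat3) = 0 := by
  obtain ⟨α, β, γ, -, h⟩ := exists_of_mem_H hh
  rw [projM_eq_zero_iff, h]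
  simp

theorem coe_inv_of_mem_H {h : SL3} {α β γ : ℝ} (hd : (α ^ 2 + β ^ 2) * γ = 1)
    (hm : (h : Mat3) = !![α, β, 0; -β, α, 0; 0, 0, γ]) :
    ((h⁻¹ : SL3) : Mat3) = !![α * γ, -(β * γ), 0; β * γ, α * γ, 0; 0, 0, α ^ 2 + β ^ 2] := by
  refine coe_inv_eq ?_
  rw [hm]
  ext i j
  fin_cases i <;> fin_cases j <;> simp [Matrix.mul_apply, Fin.sum_univ_three] <;>
    first | ring1 | linear_combination hd

/-- Reductivity of the homogeneous space: the splitting is `Ad(H)`-invariant, so the choice of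
representative only conjugates. -/
theorem projM_Ad {h : SL3} (hh : h ∈ H) (M : Mat3) : projM (Ad h M) = Ad h (projM M) := by
  obtain ⟨α, β, γ, hd, hm⟩ := exists_of_mem_H hh
  rw [Ad_apply, Ad_apply, coe_inv_of_mem_H hd hm, hm, projM_eq, projM_eq, Matrix.eta_fin_three M]
  ext i j
  fin_cases i <;> fin_cases j <;> simp [Matrix.mul_apply, Fin.sum_univ_three] <;> ring

theorem projM_projM (M : Mat3) : projM (projM M) = projM M := by
  rw [projM_eq (projM M), projM_eq]
  ext i j
  fin_cases i <;> fin_cases j <;> simp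

theorem J0_eq (A : Mat3) :
    J0 A = !![(A 0 1 + A 1 0) / 2, -((A 0 0 - A 1 1) / 2), -A 1 2;
      -((A 0 0 - A 1 1) / 2), -((A 0 1 + A 1 0) / 2), A 0 2; -A 2 1, A 2 0, 0] := by
  ext i j
  fin_cases i <;> fin_cases j <;> simp [J0, e1, e2, e3, e4, e5, e6]

theorem projM_J0 (M : Mat3) : projM (J0 M) = J0 M := by
  rw [projM_eq, J0_eq]
  ext i j
  fin_cases i <;> fin_cases j <;> simp

theorem J0_J0 (M : Mat3) : J0 (J0 M) = -projM M := by
  rw [J0_eq (J0 M), projM_eq, J0_eq]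
  ext i j
  fin_cases i <;> fin_cases j <;> simp

theorem J0_Ad {h : SL3} (hh : h ∈ H) (M : Mat3) : J0 (Ad h M) = Ad h (J0 M) := by
  obtain ⟨α, β, γ, hd, hm⟩ := exists_of_mem_H hh
  rw [Ad_apply, Ad_apply, coe_inv_of_mem_H hd hm, hm, J0_eq, J0_eq, Matrix.eta_fin_three M]
  ext i j
  fin_cases i <;> fin_cases j <;> simp [Matrix.mul_apply, Fin.sum_univ_three] <;>
    first | ring1 | (left; ring1)

/-- `J0` as a linear map. -/
noncomputable def J0L : Mat3 →ₗ[ℝ] Mat3 where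
  toFun := J0
  map_add' A B := by
    simp only [J0_eq]
    ext i j
    fin_cases i <;> fin_cases j <;> simp <;> ring
  map_smul' c A := by
    simp only [J0_eq]
    ext i j
    fin_cases i <;> fin_cases j <;> simp <;> ring

theorem J0L_apply (M : Mat3) : J0L M = J0 M := rfl

/-- `ker projM` is orthogonal to `𝔪`. -/
theorem trace_mul_of_projM_eq_zero {X M : Mat3} (hX : projM X = X) (hM : projM M = 0) :
    (X * M).trace = 0 := by
  rw [projM_eq_zero_iff] at hM
  rw [← hX, hM, projM_eq]
  simp [Matrix.trace_fin_three]

theorem trace_mul_projM {X : Mat3} (hX : projM X = X) (M : Mat3) :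
    (X * projM M).trace = (X * M).trace := by
  have h := trace_mul_of_projM_eq_zero hX (M := M - projM M)
    (by rw [map_sub, projM_projM, sub_self])
  rw [mul_sub, Matrix.trace_sub] at h
  linarith

theorem trace_projM (M : Mat3) : (projM M).trace = 0 := by
  rw [projM_eq]; simp [Matrix.trace_fin_three]

/-! ### Tangent vectors relative to a representative -/

/-- The tangent vector `v` at `p = [a]`, identified with an element of `𝔪` by means of the
representative `a`. -/
noncomputable def horRel (a : SL3) (p : NKSpace) : TangentSpace (𝓡 6) p →ₗ[ℝ] Mat3 :=
  Ad (a⁻¹ * p.out) ∘ₗ hor p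

theorem horRel_apply (a : SL3) (p : NKSpace) (v : TangentSpace (𝓡 6) p) :
    horRel a p v = Ad (a⁻¹ * p.out) (hor p v) := rfl

theorem inv_mul_out_mem (a : SL3) : a⁻¹ * (cls a).out ∈ H :=
  QuotientGroup.eq.1 (cls_out (cls a)).symm

theorem inv_mul_out_mem' {a : SL3} {p : NKSpace} (h : cls a = p) : a⁻¹ * p.out ∈ H := by
  subst h; exact inv_mul_out_mem a

theorem horRel_mul (a h : SL3) (p : NKSpace) (v : TangentSpace (𝓡 6) p) :
    horRel (a * h) p v = Ad h⁻¹ (horRel a p v) := by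
  rw [horRel_apply, horRel_apply, ← Ad_mul, mul_inv_rev, mul_assoc]

theorem horRel_injective (a : SL3) (p : NKSpace) : Function.Injective (horRel a p) :=
  (Ad_injective _).comp (hor_injective p)

theorem projM_hor (p : NKSpace) (v : TangentSpace (𝓡 6) p) : projM (hor p v) = hor p v :=
  projM_projM _

theorem projM_horRel {a : SL3} {p : NKSpace} (h : cls a = p) (v : TangentSpace (𝓡 6) p) :
    projM (horRel a p v) = horRel a p v := by
  rw [horRel_apply, projM_Ad (inv_mul_out_mem' h), projM_hor]

theorem g_apply (p : NKSpace) (v w : TangentSpace (𝓡 6) p) :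
    g p v w = -(1 / 2) * (hor p v * hor p w).trace := rfl

/-- No relation between `a` and `p` is required, since the trace form is invariant under conjugation
by all of `SL(3,ℝ)`. -/
theorem g_eq_horRel (a : SL3) (p : NKSpace) (v w : TangentSpace (𝓡 6) p) :
    g p v w = -(1 / 2) * (horRel a p v * horRel a p w).trace := by
  rw [horRel_apply, horRel_apply, ← Ad_matmul, trace_Ad, g_apply]

theorem horRel_J {a : SL3} {p : NKSpace} (h : cls a = p) (v : TangentSpace (𝓡 6) p) :
    horRel a p (J p v) = J0 (horRel a p v) := by
  rw [horRel_apply, horRel_apply, hor_J, J0_Ad (inv_mul_out_mem' h)]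

/-! ### Differentiability of matrix valued maps -/

section Calculus

variable {X : Type*} [NormedAddCommGroup X] [NormedSpace ℝ X]

/-- The entries of a matrix as a continuous linear map. -/
noncomputable def entryL (i j : Fin 3) : Mat3 →L[ℝ] ℝ :=
  (Matrix.entryLinearMap ℝ ℝ i j).toContinuousLinearMap

/-- Matrices as vectors. -/
noncomputable def matEquiv : Mat3 ≃L[ℝ] (Fin 3 → Fin 3 → ℝ) :=
  LinearEquiv.toContinuousLinearEquiv
    { toFun := fun M i j => M i j
      invFun := fun F => Matrix.of F
      map_add' := fun _ _ => rfl
      map_smul' := fun _ _ => rfl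
      left_inv := fun _ => rfl
      right_inv := fun _ => rfl }

theorem contDiffAt_mat {n : WithTop ℕ∞} {F : X → Mat3} {x : X} :
    ContDiffAt ℝ n F x ↔ ∀ i j, ContDiffAt ℝ n (fun y => F y i j) x := by
  constructor
  · intro h i j
    exact (entryL i j).contDiff.contDiffAt.comp x h
  · intro h
    have : ContDiffAt ℝ n (fun y => matEquiv (F y)) x :=
      contDiffAt_pi.2 fun i => contDiffAt_pi.2 fun j => h i j
    exact matEquiv.comp_contDiffAt_iff.1 this

theorem contDiff_exp {n : WithTop ℕ∞} : ContDiff ℝ n (fun M : Mat3 => NormedSpace.exp M) := by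
  have : CompleteSpace Mat3 := FiniteDimensional.complete ℝ Mat3
  exact contDiff_iff_contDiffAt.2 fun M => (NormedSpace.exp_analytic M).contDiffAt

/-- On determinant one the inverse is the adjugate, which is polynomial in the entries. -/
theorem contDiffAt_inv_coe {n : WithTop ℕ∞} {A : X → SL3} {x : X}
    (hA : ContDiffAt ℝ n (fun y => (A y : Mat3)) x) :
    ContDiffAt ℝ n (fun y => (((A y)⁻¹ : SL3) : Mat3)) x := by
  have h := contDiffAt_mat.1 hA
  refine contDiffAt_mat.2 fun i j => ?_
  simp only [Matrix.SpecialLinearGroup.coe_inv, Matrix.adjugate_fin_three]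
  fin_cases i <;> fin_cases j <;> simp <;> 
    first
    | exact ((h _ _).mul (h _ _)).sub ((h _ _).mul (h _ _))
    | exact ((h _ _).mul (h _ _)).neg.add ((h _ _).mul (h _ _))

end Calculus

/-- The element of (the normalizer of) `H` relating a matrix to the section over its class. -/
noncomputable def kMat (A : Mat3) : Mat3 :=
  !![A 0 0 / nrm A, -(A 0 1 / nrm A), 0; A 0 1 / nrm A, A 0 0 / nrm A, 0; 0, 0, nrm A]

theorem projM_kMat (A : Mat3) : projM (kMat A) = 0 := by
  rw [projM_eq_zero_iff]
  simp [kMat]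

/-- This identity is behind all derivative computations: a lift and the section over its class
differ by a right factor in `ker projM`, whose derivatives `projM` cannot see. -/
theorem secMat_coordFun (a : SL3) (hd : dom (a : Mat3)) :
    secMat (coordFun (a : Mat3)) = (a : Mat3) * kMat (a : Mat3) := by
  have hp := detFun_pos a hd
  have h1 := hd.1.ne'
  have hD := det_eq_detFun a hd
  generalize (a : Mat3) = A at *
  have hn : A 0 0 ^ 2 + A 0 1 ^ 2 = nrm A := rfl
  have hdiv : ∀ x : ℝ, x / detFun (coordFun A) = x * (nrm A * A 2 2) := by
    intro x
    rw [div_eq_iff hp.ne']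
    linear_combination -x * hD
  have h2 : A 2 2 ≠ 0 := hd.2.ne'
  have c0 : coordFun A 0 = (A 0 0 * A 1 0 + A 0 1 * A 1 1) / nrm A := rfl
  have c1 : coordFun A 1 = (A 0 0 * A 1 1 - A 0 1 * A 1 0) / nrm A := rfl
  have c2 : coordFun A 2 = (A 0 0 * A 2 0 + A 0 1 * A 2 1) / nrm A := rfl
  have c3 : coordFun A 3 = (A 0 0 * A 2 1 - A 0 1 * A 2 0) / nrm A := rfl
  have c4 : coordFun A 4 = A 0 2 / A 2 2 := rfl
  have c5 : coordFun A 5 = A 1 2 / A 2 2 := rfl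
  simp only [secMat, kMat, hdiv, c0, c1, c2, c3, c4, c5]
  ext i j
  fin_cases i <;> fin_cases j <;>
    simp [Matrix.mul_apply, Fin.sum_univ_three] <;> field_simp <;>
    first | linear_combination hn | linear_combination -hn | ring1

theorem dom_one : dom (1 : Mat3) := by simp [dom, nrm]

theorem dom_of_mem_H {h : SL3} (hh : h ∈ H) : dom (h : Mat3) :=
  dom_congr (a := 1) (QuotientGroup.eq.2 (by simpa using hh)) dom_one

theorem coordFun_one : coordFun (1 : Mat3) = y0 := by
  ext i
  fin_cases i <;> simp [coordFun, y0, nrm]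

theorem coordFun_of_mem_H {h : SL3} (hh : h ∈ H) : coordFun (h : Mat3) = y0 := by
  rw [← coordFun_one]
  exact (coordFun_congr (a := 1) (QuotientGroup.eq.2 (by simpa using hh))).symm

theorem secMat_y0 : secMat y0 = 1 := by
  ext i j
  fin_cases i <;> fin_cases j <;> simp [secMat, y0, detFun]

theorem secSL_y0 : secSL y0 = 1 := by
  refine Subtype.ext ?_
  rw [coe_secSL (by simp [detFun_y0]), secMat_y0]; rfl

/-! ### The projection from `SL(3,ℝ)` to the quotient and its differential -/

section Calculus

variable {X : Type*} [NormedAddCommGroup X] [NormedSpace ℝ X]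

theorem contDiffAt_kMat {A : Mat3} (hd : dom A) : ContDiffAt ℝ ∞ kMat A := by
  have h : ∀ i j, ContDiffAt ℝ ∞ (fun B : Mat3 => B i j) A :=
    fun i j => (entryL i j).contDiff.contDiffAt
  have hn : ContDiffAt ℝ ∞ nrm A := ((h 0 0).pow 2).add ((h 0 1).pow 2)
  have h1 : nrm A ≠ 0 := hd.1.ne'
  refine contDiffAt_mat.2 fun i j => ?_
  fin_cases i <;> fin_cases j
  · exact (h 0 0).div hn h1
  · exact ((h 0 1).div hn h1).neg
  · exact contDiffAt_const
  · exact (h 0 1).div hn h1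
  · exact (h 0 0).div hn h1
  · exact contDiffAt_const
  · exact contDiffAt_const
  · exact contDiffAt_const
  · exact hn

theorem contDiffAt_coordFun_id {A : Mat3} (hd : dom A) : ContDiffAt ℝ ∞ coordFun A :=
  contDiffAt_coordFun (F := fun B : Mat3 => B) (fun i j => (entryL i j).contDiff.contDiffAt) hd

theorem contDiffAt_secMat' {y : E 6} (hy : detFun y ≠ 0) : ContDiffAt ℝ ∞ secMat y :=
  contDiffAt_mat.2 fun i j => contDiffAt_secMat hy i j

theorem contDiffAt_coe_secSL {y : E 6} (hy : 0 < detFun y) :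
    ContDiffAt ℝ ∞ (fun z => (secSL z : Mat3)) y := by
  refine (contDiffAt_secMat' hy.ne').congr_of_eventuallyEq ?_
  filter_upwards [(isOpen_lt continuous_const continuous_detFun).mem_nhds hy] with z hz
  exact coe_secSL (ne_of_gt hz)

theorem continuousAt_SL {T : Type*} [TopologicalSpace T] {A : T → SL3} {x : T} :
    ContinuousAt A x ↔ ContinuousAt (fun y => (A y : Mat3)) x :=
  Topology.IsInducing.subtypeVal.continuousAt_iff

theorem continuous_cls : Continuous cls :=
  (QuotientGroup.isOpenQuotientMap_mk (N := H)).continuous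

theorem chart_eq (p q : NKSpace) : extChartAt (𝓡 6) p q = coordQ (p.out⁻¹ • q) := rfl

theorem chart_symm_eq (p : NKSpace) (y : E 6) :
    (extChartAt (𝓡 6) p).symm y = cls (p.out * secSL y) := by
  change (p.out⁻¹)⁻¹ • cls (secSL y) = _
  rw [inv_inv, smul_cls]

theorem out_inv_mul_mem (a : SL3) : (cls a).out⁻¹ * a ∈ H := by
  have := H.inv_mem (inv_mul_out_mem a)
  simpa using this

/-- The projection to the homogeneous space of a smooth map into `SL(3,ℝ)` is smooth. -/
theorem contMDiffAt_cls {n : WithTop ℕ∞} {A : X → SL3} {x : X}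
    (hA : ContDiffAt ℝ n (fun y => (A y : Mat3)) x) (hn : n ≤ ∞ := by simp) :
    ContMDiffAt 𝓘(ℝ, X) (𝓡 6) n (fun y => cls (A y)) x := by
  rw [contMDiffAt_iff_target]
  refine ⟨continuous_cls.continuousAt.comp (continuousAt_SL.2 hA.continuousAt), ?_⟩
  refine ContDiffAt.contMDiffAt ?_
  change ContDiffAt ℝ n (fun y => coordFun (((cls (A x)).out⁻¹ * A y : SL3) : Mat3)) x
  refine ContDiffAt.comp (g := coordFun) x
    ((contDiffAt_coordFun_id (dom_of_mem_H (out_inv_mul_mem _))).of_le hn) ?_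
  simp only [Matrix.SpecialLinearGroup.coe_mul]
  exact contDiffAt_const.mul hA

theorem projM_conj_kMat {C C' : Mat3} {h : SL3} (hh : h ∈ H) (hC : C = ((h⁻¹ : SL3) : Mat3))
    {k' : Mat3} (hk' : projM k' = 0) :
    projM (C' * (h : Mat3) + C * k') = projM (C' * (h : Mat3)) := by
  rw [map_add, hC, projM_mul_eq_zero (projM_of_mem_H (H.inv_mem hh)) hk', add_zero]

/-- The differential of the projection of a map into `SL(3,ℝ)`. -/
theorem horRel_mfderiv_cls {A : X → SL3} {x : X} {A' : X →L[ℝ] Mat3}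
    (hA : HasFDerivAt (fun y => (A y : Mat3)) A' x)
    (hm : MDifferentiableAt 𝓘(ℝ, X) (𝓡 6) (fun y => cls (A y)) x) (w : X) :
    horRel (A x) (cls (A x)) (mfderiv 𝓘(ℝ, X) (𝓡 6) (fun y => cls (A y)) x w) =
      projM ((((A x)⁻¹ : SL3) : Mat3) * A' w) := by
  set q := cls (A x) with hq
  set h : SL3 := (A x)⁻¹ * q.out with hh
  have hH : h ∈ H := inv_mul_out_mem _
  -- Translation by the inverse of `q.out` moves the point to `[Id]`, so that `coordFun` becomes the
  -- chart at `q`.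
  set C : X → SL3 := fun y => q.out⁻¹ * A y with hCdef
  have hCx : C x = h⁻¹ := by simp [hCdef, hh]
  have hdom : dom (C x : Mat3) := by rw [hCx]; exact dom_of_mem_H (H.inv_mem hH)
  have hC : HasFDerivAt (fun y => (C y : Mat3))
      ((ContinuousLinearMap.mul ℝ Mat3 ((q.out⁻¹ : SL3) : Mat3)).comp A') x := by
    simp only [hCdef, Matrix.SpecialLinearGroup.coe_mul]
    exact ((ContinuousLinearMap.mul ℝ Mat3 ((q.out⁻¹ : SL3) : Mat3)).hasFDerivAt).comp x hA
  set C' := (ContinuousLinearMap.mul ℝ Mat3 ((q.out⁻¹ : SL3) : Mat3)).comp A' with hC'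
  have hcoord := ((contDiffAt_coordFun_id hdom).differentiableAt (by simp)).hasFDerivAt.comp x hC
  have hk := ((contDiffAt_kMat hdom).differentiableAt (by simp)).hasFDerivAt.comp x hC
  set D := (fderiv ℝ coordFun (C x : Mat3)).comp C' with hD
  have hcx : coordFun (C x : Mat3) = y0 := by
    rw [hCx]; exact coordFun_of_mem_H (H.inv_mem hH)
  have hmf : mfderiv 𝓘(ℝ, X) (𝓡 6) (fun y => cls (A y)) x = D := by
    rw [hm.mfderiv]
    change fderivWithin ℝ (fun y => coordFun (C y : Mat3)) (Set.range 𝓘(ℝ, X)) x = D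
    simp only [modelWithCornersSelf_coe, Set.range_id, fderivWithin_univ]
    exact hcoord.fderiv
  -- Here `C x = h⁻¹` lies over `[Id]`, where the section is `1`, so `C x * kMat (C x) = 1`.
  have hkx : kMat (C x : Mat3) = (h : Mat3) := by
    have := secMat_coordFun (C x) hdom
    rw [hcx, secMat_y0, hCx] at this
    rw [hCx]
    have h2 := coe_inv_eq this.symm
    rw [← h2, inv_inv]
  -- differentiate `secMat (coordFun C) = C * kMat C`
  have hopen : ∀ᶠ y in 𝓝 x, dom (C y : Mat3) :=
    (continuousAt_SL.2 hC.continuousAt).eventually (isOpen_dom.mem_nhds hdom)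
  have hsec : HasFDerivAt secMat (fderiv ℝ secMat y0) (coordFun (C x : Mat3)) := by
    rw [hcx]
    exact ((contDiffAt_secMat' (by simp [detFun_y0])).differentiableAt (by simp)).hasFDerivAt
  have hL := hsec.comp x hcoord
  have hR := hC.mul' hk
  have hLR := hL.congr_of_eventuallyEq (f₁ := fun y => (C y : Mat3) * kMat (C y : Mat3)) (by
    filter_upwards [hopen] with y hy
    exact (secMat_coordFun (C y) hy).symm)
  have heq := congrArg (fun T => T w) (hLR.unique hR)
  have hdsec : dsec q (D w) = fderiv ℝ secMat y0 (D w) := by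
    ext i j
    rw [dsec_apply]
    have := (entryL i j).hasFDerivAt.comp y0
      ((contDiffAt_secMat' (y := y0) (by simp [detFun_y0])).differentiableAt (by simp)).hasFDerivAt
    change fderiv ℝ (entryL i j ∘ secMat) y0 _ = _
    rw [this.fderiv]; rfl
  -- `kMat` takes values in the linear space `ker projM`, hence so does its derivative.
  have hk0 : projM (fderiv ℝ kMat (C x : Mat3) (C' w)) = 0 := by
    have h1 := projM.toContinuousLinearMap.hasFDerivAt.comp (C x : Mat3)
      ((contDiffAt_kMat hdom).differentiableAt (by simp)).hasFDerivAt
    have h2 : (projM.toContinuousLinearMap ∘ kMat) = fun _ => (0 : Mat3) := funext projM_kMat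
    rw [h2] at h1
    have := congrArg (fun T => T (C' w)) (h1.unique (hasFDerivAt_const _ _))
    exact this
  rw [horRel_apply, hmf]
  have hhor : hor q (D w) = projM (C' w * (h : Mat3)) := by
    change projM (dsec q (D w)) = _
    rw [hdsec]
    have : fderiv ℝ secMat y0 (D w) = C' w * (h : Mat3) +
        (C x : Mat3) * fderiv ℝ kMat (C x : Mat3) (C' w) := by
      refine Eq.trans heq ?_
      simp [hkx, add_comm]
      rfl
    rw [this, projM_conj_kMat hH (by rw [hCx]) hk0]
  rw [← hh]
  refine (congrArg (Ad h) hhor).trans ?_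
  rw [← projM_Ad hH]
  congr 1
  have hC'w : C' w = ((q.out⁻¹ : SL3) : Mat3) * A' w := rfl
  rw [Ad_apply, hC'w, hh]
  simp only [Matrix.SpecialLinearGroup.coe_mul, mul_inv_rev, inv_inv, mul_assoc,
    coe_mul_inv_cancel, coe_inv_mul, mul_one]

end Calculus

/-! ### Geodesics -/

theorem isOpen_detFun_pos : IsOpen {y : E 6 | 0 < detFun y} :=
  isOpen_lt continuous_const continuous_detFun

/-- The differential of the section, translated to the identity and projected to `𝔪`. -/
noncomputable def secForm (y u : E 6) : Mat3 :=
  projM ((((secSL y)⁻¹ : SL3) : Mat3) * fderiv ℝ secMat y u)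

/-- Relative to the representative `p.out * secSL y` the coordinate fields are the `𝔪`-part of the
Maurer-Cartan form of the section. The result does not involve `p`, so the metric has the same
coefficients in every chart of this atlas. -/
theorem horRel_chart_symm (p : NKSpace) {y : E 6} (hy : 0 < detFun y) (u : E 6) :
    horRel (p.out * secSL y) _ (mfderiv (𝓡 6) (𝓡 6) (extChartAt (𝓡 6) p).symm y u) =
      secForm y u := by
  have hfun : ((extChartAt (𝓡 6) p).symm : E 6 → NKSpace) = fun z => cls (p.out * secSL z) :=
    funext (chart_symm_eq p)
  have hA : ContDiffAt ℝ ∞ (fun z => ((p.out * secSL z : SL3) : Mat3)) y := by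
    simp only [Matrix.SpecialLinearGroup.coe_mul]
    exact contDiffAt_const.mul (contDiffAt_coe_secSL hy)
  have hS : HasFDerivAt (fun z => (secSL z : Mat3)) (fderiv ℝ secMat y) y := by
    refine ((contDiffAt_secMat' hy.ne').differentiableAt (by simp)).hasFDerivAt.congr_of_eventuallyEq
      ?_
    filter_upwards [isOpen_detFun_pos.mem_nhds hy] with z hz
    exact coe_secSL (ne_of_gt hz)
  have hA' : HasFDerivAt (fun z => ((p.out * secSL z : SL3) : Mat3))
      ((ContinuousLinearMap.mul ℝ Mat3 (p.out : Mat3)).comp (fderiv ℝ secMat y)) y := by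
    simp only [Matrix.SpecialLinearGroup.coe_mul]
    exact ((ContinuousLinearMap.mul ℝ Mat3 (p.out : Mat3)).hasFDerivAt).comp y hS
  have key := horRel_mfderiv_cls hA' ((contMDiffAt_cls hA).mdifferentiableAt (by simp)) u
  rw [hfun]
  refine key.trans ?_
  change projM ((((p.out * secSL y)⁻¹ : SL3) : Mat3) * ((p.out : Mat3) * fderiv ℝ secMat y u)) = _
  rw [mul_inv_rev, Matrix.SpecialLinearGroup.coe_mul, mul_assoc, coe_inv_mul_cancel]
  rfl

theorem coeff_g (p : NKSpace) {y : E 6} (hy : 0 < detFun y) (u v : E 6) :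
    coeff g p y u v = -(1 / 2) * (secForm y u * secForm y v).trace := by
  unfold coeff
  rw [g_eq_horRel (p.out * secSL y), horRel_chart_symm p hy, horRel_chart_symm p hy]

theorem secForm_y0 (u : E 6) : secForm y0 u = projM (fderiv ℝ secMat y0 u) := by
  unfold secForm
  rw [secSL_y0, inv_one, Matrix.SpecialLinearGroup.coe_one, one_mul]

theorem contDiffAt_secMat_y0 : ContDiffAt ℝ ∞ secMat y0 :=
  contDiffAt_secMat' (by simp [detFun_y0])

theorem hasFDerivAt_fderiv_secMat :
    HasFDerivAt (fderiv ℝ secMat) (fderiv ℝ (fderiv ℝ secMat) y0) y0 :=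
  ((contDiffAt_secMat_y0.fderiv_right (m := 1) (by norm_cast)).differentiableAt
    (by simp)).hasFDerivAt

/-- Differentiate `σ⁻¹ σ = 1` at `y0`, where the section `σ` takes the value `1`. -/
theorem hasFDerivAt_inv_secSL :
    HasFDerivAt (fun y => (((secSL y)⁻¹ : SL3) : Mat3)) (-fderiv ℝ secMat y0) y0 := by
  have h1 : DifferentiableAt ℝ (fun y => (((secSL y)⁻¹ : SL3) : Mat3)) y0 :=
    (contDiffAt_inv_coe (contDiffAt_coe_secSL (by simp [detFun_y0]))).differentiableAt
      (n := ∞) (by simp)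
  have h2 := contDiffAt_secMat_y0.differentiableAt (by simp)
  have h3 := h1.hasFDerivAt.mul' h2.hasFDerivAt
  have h4 : HasFDerivAt (fun _ : E 6 => (1 : Mat3)) _ y0 := h3.congr_of_eventuallyEq (by
    filter_upwards [isOpen_detFun_pos.mem_nhds (x := y0) (by simp [detFun_y0])] with y hy
    simp only [Pi.mul_apply]
    rw [← coe_secSL (ne_of_gt hy), coe_inv_mul])
  have h5 := h4.unique (hasFDerivAt_const (1 : Mat3) y0)
  have h6 : fderiv ℝ (fun y => (((secSL y)⁻¹ : SL3) : Mat3)) y0 = -fderiv ℝ secMat y0 := by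
    ext1 w
    have := congrArg (fun T => T w) h5
    change (((secSL y0)⁻¹ : SL3) : Mat3) * fderiv ℝ secMat y0 w +
      fderiv ℝ (fun y => (((secSL y)⁻¹ : SL3) : Mat3)) y0 w * secMat y0 = 0 at this
    rw [secSL_y0, secMat_y0, inv_one, Matrix.SpecialLinearGroup.coe_one, one_mul, mul_one] at this
    exact eq_neg_of_add_eq_zero_right this
  rw [← h6]
  exact h1.hasFDerivAt

/-- The derivative of `secForm` at `y₀`. -/
theorem hasFDerivAt_secForm (u : E 6) :
    ∃ L : E 6 →L[ℝ] Mat3, HasFDerivAt (fun y => secForm y u) L y0 ∧ ∀ w, L w =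
      projM (fderiv ℝ (fderiv ℝ secMat) y0 w u - fderiv ℝ secMat y0 w * fderiv ℝ secMat y0 u) := by
  have h1 : HasFDerivAt (fun y => fderiv ℝ secMat y u)
      ((fderiv ℝ (fderiv ℝ secMat) y0).flip u) y0 := by
    have := hasFDerivAt_fderiv_secMat.clm_apply (hasFDerivAt_const u y0)
    refine this.congr_fderiv ?_
    ext1 w
    change fderiv ℝ secMat y0 (0 : E 6) + fderiv ℝ (fderiv ℝ secMat) y0 w u =
      fderiv ℝ (fderiv ℝ secMat) y0 w u
    rw [(fderiv ℝ secMat y0).map_zero, zero_add]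
  have h2 := hasFDerivAt_inv_secSL.mul' h1
  refine ⟨_, projM.toContinuousLinearMap.hasFDerivAt.comp y0 h2, fun w => ?_⟩
  change projM ((((secSL y0)⁻¹ : SL3) : Mat3) * fderiv ℝ (fderiv ℝ secMat) y0 w u +
    -(fderiv ℝ secMat y0 w) * fderiv ℝ secMat y0 u) = _
  rw [secSL_y0, inv_one, Matrix.SpecialLinearGroup.coe_one, one_mul, neg_mul, ← sub_eq_add_neg]

theorem fderiv_coeff (p : NKSpace) (u v w : E 6) :
    fderiv ℝ (fun y => coeff g p y u v) y0 w = -(1 / 2) *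
      ((projM (fderiv ℝ (fderiv ℝ secMat) y0 w u -
          fderiv ℝ secMat y0 w * fderiv ℝ secMat y0 u) * projM (fderiv ℝ secMat y0 v)).trace +
        (projM (fderiv ℝ secMat y0 u) * projM (fderiv ℝ (fderiv ℝ secMat) y0 w v -
          fderiv ℝ secMat y0 w * fderiv ℝ secMat y0 v)).trace) := by
  obtain ⟨L, hL, hL'⟩ := hasFDerivAt_secForm u
  obtain ⟨K, hK, hK'⟩ := hasFDerivAt_secForm v
  have h1 := hL.mul' hK
  have h2 := ((Matrix.traceLinearMap (Fin 3) ℝ ℝ).toContinuousLinearMap.hasFDerivAt.comp y0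
    h1).const_mul (-(1 / 2) : ℝ)
  have h3 : HasFDerivAt (fun y => coeff g p y u v) _ y0 := h2.congr_of_eventuallyEq (by
    filter_upwards [isOpen_detFun_pos.mem_nhds (x := y0) (by simp [detFun_y0])] with y hy
    rw [coeff_g p hy]
    rfl)
  rw [h3.fderiv, ← hL', ← hK', ← secForm_y0, ← secForm_y0, ← Matrix.trace_add]
  change -(1 / 2) * Matrix.trace (_ : Mat3) = _
  congr 2
  rw [add_comm]
  rfl

theorem fderiv_fderiv_secMat_symm (u w : E 6) :
    fderiv ℝ (fderiv ℝ secMat) y0 u w = fderiv ℝ (fderiv ℝ secMat) y0 w u := by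
  have h := contDiffAt_secMat_y0.isSymmSndFDerivAt (by simpa using (WithTop.coe_le_coe.2 le_top : ((2 : ℕ∞) : WithTop ℕ∞) ≤ ∞))
  exact h u w

theorem projM_eq_zero_of_hasDerivAt {k : ℝ → Mat3} {k' : Mat3} {t : ℝ} (hk : HasDerivAt k k' t)
    (h : ∀ᶠ s in 𝓝 t, projM (k s) = 0) : projM k' = 0 := by
  have h1 : HasDerivAt (fun s => projM (k s)) (projM k') t :=
    projM.toContinuousLinearMap.hasFDerivAt.comp_hasDerivAt t hk
  have h2 : HasDerivAt (fun s => projM (k s)) 0 t :=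
    (hasDerivAt_const t (0 : Mat3)).congr_of_eventuallyEq h
  exact h1.unique h2

theorem differentiableAt_deriv_of_contDiffAt {F : Type*} [NormedAddCommGroup F] [NormedSpace ℝ F]
    {c : ℝ → F} {t : ℝ} (hc : ContDiffAt ℝ ∞ c t) : DifferentiableAt ℝ (deriv c) t := by
  have h := ((hc.fderiv_right (m := 1) (by norm_cast)).clm_apply
    (contDiffAt_const (c := (1 : ℝ)))).differentiableAt (by simp)
  exact h

theorem hasDerivAt_fderiv_apply_curve {F G : Type*} [NormedAddCommGroup F] [NormedSpace ℝ F]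
    [NormedAddCommGroup G] [NormedSpace ℝ G] {S : F → G} {S₂ : F →L[ℝ] F →L[ℝ] G} {c v : ℝ → F}
    {c' v' : F} {t : ℝ} (hS : HasFDerivAt (fderiv ℝ S) S₂ (c t)) (hc : HasDerivAt c c' t)
    (hv : HasDerivAt v v' t) :
    HasDerivAt (fun s => fderiv ℝ S (c s) (v s)) (S₂ c' (v t) + fderiv ℝ S (c t) v') t :=
  (hS.comp_hasDerivAt t hc).clm_apply hv

/-- First and second derivative of the affine coordinates of a one-parameter group. -/
theorem deriv_coord_curve {B : ℝ → SL3} {X : Mat3} {t : ℝ}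
    (hB : ∀ s, HasDerivAt (fun s => (B s : Mat3)) ((B s : Mat3) * X) s) (ht : B t = 1) :
    ∃ k₁ k₂ : Mat3, projM k₁ = 0 ∧ projM k₂ = 0 ∧
      fderiv ℝ secMat y0 (deriv (fun s => coordFun (B s : Mat3)) t) = X + k₁ ∧
      fderiv ℝ secMat y0 (deriv (deriv fun s => coordFun (B s : Mat3)) t) +
        fderiv ℝ (fderiv ℝ secMat) y0 (deriv (fun s => coordFun (B s : Mat3)) t)
          (deriv (fun s => coordFun (B s : Mat3)) t) = X * X + 2 • (X * k₁) + k₂ := by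
  -- The equation `B' = B X` bootstraps the smoothness of `B`.
  have hBs : ∀ n : ℕ, ContDiff ℝ n (fun s => (B s : Mat3)) := by
    intro n
    induction n with
    | zero => exact contDiff_zero.2 (continuous_iff_continuousAt.2 fun s => (hB s).continuousAt)
    | succ n ih =>
      rw [Nat.cast_succ, contDiff_succ_iff_deriv]
      refine ⟨fun s => (hB s).differentiableAt, by simp, ?_⟩
      have h := ih.mul (contDiff_const (c := X))
      have h' : (deriv fun s => (B s : Mat3)) = fun s => (B s : Mat3) * X :=
        funext fun s => (hB s).deriv
      exact h' ▸ h
  have hBc : ContDiff ℝ ∞ (fun s => (B s : Mat3)) := contDiff_infty.2 hBs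
  have hdt : dom (B t : Mat3) := by rw [ht]; exact dom_one
  have hdom : ∀ᶠ s in 𝓝 t, dom (B s : Mat3) :=
    (continuousAt_SL.2 hBc.continuous.continuousAt).eventually (isOpen_dom.mem_nhds hdt)
  have hc : ∀ s, dom (B s : Mat3) → ContDiffAt ℝ ∞ (fun s => coordFun (B s : Mat3)) s :=
    fun s hs => ContDiffAt.comp (g := coordFun) (f := fun s => (B s : Mat3)) s
      (contDiffAt_coordFun_id hs) hBc.contDiffAt
  have hk : ∀ s, dom (B s : Mat3) → ContDiffAt ℝ ∞ (fun s => kMat (B s : Mat3)) s :=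
    fun s hs => ContDiffAt.comp (g := kMat) (f := fun s => (B s : Mat3)) s
      (contDiffAt_kMat hs) hBc.contDiffAt
  set c := fun s => coordFun (B s : Mat3) with hcdef
  set k := fun s => kMat (B s : Mat3) with hkdef
  have hct : c t = y0 := by rw [hcdef]; simp only [ht]; exact coordFun_one
  have hkt : k t = 1 := by
    have := secMat_coordFun (B t) hdt
    rw [show coordFun (B t : Mat3) = y0 from hct, ht, Matrix.SpecialLinearGroup.coe_one, one_mul,
      secMat_y0] at this
    rw [hkdef]; simp only [ht]; exact this.symm
  have hc1 : ∀ s, dom (B s : Mat3) → HasDerivAt c (deriv c s) s :=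
    fun s hs => ((hc s hs).differentiableAt (by simp)).hasDerivAt
  have hk1 : ∀ s, dom (B s : Mat3) → HasDerivAt k (deriv k s) s :=
    fun s hs => ((hk s hs).differentiableAt (by simp)).hasDerivAt
  have hc2 : HasDerivAt (deriv c) (deriv (deriv c) t) t :=
    (differentiableAt_deriv_of_contDiffAt (hc t hdt)).hasDerivAt
  have hk2 : HasDerivAt (deriv k) (deriv (deriv k) t) t :=
    (differentiableAt_deriv_of_contDiffAt (hk t hdt)).hasDerivAt
  have hpk1 : ∀ s, dom (B s : Mat3) → projM (deriv k s) = 0 := fun s hs =>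
    projM_eq_zero_of_hasDerivAt (hk1 s hs) (Filter.Eventually.of_forall fun s => projM_kMat _)
  -- Derivative of `secMat c = B k`. It is proved on a neighbourhood of `t` so that it can be
  -- differentiated once more.
  have hfirst : ∀ᶠ s in 𝓝 t, fderiv ℝ secMat (c s) (deriv c s) =
      (B s : Mat3) * X * k s + (B s : Mat3) * deriv k s := by
    filter_upwards [hdom.eventually_nhds] with s hs
    have hs' := hs.self_of_nhds
    have h1 : HasDerivAt (fun s => secMat (c s)) (fderiv ℝ secMat (c s) (deriv c s)) s :=
      HasFDerivAt.comp_hasDerivAt (l := secMat) s ((contDiffAt_secMat'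
        (detFun_pos _ hs').ne').differentiableAt (by simp)).hasFDerivAt (hc1 s hs')
    have h2 := (hB s).mul (hk1 s hs')
    refine (h1.congr_of_eventuallyEq ?_).unique h2
    filter_upwards [hs] with r hr
    exact (secMat_coordFun (B r) hr).symm
  refine ⟨deriv k t, deriv (deriv k) t, hpk1 t hdt,
    projM_eq_zero_of_hasDerivAt hk2 (hdom.mono hpk1), ?_, ?_⟩
  · have := hfirst.self_of_nhds
    rw [hct, hkt, ht] at this
    simpa using this
  · have h0 : HasFDerivAt (fderiv ℝ secMat) (fderiv ℝ (fderiv ℝ secMat) y0) (c t) := by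
      rw [hct]; exact hasFDerivAt_fderiv_secMat
    have h1 := hasDerivAt_fderiv_apply_curve h0 (hc1 t hdt) hc2
    have h2 := (((hB t).mul_const X).mul (hk1 t hdt)).add ((hB t).mul hk2)
    have h3 := (h1.congr_of_eventuallyEq (hfirst.mono fun s hs => hs.symm)).unique h2
    rw [hct, hkt, ht] at h3
    rw [add_comm]
    refine h3.trans ?_
    simp only [Matrix.SpecialLinearGroup.coe_one, one_mul, mul_one]
    rw [two_nsmul]
    abel

theorem coe_expSL {X : Mat3} (h : X.trace = 0) : (expSL X : Mat3) = NormedSpace.exp X := by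
  simp [expSL, h]

theorem trace_of_projM {X : Mat3} (hX : projM X = X) : X.trace = 0 := by
  rw [← hX, trace_projM]

theorem trace_smul_eq_zero {X : Mat3} (h : X.trace = 0) (s : ℝ) : (s • X).trace = 0 := by
  rw [Matrix.trace_smul, h, smul_zero]

theorem expSL_zero : expSL 0 = 1 := by
  refine Subtype.ext ?_
  rw [coe_expSL (by simp), NormedSpace.exp_zero]; rfl

theorem expSL_add {X Y : Mat3} (hX : X.trace = 0) (hY : Y.trace = 0) (h : Commute X Y) :
    expSL (X + Y) = expSL X * expSL Y := by
  refine Subtype.ext ?_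
  rw [Matrix.SpecialLinearGroup.coe_mul, coe_expSL hX, coe_expSL hY,
    coe_expSL (by rw [Matrix.trace_add, hX, hY, add_zero]), Matrix.exp_add_of_commute _ _ h]

theorem expSL_add_smul {X : Mat3} (hX : X.trace = 0) (s t : ℝ) :
    expSL ((s + t) • X) = expSL (s • X) * expSL (t • X) := by
  rw [add_smul, expSL_add (trace_smul_eq_zero hX s) (trace_smul_eq_zero hX t)
    ((Commute.refl X).smul_left s |>.smul_right t)]

theorem expSL_neg {X : Mat3} (hX : X.trace = 0) : expSL (-X) = (expSL X)⁻¹ := by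
  refine eq_inv_of_mul_eq_one_left ?_
  rw [← expSL_add (by simp [hX]) hX (Commute.refl X).neg_left, neg_add_cancel, expSL_zero]

theorem expSL_Ad (a : SL3) {X : Mat3} (hX : X.trace = 0) :
    expSL (Ad a X) = a * expSL X * a⁻¹ := by
  refine Subtype.ext ?_
  rw [Matrix.SpecialLinearGroup.coe_mul, Matrix.SpecialLinearGroup.coe_mul, coe_expSL hX,
    coe_expSL (by rw [trace_Ad, hX]), Ad_apply]
  have hu : IsUnit (a : Mat3) := (Units.mk (a : Mat3) ((a⁻¹ : SL3) : Mat3) (coe_mul_inv a)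
    (coe_inv_mul a)).isUnit
  have hi : ((a⁻¹ : SL3) : Mat3) = (a : Mat3)⁻¹ :=
    (Matrix.inv_eq_right_inv (coe_mul_inv a)).symm
  rw [hi, Matrix.exp_conj _ _ hu]

theorem hasDerivAt_expSL {X : Mat3} (hX : X.trace = 0) (s : ℝ) :
    HasDerivAt (fun s : ℝ => (expSL (s • X) : Mat3)) ((expSL (s • X) : Mat3) * X) s := by
  have h := hasDerivAt_exp_smul_const (𝕂 := ℝ) X s
  rw [coe_expSL (trace_smul_eq_zero hX s)]
  refine h.congr_of_eventuallyEq (Filter.Eventually.of_forall fun r => ?_)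
  exact coe_expSL (trace_smul_eq_zero hX r)

theorem hasDerivAt_mul_expSL (a : SL3) {X : Mat3} (hX : X.trace = 0) (s : ℝ) :
    HasDerivAt (fun s : ℝ => ((a * expSL (s • X) : SL3) : Mat3))
      (((a * expSL (s • X) : SL3) : Mat3) * X) s := by
  simp only [Matrix.SpecialLinearGroup.coe_mul, mul_assoc]
  exact (hasDerivAt_expSL hX s).const_mul _

theorem contDiff_expSL_comp {F : Type*} [NormedAddCommGroup F] [NormedSpace ℝ F] {n : WithTop ℕ∞}
    {L : F → Mat3} (hL : ContDiff ℝ n L) (h : ∀ y, (L y).trace = 0) :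
    ContDiff ℝ n (fun y => (expSL (L y) : Mat3)) := by
  have h1 := contDiff_exp.comp hL
  have h2 : (fun y => (expSL (L y) : Mat3)) = fun y => NormedSpace.exp (L y) :=
    funext fun y => coe_expSL (h y)
  exact h2 ▸ h1

theorem contDiff_mul_expSL (a : SL3) {X : Mat3} (hX : X.trace = 0) :
    ContDiff ℝ ∞ (fun s : ℝ => ((a * expSL (s • X) : SL3) : Mat3)) := by
  simp only [Matrix.SpecialLinearGroup.coe_mul]
  exact contDiff_const.mul (contDiff_expSL_comp (L := fun s : ℝ => s • X)
    (contDiff_id.smul contDiff_const) fun s => trace_smul_eq_zero hX s)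

/-- Infinitesimal form of `projM_Ad`: `ker projM` is the Lie algebra of `H` plus the scalar
matrices, and the latter drop out of the commutator. -/
theorem projM_commutator {X k : Mat3} (hX : projM X = X) (hk : projM k = 0) :
    projM (X * k - k * X) = X * k - k * X := by
  rw [projM_eq_zero_iff] at hk
  rw [← hX, hk, projM_eq, projM_eq]
  ext i j
  fin_cases i <;> fin_cases j <;> simp <;> ring

/-- The curves `t ↦ [a exp (t X)]` with `X ∈ 𝔪` are geodesics. -/
theorem isGeodesicAt_exp (a : SL3) {X : Mat3} (hX : projM X = X) (t : ℝ) :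
    IsGeodesicAt g (fun s : ℝ => cls (a * expSL (s • X))) t := by
  have hX0 := trace_of_projM hX
  refine ⟨contMDiffAt_cls (contDiff_mul_expSL a hX0).contDiffAt, fun w => ?_⟩
  set p := cls (a * expSL (t • X)) with hp
  set h : SL3 := (a * expSL (t • X))⁻¹ * p.out with hh
  have hH : h ∈ H := inv_mul_out_mem _
  -- The right factor `h ∈ H` does not change classes. It achieves `B t = 1`, at the price of
  -- replacing the generator `X` by `Ad h⁻¹ X`.
  set B : ℝ → SL3 := fun s => p.out⁻¹ * (a * expSL (s • X)) * h with hBdef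
  have hBt : B t = 1 := by simp only [hBdef, hh]; group
  have hchart : (fun s : ℝ => extChartAt (𝓡 6) p (cls (a * expSL (s • X)))) =
      fun s => coordFun (B s : Mat3) := by
    funext s
    rw [chart_eq, smul_cls, coordQ_cls]
    refine coordFun_congr (QuotientGroup.eq.2 ?_)
    simp only [hBdef]
    rwa [inv_mul_cancel_left]
  set Z := Ad h⁻¹ X with hZ
  have hZp : projM Z = Z := by rw [hZ, projM_Ad (H.inv_mem hH), hX]
  have hB : ∀ s, HasDerivAt (fun s => (B s : Mat3)) ((B s : Mat3) * Z) s := by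
    intro s
    have h1 := ((hasDerivAt_mul_expSL a hX0 s).const_mul ((p.out⁻¹ : SL3) : Mat3)).mul_const
      (h : Mat3)
    have h2 : (B s : Mat3) * Z = ((p.out⁻¹ : SL3) : Mat3) *
        (((a * expSL (s • X) : SL3) : Mat3) * X) * (h : Mat3) := by
      simp only [hBdef, hZ, Ad_apply, Matrix.SpecialLinearGroup.coe_mul, mul_assoc, inv_inv,
        coe_mul_inv_cancel]
    rw [h2]
    exact h1
  obtain ⟨k₁, k₂, hk₁, hk₂, hc1, hc2⟩ := deriv_coord_curve hB hBt
  have hct : coordFun (B t : Mat3) = y0 := by rw [hBt]; exact coordFun_one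
  intro c
  have hc : c = fun s => coordFun (B s : Mat3) := hchart
  have hctt : c t = y0 := by rw [hc]; exact hct
  clear_value c
  subst hc
  rw [hctt, coeff_g _ (by simp [detFun_y0]), fderiv_coeff, fderiv_coeff, secForm_y0, secForm_y0]
  set c1 := deriv (fun s => coordFun (B s : Mat3)) t
  set c2 := deriv (deriv fun s => coordFun (B s : Mat3)) t
  rw [fderiv_fderiv_secMat_symm w c1]
  set T := fderiv ℝ (fderiv ℝ secMat) y0 c1 w
  have hR := eq_sub_of_add_eq hc2
  set R := fderiv ℝ (fderiv ℝ secMat) y0 c1 c1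
  set W := fderiv ℝ secMat y0 w
  rw [hR, hc1]
  have hpX : projM (Z + k₁) = Z := by rw [map_add, hk₁, hZp, add_zero]
  -- The second derivative `R` of the section cancels between the acceleration term and the
  -- derivative of the metric along the curve; only the commutator of `Z` and `k₁` survives.
  have e1 : projM (Z * Z + 2 • (Z * k₁) + k₂ - R) + projM (R - (Z + k₁) * (Z + k₁)) =
      Z * k₁ - k₁ * Z := by
    rw [← projM_commutator hZp hk₁, ← map_add]
    have : Z * Z + 2 • (Z * k₁) + k₂ - R + (R - (Z + k₁) * (Z + k₁)) =
        (Z * k₁ - k₁ * Z) + (k₂ - k₁ * k₁) := by noncomm_ring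
    rw [this, map_add projM (_ - _), map_sub projM k₂, hk₂, projM_mul_eq_zero hk₁ hk₁, sub_zero,
      add_zero]
  have e2 : ((projM (Z * Z + 2 • (Z * k₁) + k₂ - R)) * projM W).trace =
      ((Z * k₁ - k₁ * Z) * W).trace - (projM (R - (Z + k₁) * (Z + k₁)) * projM W).trace := by
    rw [eq_sub_of_add_eq e1, sub_mul, Matrix.trace_sub,
      trace_mul_projM (projM_commutator hZp hk₁)]
  have e3 : (projM (T - W * (Z + k₁)) * Z).trace = ((T - W * (Z + k₁)) * Z).trace := by
    rw [Matrix.trace_mul_comm, trace_mul_projM hZp, Matrix.trace_mul_comm]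
  rw [hpX, e2, e3, trace_mul_projM hZp, trace_mul_projM hZp]
  simp only [mul_add, add_mul, mul_sub, sub_mul, Matrix.trace_add, Matrix.trace_sub, ← mul_assoc]
  -- The remaining terms cancel by cyclicity of the trace, which is where natural reductivity of the
  -- metric enters.
  have t1 : (W * Z * Z).trace = (Z * Z * W).trace := by
    rw [mul_assoc, Matrix.trace_mul_comm]
  have t2 : (Z * W * Z).trace = (Z * Z * W).trace := by
    rw [Matrix.trace_mul_comm, mul_assoc]
  have t3 : (W * k₁ * Z).trace = (k₁ * Z * W).trace := by
    rw [mul_assoc, Matrix.trace_mul_comm]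
  have t4 : (Z * W * k₁).trace = (k₁ * Z * W).trace := by
    rw [Matrix.trace_mul_comm, mul_assoc]
  have t5 : (T * Z).trace = (Z * T).trace := Matrix.trace_mul_comm _ _
  rw [t1, t2, t3, t4, t5]
  ring

/-! ### Surfaces in terms of lifts to `SL(3,ℝ)` -/

theorem horRel_congr {a : SL3} {p q : NKSpace} (h : p = q) (v : E 6) :
    horRel a p v = horRel a q v := by subst h; rfl

theorem horRel_congr_left {a b : SL3} (h : a = b) (p : NKSpace) (v : TangentSpace (𝓡 6) p) :
    horRel a p v = horRel b p v := by rw [h]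

theorem horRel_mfderiv_of_eventuallyEq {X : Type*} [NormedAddCommGroup X] [NormedSpace ℝ X]
    {F : X → NKSpace} {A : X → SL3} {x : X} (hA : ContDiffAt ℝ 1 (fun y => (A y : Mat3)) x)
    (hF : F =ᶠ[𝓝 x] fun y => cls (A y)) (w : X) :
    horRel (A x) (F x) (mfderiv 𝓘(ℝ, X) (𝓡 6) F x w) =
      projM ((((A x)⁻¹ : SL3) : Mat3) * fderiv ℝ (fun y => (A y : Mat3)) x w) := by
  have h1 := horRel_mfderiv_cls (hA.differentiableAt (by simp)).hasFDerivAt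
    ((contMDiffAt_cls hA).mdifferentiableAt one_ne_zero) w
  have h2 : mfderiv 𝓘(ℝ, X) (𝓡 6) F x w = (mfderiv 𝓘(ℝ, X) (𝓡 6) (fun y => cls (A y)) x w : E 6) :=
    congrArg (fun T : X →L[ℝ] E 6 => T w) hF.mfderiv_eq
  exact ((congrArg (horRel (A x) (F x)) h2).trans (horRel_congr hF.self_of_nhds _)).trans h1

/-- The `𝔪`-component of the pull back of the Maurer-Cartan form by `A`. -/
noncomputable def form (A : E 2 → SL3) (y : E 2) : E 2 →ₗ[ℝ] Mat3 :=
  projM ∘ₗ LinearMap.mulLeft ℝ (((A y)⁻¹ : SL3) : Mat3) ∘ₗ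
    (fderiv ℝ (fun z => (A z : Mat3)) y).toLinearMap

theorem form_apply (A : E 2 → SL3) (y v : E 2) :
    form A y v = projM ((((A y)⁻¹ : SL3) : Mat3) * fderiv ℝ (fun z => (A z : Mat3)) y v) := rfl

/-- The lift to `SL(3,ℝ)` of a totally geodesic almost complex surface. -/
structure IsSurfaceLift (A : E 2 → SL3) (O : Set (E 2)) : Prop where
  isOpen : IsOpen O
  smooth : ∀ y ∈ O, ContDiffAt ℝ ∞ (fun z => (A z : Mat3)) y
  inj : ∀ y ∈ O, Function.Injective (form A y)
  almostComplex : ∀ y ∈ O, ∀ v, ∃ w, J0 (form A y v) = form A y w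
  geodesic : ∀ y ∈ O, ∀ v, ∀ U ∈ 𝓝 y, ∀ᶠ t : ℝ in 𝓝 0,
    ∃ z ∈ U, cls (A y * expSL (t • form A y v)) = cls (A z)

theorem horRel_curve (a : SL3) {X : Mat3} (hX : projM X = X) :
    horRel a _ (mfderiv 𝓘(ℝ, ℝ) (𝓡 6) (fun t : ℝ => cls (a * expSL (t • X))) 0 (1 : ℝ)) = X := by
  have hX0 := trace_of_projM hX
  have h1 := horRel_mfderiv_cls (hasDerivAt_mul_expSL a hX0 0).hasFDerivAt
    ((contMDiffAt_cls (contDiff_mul_expSL a hX0).contDiffAt).mdifferentiableAt (by simp)) (1 : ℝ)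
  have h0 : a * expSL ((0 : ℝ) • X) = a := by rw [zero_smul, expSL_zero, mul_one]
  refine (horRel_congr_left h0.symm _ _).trans (h1.trans ?_)
  rw [h0]
  change projM (((a⁻¹ : SL3) : Mat3) * ((1 : ℝ) • ((a : Mat3) * X))) = X
  rw [one_smul, coe_inv_mul_cancel, hX]

section Reduction

variable {S : Type*} [TopologicalSpace S] [ChartedSpace (E 2) S] [IsManifold (𝓡 2) ∞ S]
  {f : S → NKSpace}

/-- The lift is the inverse chart of `S`, followed by `f` and by a local section over the chart at
`f p`. The hypothesis on geodesics is tested on the curves of `isGeodesicAt_exp` only. -/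
theorem exists_surfaceLift (hf : IsSmoothImmersion (m := 2) (n := 6) f)
    (hgeod : IsTotallyGeodesic (m := 2) g f) (hac : IsAlmostComplex (m := 2) J f) (p : S) :
    ∃ (A : E 2 → SL3) (O : Set (E 2)), IsSurfaceLift A O ∧ O ⊆ (chartAt (E 2) p).target ∧
      chartAt (E 2) p p ∈ O ∧ ∀ y ∈ O, cls (A y) = f ((chartAt (E 2) p).symm y) ∧
        ∀ v : E 2, horRel (A y) _ (mfderiv (𝓡 2) (𝓡 6) f ((chartAt (E 2) p).symm y)
          (mfderiv (𝓡 2) (𝓡 2) (chartAt (E 2) p).symm y v)) = form A y v := by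
  set φ := chartAt (E 2) p with hφ
  set q := f p with hq
  have hφm : φ ∈ IsManifold.maximalAtlas (𝓡 2) ∞ S := IsManifold.chart_mem_maximalAtlas p
  have hφd : φ.MDifferentiable (𝓡 2) (𝓡 2) := mdifferentiable_chart p
  set A : E 2 → SL3 := fun y => q.out * secSL (coordQ (q.out⁻¹ • f (φ.symm y))) with hA
  set O : Set (E 2) := φ.target ∩ φ.symm ⁻¹' (f ⁻¹' (chartAt (E 6) q).source) with hO
  have hfc : Continuous f := hf.1.continuous
  have hOopen : IsOpen O := φ.symm.continuousOn.isOpen_inter_preimage φ.open_target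
    ((chartAt (E 6) q).open_source.preimage hfc)
  have hcls : ∀ y ∈ O, cls (A y) = f (φ.symm y) := by
    intro y hy
    rw [hA]
    simp only
    rw [← chart_symm_eq, ← chart_eq]
    exact (extChartAt (𝓡 6) q).left_inv (by rw [extChartAt_source]; exact hy.2)
  have hsm : ∀ y ∈ O, ContDiffAt ℝ ∞ (fun z => (A z : Mat3)) y := by
    intro y hy
    have h1 : ContMDiffAt (𝓡 2) (𝓡 2) ∞ φ.symm y :=
      (contMDiffOn_symm_of_mem_maximalAtlas hφm).contMDiffAt (φ.open_target.mem_nhds hy.1)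
    have h2 : ContMDiffAt (𝓡 2) (𝓡 6) ∞ f (φ.symm y) := hf.1 _
    have h3 : ContMDiffAt (𝓡 6) (𝓡 6) ∞ (extChartAt (𝓡 6) q) (f (φ.symm y)) :=
      contMDiffAt_extChartAt' hy.2
    have h4 : ContDiffAt ℝ ∞ (fun z => coordQ (q.out⁻¹ • f (φ.symm z))) y :=
      (ContMDiffAt.comp (g := extChartAt (𝓡 6) q) (f := f ∘ φ.symm) y h3
        (ContMDiffAt.comp (g := f) (f := φ.symm) y h2 h1)).contDiffAt
    have h5 : 0 < detFun (coordQ (q.out⁻¹ • f (φ.symm y))) := (chartFrom q.out).map_source hy.2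
    have h6 := ContDiffAt.comp (g := fun z => (secSL z : Mat3)) y (contDiffAt_coe_secSL h5) h4
    simp only [hA, Matrix.SpecialLinearGroup.coe_mul]
    exact contDiffAt_const.mul h6
  have hform : ∀ y ∈ O, ∀ v : E 2, horRel (A y) _ (mfderiv (𝓡 2) (𝓡 6) f (φ.symm y)
      (mfderiv (𝓡 2) (𝓡 2) φ.symm y v)) = form A y v := by
    intro y hy v
    have h1 := horRel_mfderiv_of_eventuallyEq (F := fun z => f (φ.symm z))
      ((hsm y hy).of_le (by simp)) (by
      filter_upwards [hOopen.mem_nhds hy] with z hz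
      exact (hcls z hz).symm) v
    have h2 := mfderiv_comp (I := 𝓡 2) (I' := 𝓡 2) (I'' := 𝓡 6) y (g := f) (f := φ.symm)
      ((hf.1 (φ.symm y)).mdifferentiableAt (by simp)) (hφd.mdifferentiableAt_symm hy.1)
    exact (congrArg (fun T : E 2 →L[ℝ] E 6 => horRel (A y) (f (φ.symm y)) (T v)) h2.symm).trans h1
  have hbij : ∀ y ∈ O, Function.Bijective (mfderiv (𝓡 2) (𝓡 2) φ.symm y) :=
    fun y hy => hφd.symm.mfderiv_bijective hy.1
  refine ⟨A, O, ⟨hOopen, hsm, ?_, ?_, ?_⟩, fun y hy => hy.1,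
    ⟨mem_chart_target _ p, ?_⟩, fun y hy => ⟨hcls y hy, hform y hy⟩⟩
  · intro y hy v w hvw
    rw [← hform y hy, ← hform y hy] at hvw
    exact (hbij y hy).1 (hf.2 _ (horRel_injective _ _ hvw))
  · intro y hy v
    obtain ⟨w, hw⟩ := hac (φ.symm y) (mfderiv (𝓡 2) (𝓡 2) φ.symm y v)
    obtain ⟨w', rfl⟩ := (hbij y hy).2 w
    refine ⟨w', ?_⟩
    exact (congrArg J0 (hform y hy v).symm).trans ((horRel_J (hcls y hy) _).symm.trans
      ((congrArg _ hw).trans (hform y hy w')))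
  · intro y hy v U hU
    set X := form A y v with hX
    have hXp : projM X = X := projM_projM _
    have hx : φ.symm y ∈ φ.source := φ.map_target hy.1
    -- Intersecting with `O` ensures that the point of the surface provided by `hgeod` has
    -- coordinates at which `A` is a lift.
    have hU' : φ ⁻¹' (U ∩ O) ∩ φ.source ∈ 𝓝 (φ.symm y) := by
      refine Filter.inter_mem ((φ.continuousAt hx).preimage_mem_nhds ?_) (φ.open_source.mem_nhds hx)
      rw [φ.right_inv hy.1]
      exact Filter.inter_mem hU (hOopen.mem_nhds hy)
    have hγ0 : cls (A y * expSL ((0 : ℝ) • X)) = f (φ.symm y) := by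
      rw [zero_smul, expSL_zero, mul_one, hcls y hy]
    have key := hgeod (φ.symm y) (mfderiv (𝓡 2) (𝓡 2) φ.symm y v) 1
      (fun t : ℝ => cls (A y * expSL (t • X))) one_pos
      (fun t _ => isGeodesicAt_exp _ hXp t) (by
        refine Bundle.TotalSpace.ext hγ0 (heq_of_eq ?_)
        change (mfderiv 𝓘(ℝ, ℝ) (𝓡 6) (fun t : ℝ => cls (A y * expSL (t • X))) 0 (1 : ℝ) : E 6) =
          (mfderiv (𝓡 2) (𝓡 6) f (φ.symm y) (mfderiv (𝓡 2) (𝓡 2) φ.symm y v) : E 6)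
        refine horRel_injective (A y) (f (φ.symm y)) ?_
        refine Eq.trans ?_ (hform y hy v).symm
        rw [← hX]
        exact (horRel_congr hγ0.symm _).trans (horRel_curve (A y) hXp)) _ hU'
    filter_upwards [key] with t ht
    obtain ⟨x, ⟨hx1, hx2⟩, hx3⟩ := ht
    refine ⟨φ x, hx1.1, ?_⟩
    rw [hcls _ hx1.2, φ.left_inv hx2, hx3]
  · refine Set.mem_preimage.2 (Set.mem_preimage.2 ?_)
    rw [φ.left_inv (mem_chart_source _ p)]
    exact mem_chart_source _ _

end Reduction

/-! ### Geodesics in a totally geodesic surface -/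

theorem Ad_horRel {a b : SL3} {p q : NKSpace} (h : p = q) (v : E 6) :
    Ad (a⁻¹ * b) (horRel b q v) = horRel a p v := by
  subst h
  change Ad (a⁻¹ * b) (Ad (b⁻¹ * p.out) (hor p v)) = Ad (a⁻¹ * p.out) (hor p v)
  rw [← Ad_mul, mul_assoc, mul_inv_cancel_left]

section Coordinates

variable {X₁ X₂ : Type*} [NormedAddCommGroup X₁] [NormedSpace ℝ X₁] [NormedAddCommGroup X₂]
  [NormedSpace ℝ X₂]

theorem fderiv_coordFun_eq_mfderiv {C : X₁ → SL3} {x : X₁}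
    (hC : ContDiffAt ℝ 1 (fun y => (C y : Mat3)) x) (hd : dom (C x : Mat3)) (w : X₁) :
    fderiv ℝ (fun y => coordFun (C y : Mat3)) x w =
      mfderiv (𝓡 6) (𝓡 6) (chartFrom 1) (cls (C x))
        (mfderiv 𝓘(ℝ, X₁) (𝓡 6) (fun y => cls (C y)) x w) := by
  have he : (chartFrom 1).MDifferentiable (𝓡 6) (𝓡 6) := mdifferentiable_of_mem_atlas ⟨1, rfl⟩
  have hs : cls (C x) ∈ (chartFrom 1).source := by
    change (1 : SL3)⁻¹ • cls (C x) ∈ baseChart.source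
    rw [smul_cls]
    exact ⟨_, by simpa using hd, rfl⟩
  have hfun : (fun y => coordFun (C y : Mat3)) = (chartFrom 1) ∘ fun y => cls (C y) := by
    funext y
    change _ = coordQ ((1 : SL3)⁻¹ • cls (C y))
    rw [inv_one, one_smul, coordQ_cls]
  have h := mfderiv_comp (I := 𝓘(ℝ, X₁)) (I' := 𝓡 6) (I'' := 𝓡 6) x (g := chartFrom 1)
    (f := fun y => cls (C y)) (he.mdifferentiableAt hs)
    ((contMDiffAt_cls hC).mdifferentiableAt one_ne_zero)
  rw [hfun, ← mfderiv_eq_fderiv]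
  exact congrArg (fun T : X₁ →L[ℝ] E 6 => T w) h

/-- Comparison of the derivatives of the affine coordinates of two maps that agree at a point. -/
theorem fderiv_coordFun_eq_iff {C₁ : X₁ → SL3} {x₁ : X₁} {C₂ : X₂ → SL3} {x₂ : X₂}
    (h₁ : ContDiffAt ℝ 1 (fun y => (C₁ y : Mat3)) x₁)
    (h₂ : ContDiffAt ℝ 1 (fun y => (C₂ y : Mat3)) x₂)
    (hd : dom (C₁ x₁ : Mat3)) (h : cls (C₁ x₁) = cls (C₂ x₂)) (w₁ : X₁) (w₂ : X₂) :
    fderiv ℝ (fun y => coordFun (C₁ y : Mat3)) x₁ w₁ =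
        fderiv ℝ (fun y => coordFun (C₂ y : Mat3)) x₂ w₂ ↔
      projM ((((C₁ x₁)⁻¹ : SL3) : Mat3) * fderiv ℝ (fun y => (C₁ y : Mat3)) x₁ w₁) =
        Ad ((C₁ x₁)⁻¹ * C₂ x₂)
          (projM ((((C₂ x₂)⁻¹ : SL3) : Mat3) * fderiv ℝ (fun y => (C₂ y : Mat3)) x₂ w₂)) := by
  have he : (chartFrom 1).MDifferentiable (𝓡 6) (𝓡 6) := mdifferentiable_of_mem_atlas ⟨1, rfl⟩
  have hs : cls (C₁ x₁) ∈ (chartFrom 1).source := by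
    change (1 : SL3)⁻¹ • cls (C₁ x₁) ∈ baseChart.source
    rw [smul_cls]
    exact ⟨_, by simpa using hd, rfl⟩
  have hinj := he.mfderiv_injective hs
  rw [fderiv_coordFun_eq_mfderiv h₁ hd, fderiv_coordFun_eq_mfderiv h₂ (dom_congr h hd)]
  have k₁ := horRel_mfderiv_of_eventuallyEq (F := fun y => cls (C₁ y)) h₁ .rfl w₁
  have k₂ := horRel_mfderiv_of_eventuallyEq (F := fun y => cls (C₂ y)) h₂ .rfl w₂
  rw [← k₁, ← k₂]
  generalize (mfderiv 𝓘(ℝ, X₁) (𝓡 6) (fun y => cls (C₁ y)) x₁ w₁ : E 6) = v₁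
  generalize (mfderiv 𝓘(ℝ, X₂) (𝓡 6) (fun y => cls (C₂ y)) x₂ w₂ : E 6) = v₂
  have hq : mfderiv (𝓡 6) (𝓡 6) (chartFrom 1) (cls (C₂ x₂)) v₂ =
      (mfderiv (𝓡 6) (𝓡 6) (chartFrom 1) (cls (C₁ x₁)) v₂ : E 6) := by rw [h]
  have hR : Ad ((C₁ x₁)⁻¹ * C₂ x₂) (horRel (C₂ x₂) (cls (C₂ x₂)) v₂) =
      horRel (C₁ x₁) (cls (C₁ x₁)) v₂ := Ad_horRel h v₂
  rw [hR]
  constructor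
  · intro h'
    exact congrArg _ (hinj (h'.trans hq))
  · intro h'
    have h'' : v₁ = v₂ := horRel_injective _ _ h'
    rw [h'']
    exact hq.symm

end Coordinates

/-- The Maurer-Cartan form is left invariant, so a lift can be translated until it passes through
the identity. -/
theorem IsSurfaceLift.mul_left {A : E 2 → SL3} {O : Set (E 2)} (h : IsSurfaceLift A O) (a : SL3) :
    (∀ y ∈ O, form (fun z => a * A z) y = form A y) ∧ IsSurfaceLift (fun z => a * A z) O := by
  have hform : ∀ y ∈ O, form (fun z => a * A z) y = form A y := by
    intro y hy
    ext1 v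
    rw [form_apply, form_apply]
    have h1 : fderiv ℝ (fun z => ((a * A z : SL3) : Mat3)) y v =
        (a : Mat3) * fderiv ℝ (fun z => (A z : Mat3)) y v := by
      have h2 := ((ContinuousLinearMap.mul ℝ Mat3 (a : Mat3)).hasFDerivAt).comp y
        ((h.smooth y hy).differentiableAt (by simp)).hasFDerivAt
      simp only [Matrix.SpecialLinearGroup.coe_mul]
      exact congrArg (fun T : E 2 →L[ℝ] Mat3 => T v) h2.fderiv
    rw [h1, mul_inv_rev, Matrix.SpecialLinearGroup.coe_mul, mul_assoc, coe_inv_mul_cancel]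
  refine ⟨hform, h.isOpen, ?_, ?_, ?_, ?_⟩
  · intro y hy
    simp only [Matrix.SpecialLinearGroup.coe_mul]
    exact contDiffAt_const.mul (h.smooth y hy)
  · intro y hy
    rw [hform y hy]
    exact h.inj y hy
  · intro y hy
    rw [hform y hy]
    exact h.almostComplex y hy
  · intro y hy v U hU
    rw [hform y hy]
    filter_upwards [h.geodesic y hy v U hU] with t ht
    obtain ⟨z, hz, hz'⟩ := ht
    refine ⟨z, hz, ?_⟩
    rw [mul_assoc, ← smul_cls, hz', smul_cls]

/-- A smooth local left inverse of the affine coordinates of the surface. -/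
theorem IsSurfaceLift.exists_retraction {A : E 2 → SL3} {O : Set (E 2)} (h : IsSurfaceLift A O)
    {x : E 2} (hx : x ∈ O) (hA : A x = 1) :
    ∃ ρ : E 6 → E 2, ContDiffAt ℝ 1 ρ y0 ∧ ∀ᶠ y in 𝓝 x, ρ (coordFun (A y : Mat3)) = y := by
  have hd : dom (A x : Mat3) := by rw [hA]; exact dom_one
  have hG : ContDiffAt ℝ 1 (fun y => coordFun (A y : Mat3)) x :=
    ContDiffAt.comp (g := coordFun) x ((contDiffAt_coordFun_id hd).of_le (by simp))
      ((h.smooth x hx).of_le (by simp))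
  set G := fun y => coordFun (A y : Mat3) with hGdef
  have hinj : Function.Injective (fderiv ℝ G x).toLinearMap := by
    intro v w hvw
    have := (fderiv_coordFun_eq_iff ((h.smooth x hx).of_le (by simp))
      ((h.smooth x hx).of_le (by simp)) hd rfl v w).1 hvw
    rw [inv_mul_cancel, Ad_one] at this
    exact h.inj x hx this
  -- A linear left inverse `L` of the derivative makes `L' ∘ G` a local diffeomorphism of the plane;
  -- the retraction is its local inverse composed with `L'`.
  obtain ⟨L, hL⟩ := (fderiv ℝ G x).toLinearMap.exists_leftInverse_of_injective
    (LinearMap.ker_eq_bot.2 hinj)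
  set L' : E 6 →L[ℝ] E 2 := L.toContinuousLinearMap with hL'
  have hLG : ContDiffAt ℝ 1 (L' ∘ G) x := L'.contDiff.contDiffAt.comp x hG
  have hder : HasFDerivAt (L' ∘ G) ((ContinuousLinearEquiv.refl ℝ (E 2) : E 2 →L[ℝ] E 2)) x := by
    have h1 := L'.hasFDerivAt.comp x (hG.differentiableAt one_ne_zero).hasFDerivAt
    refine h1.congr_fderiv ?_
    ext1 v
    exact congrArg (fun T => T v) hL
  refine ⟨hLG.localInverse hder one_ne_zero ∘ L', ?_, ?_⟩
  · have h1 := hLG.to_localInverse hder one_ne_zero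
    have h2 : (L' ∘ G) x = L' y0 := by
      simp only [Function.comp_apply, hGdef, hA]
      exact congrArg L' coordFun_one
    rw [h2] at h1
    exact h1.comp y0 L'.contDiff.contDiffAt
  · exact (hLG.hasStrictFDerivAt' hder one_ne_zero).eventually_left_inverse

/-- `[b]` lies on the surface, at the point provided by the retraction `ρ`, and its tangent plane
there is the translate of `W` by `b`. -/
def IsOnSurface (A : E 2 → SL3) (ρ : E 6 → E 2) (W : Submodule ℝ Mat3) (b : SL3) : Prop :=
  cls b = cls (A (ρ (coordFun (b : Mat3)))) ∧ ∀ X ∈ W, ∃ v,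
    form A (ρ (coordFun (b : Mat3))) v = Ad ((A (ρ (coordFun (b : Mat3))))⁻¹ * b) X

/-- The coordinates in which the retraction is well behaved. -/
def retractDomain (A : E 2 → SL3) (O : Set (E 2)) (ρ : E 6 → E 2) : Set (E 6) :=
  {η | ContDiffAt ℝ 1 ρ η ∧ ρ η ∈ O ∧ dom (A (ρ η) : Mat3) ∧ ∀ᶠ y in 𝓝 (ρ η), ρ (coordFun (A y : Mat3)) = y}

/-! ### Continuation of tangent geodesics inside the surface -/

section Transport

variable {A : E 2 → SL3} {O : Set (E 2)} {ρ : E 6 → E 2}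

theorem continuousAt_deriv_of_contDiffAt {F : Type*} [NormedAddCommGroup F] [NormedSpace ℝ F]
    {c : ℝ → F} {t : ℝ} (hc : ContDiffAt ℝ 1 c t) : ContinuousAt (deriv c) t := by
  have h := ((hc.fderiv_right (m := 0) (by simp)).clm_apply
    (contDiffAt_const (c := (1 : ℝ)))).continuousAt
  exact h

theorem retractDomain_mem_nhds (h : IsSurfaceLift A O) {x : E 2} (hx : x ∈ O) (hA : A x = 1)
    (hρ : ContDiffAt ℝ 1 ρ y0) (hρ' : ∀ᶠ y in 𝓝 x, ρ (coordFun (A y : Mat3)) = y) :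
    ρ y0 = x ∧ retractDomain A O ρ ∈ 𝓝 y0 := by
  have h0 : ρ y0 = x := by
    have := hρ'.self_of_nhds
    rwa [hA, show coordFun ((1 : SL3) : Mat3) = y0 from coordFun_one] at this
  refine ⟨h0, ?_⟩
  have hc := hρ.continuousAt
  rw [ContinuousAt, h0] at hc
  have hd : ∀ᶠ y in 𝓝 x, dom (A y : Mat3) := (continuousAt_SL.2
    (h.smooth x hx).continuousAt).eventually (isOpen_dom.mem_nhds (by
      rw [hA]; exact dom_one))
  filter_upwards [hρ.eventually (by simp), hc.eventually (h.isOpen.mem_nhds hx),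
    hc.eventually hρ'.eventually_nhds, hc.eventually hd] with η h1 h2 h3 h4
  exact ⟨h1, h2, h4, h3⟩

/-- The derivative condition for a one-parameter family to be tangent to the surface. -/
theorem exists_form_eq_of_deriv_eq (h : IsSurfaceLift A O) (b : SL3) {X : Mat3} (hX : projM X = X) (s : ℝ)
    (hd : dom ((b * expSL (s • X) : SL3) : Mat3))
    (hN : coordFun ((b * expSL (s • X) : SL3) : Mat3) ∈ retractDomain A O ρ)
    (hc : cls (b * expSL (s • X)) = cls (A (ρ (coordFun ((b * expSL (s • X) : SL3) : Mat3)))))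
    (hderiv : deriv (fun r : ℝ => coordFun (A (ρ (coordFun
        ((b * expSL (r • X) : SL3) : Mat3))) : Mat3)) s =
      deriv (fun r : ℝ => coordFun ((b * expSL (r • X) : SL3) : Mat3)) s) :
    ∃ v, form A (ρ (coordFun ((b * expSL (s • X) : SL3) : Mat3))) v =
      Ad ((A (ρ (coordFun ((b * expSL (s • X) : SL3) : Mat3))))⁻¹ * (b * expSL (s • X))) X := by
  have hX0 := trace_of_projM hX
  set C : ℝ → SL3 := fun r => b * expSL (r • X) with hC
  have hC1 : ContDiffAt ℝ 1 (fun r => (C r : Mat3)) s :=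
    (contDiff_mul_expSL b hX0).contDiffAt.of_le (by simp)
  have hk : ContDiffAt ℝ 1 (fun r => coordFun (C r : Mat3)) s :=
    ContDiffAt.comp (g := coordFun) s ((contDiffAt_coordFun_id hd).of_le (by simp)) hC1
  have hρk : ContDiffAt ℝ 1 (fun r => ρ (coordFun (C r : Mat3))) s :=
    ContDiffAt.comp (g := ρ) s hN.1 hk
  have hA1 : ContDiffAt ℝ 1 (fun y => (A y : Mat3)) (ρ (coordFun (C s : Mat3))) :=
    (h.smooth _ hN.2.1).of_le (by simp)
  have hD : ContDiffAt ℝ 1 (fun r => (A (ρ (coordFun (C r : Mat3))) : Mat3)) s :=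
    ContDiffAt.comp (g := fun y => (A y : Mat3)) s hA1 hρk
  have key := (fderiv_coordFun_eq_iff (C₁ := fun r => A (ρ (coordFun (C r : Mat3)))) (C₂ := C)
    hD hC1 (dom_congr hc hd) hc.symm (1 : ℝ) (1 : ℝ)).1 hderiv
  have hCX : projM ((((C s)⁻¹ : SL3) : Mat3) * fderiv ℝ (fun r => (C r : Mat3)) s (1 : ℝ)) = X := by
    have h1 : fderiv ℝ (fun r => (C r : Mat3)) s (1 : ℝ) = (C s : Mat3) * X :=
      (hasDerivAt_mul_expSL b hX0 s).deriv
    rw [h1, coe_inv_mul_cancel, hX]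
  rw [hCX] at key
  refine ⟨fderiv ℝ (fun r => ρ (coordFun (C r : Mat3))) s 1, ?_⟩
  rw [← key, form_apply]
  congr 2
  have h2 := (hA1.differentiableAt one_ne_zero).hasFDerivAt.comp s
    (hρk.differentiableAt one_ne_zero).hasFDerivAt
  exact (congrArg (fun T : ℝ →L[ℝ] Mat3 => T 1) h2.fderiv).symm

/-- A geodesic that starts in the surface, tangentially, stays in it as long as it does not leave
the domain of the retraction. -/
theorem tangent_transport (h : IsSurfaceLift A O) (b : SL3) {X : Mat3} (hX : projM X = X)
    (hd : ∀ s ∈ Set.Icc (0 : ℝ) 1, dom ((b * expSL (s • X) : SL3) : Mat3))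
    (hN : ∀ s ∈ Set.Icc (0 : ℝ) 1,
      coordFun ((b * expSL (s • X) : SL3) : Mat3) ∈ retractDomain A O ρ)
    (hc : cls b = cls (A (ρ (coordFun (b : Mat3)))))
    (hv : ∃ v, form A (ρ (coordFun (b : Mat3))) v = Ad ((A (ρ (coordFun (b : Mat3))))⁻¹ * b) X) :
    cls (b * expSL X) = cls (A (ρ (coordFun ((b * expSL X : SL3) : Mat3)))) ∧
    ∃ v, form A (ρ (coordFun ((b * expSL X : SL3) : Mat3))) v =
      Ad ((A (ρ (coordFun ((b * expSL X : SL3) : Mat3))))⁻¹ * (b * expSL X)) X := by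
  have hX0 := trace_of_projM hX
  set C : ℝ → SL3 := fun r => b * expSL (r • X) with hC
  set κ : ℝ → E 6 := fun r => coordFun (C r : Mat3) with hκ
  set μ : ℝ → E 6 := fun r => coordFun (A (ρ (κ r)) : Mat3) with hμ
  have hC1 : ∀ s, ContDiffAt ℝ 1 (fun r => (C r : Mat3)) s :=
    fun s => (contDiff_mul_expSL b hX0).contDiffAt.of_le (by simp)
  have hκ1 : ∀ s, dom (C s : Mat3) → ContDiffAt ℝ 1 κ s := fun s hs =>
    ContDiffAt.comp (g := coordFun) s ((contDiffAt_coordFun_id hs).of_le (by simp)) (hC1 s)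
  -- near a point of tangency the curve stays in the surface
  have hstep : ∀ s, dom (C s : Mat3) → κ s ∈ retractDomain A O ρ →
      cls (C s) = cls (A (ρ (κ s))) → (∃ v, form A (ρ (κ s)) v = Ad ((A (ρ (κ s)))⁻¹ * C s) X) →
      ∀ᶠ r in 𝓝 s, cls (C r) = cls (A (ρ (κ r))) := by
    rintro s hs hNs hcs ⟨v, hv⟩
    have h1 := h.geodesic _ hNs.2.1 v _ hNs.2.2.2
    rw [hv] at h1
    have h2 : Filter.Tendsto (fun r : ℝ => r - s) (𝓝 s) (𝓝 0) := by
      have : ContinuousAt (fun r : ℝ => r - s) s := by fun_prop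
      simpa [ContinuousAt] using this
    filter_upwards [h2.eventually h1] with r hr
    obtain ⟨z, hz, hz'⟩ := hr
    have hH : (A (ρ (κ s)))⁻¹ * C s ∈ H := QuotientGroup.eq.1 hcs.symm
    -- The geodesics issuing from `A (ρ (κ s))` and from `C s` are the same curve of classes:
    -- passing between the representatives by the element of `H` in `hH` conjugates the direction
    -- accordingly.
    have h3 : cls (C r) = cls (A z) := by
      rw [← hz']
      refine QuotientGroup.eq.2 ?_
      have hCr : C r = C s * expSL ((r - s) • X) := by
        simp only [hC]
        rw [mul_assoc, ← expSL_add_smul hX0, add_sub_cancel]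
      rw [← map_smul, expSL_Ad _ (trace_smul_eq_zero hX0 _), hCr]
      have : (C s * expSL ((r - s) • X))⁻¹ * (A (ρ (κ s)) * ((A (ρ (κ s)))⁻¹ * C s *
          expSL ((r - s) • X) * ((A (ρ (κ s)))⁻¹ * C s)⁻¹)) = ((A (ρ (κ s)))⁻¹ * C s)⁻¹ := by
        group
      rw [this]
      exact H.inv_mem hH
    have h4 : ρ (κ r) = z := by
      have : κ r = coordFun (A z : Mat3) := coordFun_congr h3
      rw [this]
      exact hz
    rw [h3, h4]
  have hμκ : ∀ s, dom (C s : Mat3) → κ s ∈ retractDomain A O ρ →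
      cls (C s) = cls (A (ρ (κ s))) → (∃ v, form A (ρ (κ s)) v = Ad ((A (ρ (κ s)))⁻¹ * C s) X) →
      ∀ᶠ r in 𝓝 s, μ r = κ r ∧ deriv μ r = deriv κ r := by
    intro s hs hNs hcs hvs
    have h1 : μ =ᶠ[𝓝 s] κ := by
      filter_upwards [hstep s hs hNs hcs hvs] with r hr
      exact (coordFun_congr hr).symm
    filter_upwards [h1.eventually_nhds] with r hr
    exact ⟨hr.self_of_nhds, Filter.EventuallyEq.deriv_eq hr⟩
  have hcls : ∀ s ∈ Set.Icc (0 : ℝ) 1, μ s = κ s → cls (C s) = cls (A (ρ (κ s))) := by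
    intro s hs h1
    rw [← cls_secSL _ (hd s hs), ← cls_secSL _ (hN s hs).2.2.1]
    exact congrArg (fun η => cls (secSL η)) h1.symm
  have hμ1 : ∀ s ∈ Set.Icc (0 : ℝ) 1, ContDiffAt ℝ 1 μ s := by
    intro s hs
    have h1 : ContDiffAt ℝ 1 (fun r => ρ (κ r)) s :=
      ContDiffAt.comp (g := ρ) s (hN s hs).1 (hκ1 s (hd s hs))
    have h2 : ContDiffAt ℝ 1 (fun r => (A (ρ (κ r)) : Mat3)) s :=
      ContDiffAt.comp (g := fun y => (A y : Mat3)) s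
        ((h.smooth _ (hN s hs).2.1).of_le (by simp)) h1
    exact ContDiffAt.comp (g := coordFun) s
      ((contDiffAt_coordFun_id (hN s hs).2.2.1).of_le (by simp)) h2
  -- Total geodesy only controls short times, and only from tangency. Agreement of `μ` and `κ` to
  -- first order encodes both conditions; it is closed by continuity, and open by `hμκ`, so it
  -- propagates along `[0, 1]`.
  have hclosed : IsClosed ({s | μ s = κ s ∧ deriv μ s = deriv κ s} ∩ Set.Icc (0 : ℝ) 1) := by
    have hcont : ContinuousOn (fun s => (μ s - κ s, deriv μ s - deriv κ s)) (Set.Icc (0 : ℝ) 1) := by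
      intro s hs
      refine ContinuousAt.continuousWithinAt ?_
      exact ((hμ1 s hs).continuousAt.sub (hκ1 s (hd s hs)).continuousAt).prodMk
        ((continuousAt_deriv_of_contDiffAt (hμ1 s hs)).sub
          (continuousAt_deriv_of_contDiffAt (hκ1 s (hd s hs))))
    have := hcont.preimage_isClosed_of_isClosed isClosed_Icc (isClosed_singleton (x := 0))
    convert this using 1
    ext s
    simp only [Set.mem_inter_iff, Set.mem_preimage, Set.mem_singleton_iff, Prod.mk_eq_zero,
      sub_eq_zero, Set.mem_ofPred_eq]
    exact and_comm
  have h0 : C 0 = b := by simp only [hC]; rw [zero_smul, expSL_zero, mul_one]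
  have hκ0 : κ 0 = coordFun (b : Mat3) := by simp only [hκ]; rw [h0]
  have hstart : μ 0 = κ 0 ∧ deriv μ 0 = deriv κ 0 := by
    refine (hμκ 0 (hd 0 (by simp)) (hN 0 (by simp)) ?_ ?_).self_of_nhds
    · rw [hκ0, h0]; exact hc
    · rw [hκ0, h0]; exact hv
  have hall := hclosed.Icc_subset_of_forall_mem_nhdsWithin hstart (fun s hs => by
    have hs1 : s ∈ Set.Icc (0 : ℝ) 1 := Set.Ico_subset_Icc_self hs.2
    have hcs := hcls s hs1 hs.1.1
    exact mem_nhdsWithin_of_mem_nhds (hμκ s (hd s hs1) (hN s hs1) hcs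
      (exists_form_eq_of_deriv_eq h b hX s (hd s hs1) (hN s hs1) hcs hs.1.2)))
  have h1 : (1 : ℝ) ∈ Set.Icc (0 : ℝ) 1 := by simp
  have hend := hall h1
  have hc1 := hcls 1 h1 hend.1
  have ht1 := exists_form_eq_of_deriv_eq h b hX 1 (hd 1 h1) (hN 1 h1) hc1 hend.2
  simp only [hκ, hC, one_smul] at hc1 ht1
  exact ⟨hc1, ht1⟩

end Transport

/-! ### Complex planes in `𝔪` -/

/-- A complex line in `𝔪`, as a real plane. -/
structure IsComplexPlane (W : Submodule ℝ Mat3) : Prop where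
  finrank_eq : Module.finrank ℝ W = 2
  projM_eq_self : ∀ X ∈ W, projM X = X
  J0_mem : ∀ X ∈ W, J0 X ∈ W

/-- Multiplication by the conjugate: `(a - b J)(a + b J) = a² + b²` on `𝔪`. -/
theorem smul_J0_eq_zero {X : Mat3} (hX : projM X = X) {a b : ℝ} (h : a • X + b • J0 X = 0) :
    (a ^ 2 + b ^ 2) • X = 0 := by
  have h2 : a • J0 X - b • X = 0 := by
    have := congrArg J0L h
    rw [map_add, map_smul, map_smul, map_zero, J0L_apply, J0L_apply, J0_J0, hX] at this
    rw [← this]; module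
  have : (a ^ 2 + b ^ 2) • X = a • (a • X + b • J0 X) - b • (a • J0 X - b • X) := by module
  rw [this, h, h2, smul_zero, smul_zero, sub_zero]

theorem linearIndependent_J0 {X : Mat3} (hX : projM X = X) (h0 : X ≠ 0) :
    LinearIndependent ℝ ![X, J0 X] := by
  rw [LinearIndependent.pair_iff]
  intro a b hab
  have h1 := smul_J0_eq_zero hX hab
  rcases smul_eq_zero.1 h1 with h | h
  · constructor <;> nlinarith [sq_nonneg a, sq_nonneg b]
  · exact absurd h h0

theorem IsComplexPlane.eq_span {W : Submodule ℝ Mat3} (hW : IsComplexPlane W) {X : Mat3}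
    (hX : X ∈ W) (h0 : X ≠ 0) : W = Submodule.span ℝ {X, J0 X} := by
  symm
  refine Submodule.eq_of_le_of_finrank_eq ?_ ?_
  · rw [Submodule.span_le]
    rintro Y (rfl | rfl)
    · exact hX
    · exact hW.J0_mem _ hX
  · rw [hW.finrank_eq]
    have := finrank_span_eq_card (linearIndependent_J0 (hW.projM_eq_self X hX) h0)
    rw [Matrix.range_cons_cons_empty] at this
    simpa using this

theorem IsComplexPlane.exists_eq {W : Submodule ℝ Mat3} (hW : IsComplexPlane W) {X Z : Mat3}
    (hX : X ∈ W) (h0 : X ≠ 0) (hZ : Z ∈ W) : ∃ a b : ℝ, Z = a • X + b • J0 X := by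
  rw [hW.eq_span hX h0, Submodule.mem_span_pair] at hZ
  obtain ⟨a, b, h⟩ := hZ
  exact ⟨a, b, h.symm⟩

theorem IsSurfaceLift.isComplexPlane {A : E 2 → SL3} {O : Set (E 2)} (h : IsSurfaceLift A O)
    {y : E 2} (hy : y ∈ O) : IsComplexPlane (LinearMap.range (form A y)) where
  finrank_eq := by
    rw [LinearMap.finrank_range_of_inj (h.inj y hy)]
    simp
  projM_eq_self := by
    rintro _ ⟨v, rfl⟩
    exact projM_projM _
  J0_mem := by
    rintro _ ⟨v, rfl⟩
    obtain ⟨w, hw⟩ := h.almostComplex y hy v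
    exact ⟨w, hw.symm⟩

/-! ### Transport of tangent planes and the Lie triple property -/

section OnSurface

variable {A : E 2 → SL3} {O : Set (E 2)} {ρ : E 6 → E 2} {W : Submodule ℝ Mat3}

/-- `IsOnSurface` only places the translate of `W` inside the tangent plane; both have dimension
two, so they coincide. -/
theorem IsOnSurface.exists_mem (h : IsSurfaceLift A O) (hW : IsComplexPlane W) {b : SL3}
    (hb : IsOnSurface A ρ W b) (hN : coordFun (b : Mat3) ∈ retractDomain A O ρ) (v : E 2) :
    ∃ X ∈ W, form A (ρ (coordFun (b : Mat3))) v =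
      Ad ((A (ρ (coordFun (b : Mat3))))⁻¹ * b) X := by
  set y := ρ (coordFun (b : Mat3)) with hy
  set k := (A y)⁻¹ * b with hk
  have hle : W.map (Ad k) ≤ LinearMap.range (form A y) := by
    rintro _ ⟨X, hX, rfl⟩
    obtain ⟨w, hw⟩ := hb.2 X hX
    exact ⟨w, hw⟩
  have heq := Submodule.eq_of_le_of_finrank_eq hle (by
    rw [(h.isComplexPlane hN.2.1).finrank_eq, ← hW.finrank_eq]
    exact (Submodule.equivMapOfInjective (Ad k) (Ad_injective k) W).finrank_eq.symm)
  have : form A y v ∈ W.map (Ad k) := by rw [heq]; exact ⟨v, rfl⟩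
  obtain ⟨X, hX, hX'⟩ := this
  exact ⟨X, hX, hX'.symm⟩

/-- Tangency is transported for the single direction `X` of the geodesic. The tangent plane is
`J`-invariant and `W` is spanned by `X` and `J X`, so the whole plane follows; this is where almost
complexity replaces an argument about parallel transport. -/
theorem IsOnSurface.mul_expSL (h : IsSurfaceLift A O) (hW : IsComplexPlane W) {b : SL3}
    (hb : IsOnSurface A ρ W b) {X : Mat3} (hX : X ∈ W)
    (hd : ∀ s ∈ Set.Icc (0 : ℝ) 1, dom ((b * expSL (s • X) : SL3) : Mat3))
    (hN : ∀ s ∈ Set.Icc (0 : ℝ) 1,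
      coordFun ((b * expSL (s • X) : SL3) : Mat3) ∈ retractDomain A O ρ) :
    IsOnSurface A ρ W (b * expSL X) := by
  rcases eq_or_ne X 0 with rfl | h0
  · rwa [expSL_zero, mul_one]
  have hXp := hW.projM_eq_self X hX
  obtain ⟨hc, v, hv⟩ := tangent_transport h b hXp hd hN hb.1 (hb.2 X hX)
  refine ⟨hc, fun Z hZ => ?_⟩
  have hN1 := hN 1 (by simp)
  rw [one_smul] at hN1
  have hk : (A (ρ (coordFun ((b * expSL X : SL3) : Mat3))))⁻¹ * (b * expSL X) ∈ H :=
    QuotientGroup.eq.1 hc.symm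
  obtain ⟨w, hw⟩ := h.almostComplex _ hN1.2.1 v
  obtain ⟨r, s, rfl⟩ := hW.exists_eq hX h0 hZ
  refine ⟨r • v + s • w, ?_⟩
  rw [map_add, map_smul, map_smul, ← hw, hv, J0_Ad hk, map_add, map_smul, map_smul]

theorem isOnSurface_one {x : E 2} (hA : A x = 1) (h0 : ρ y0 = x) :
    IsOnSurface A ρ (LinearMap.range (form A x)) 1 := by
  have h1 : ρ (coordFun ((1 : SL3) : Mat3)) = x := by
    rw [← h0]; exact congrArg ρ coordFun_one
  rw [IsOnSurface, h1]
  refine ⟨by rw [hA], ?_⟩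
  rintro _ ⟨v, rfl⟩
  exact ⟨v, by rw [hA, inv_one, one_mul, Ad_one]⟩

theorem eventually_dom_one : ∀ᶠ M : Mat3 in 𝓝 1, dom M := by
  have h : ∀ i j, Continuous (fun M : Mat3 => M i j) := fun i j => (entryL i j).continuous
  have hn : Continuous nrm := ((h 0 0).pow 2).add ((h 0 1).pow 2)
  exact ((isOpen_lt continuous_const hn).inter (isOpen_lt continuous_const (h 2 2))).mem_nhds
    dom_one

/-- Near `[Id]`, all two-step geodesics with directions in the initial tangent plane stay in the
surface. -/
theorem exists_isOnSurface_exp (h : IsSurfaceLift A O) {x : E 2} (hx : x ∈ O) (hA : A x = 1)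
    (hρ : ContDiffAt ℝ 1 ρ y0) (hρ' : ∀ᶠ y in 𝓝 x, ρ (coordFun (A y : Mat3)) = y) :
    ∃ δ > 0, ∀ X ∈ LinearMap.range (form A x), ∀ Y ∈ LinearMap.range (form A x), ‖X‖ < δ →
      ‖Y‖ < δ → IsOnSurface A ρ (LinearMap.range (form A x)) (expSL X * expSL Y) ∧
        dom ((expSL X * expSL Y : SL3) : Mat3) ∧
        coordFun ((expSL X * expSL Y : SL3) : Mat3) ∈ retractDomain A O ρ := by
  obtain ⟨h0, hN⟩ := retractDomain_mem_nhds h hx hA hρ hρ'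
  have hW := h.isComplexPlane hx
  set W := LinearMap.range (form A x) with hWdef
  have hc : ContinuousAt coordFun (1 : Mat3) := (contDiffAt_coordFun_id dom_one).continuousAt
  rw [ContinuousAt, coordFun_one] at hc
  have h1 : ∀ᶠ M : Mat3 in 𝓝 1, dom M ∧ coordFun M ∈ retractDomain A O ρ :=
    eventually_dom_one.and (hc.eventually hN)
  have h2 : Continuous (fun p : Mat3 × Mat3 => NormedSpace.exp p.1 * NormedSpace.exp p.2) :=
    ((contDiff_exp (n := 0)).continuous.comp continuous_fst).mul
      ((contDiff_exp (n := 0)).continuous.comp continuous_snd)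
  have h3 := h2.tendsto (0 : Mat3 × Mat3)
  simp only [Prod.fst_zero, Prod.snd_zero, NormedSpace.exp_zero, mul_one] at h3
  obtain ⟨δ, hδ, h4⟩ := Metric.eventually_nhds_iff.1 (h3.eventually h1)
  have h5 : ∀ X ∈ W, ∀ Y ∈ W, ‖X‖ < δ → ‖Y‖ < δ → dom ((expSL X * expSL Y : SL3) : Mat3) ∧
      coordFun ((expSL X * expSL Y : SL3) : Mat3) ∈ retractDomain A O ρ := by
    intro X hX Y hY hX' hY'
    have h6 := @h4 (X, Y) (by
      rw [dist_zero_right, Prod.norm_def]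
      exact max_lt hX' hY')
    rw [Matrix.SpecialLinearGroup.coe_mul, coe_expSL (trace_of_projM (hW.projM_eq_self X hX)),
      coe_expSL (trace_of_projM (hW.projM_eq_self Y hY))]
    exact h6
  have hsm : ∀ s ∈ Set.Icc (0 : ℝ) 1, ∀ X : Mat3, ‖X‖ < δ → ‖s • X‖ < δ := by
    intro s hs X hX
    refine lt_of_le_of_lt ?_ hX
    rw [norm_smul, Real.norm_of_nonneg hs.1]
    exact mul_le_of_le_one_left (norm_nonneg X) hs.2
  refine ⟨δ, hδ, fun X hX Y hY hX' hY' => ⟨?_, h5 X hX Y hY hX' hY'⟩⟩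
  have hzero : ‖(0 : Mat3)‖ < δ := by simpa using hδ
  -- A geodesic from `[Id]` in the direction `X` is followed by one from its endpoint in the
  -- direction `Y`.
  have hXs : IsOnSurface A ρ W (expSL X) := by
    have := (isOnSurface_one hA h0).mul_expSL h hW hX
      (fun s hs => by
        have := (h5 0 W.zero_mem (s • X) (W.smul_mem s hX) hzero (hsm s hs X hX')).1
        rwa [expSL_zero] at this)
      (fun s hs => by
        have := (h5 0 W.zero_mem (s • X) (W.smul_mem s hX) hzero (hsm s hs X hX')).2
        rwa [expSL_zero] at this)
    rwa [one_mul] at this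
  exact hXs.mul_expSL h hW hY
    (fun s hs => (h5 X hX (s • Y) (W.smul_mem s hY) hX' (hsm s hs Y hY')).1)
    (fun s hs => (h5 X hX (s • Y) (W.smul_mem s hY) hX' (hsm s hs Y hY')).2)

/-- The curve `t ↦ [exp (t X) exp Y]` runs in the surface. Relative to the representative `exp Y`,
its velocity at `0` is the given vector, and the tangent plane at that point is `W`. -/
theorem projM_Ad_mem (h : IsSurfaceLift A O) (hW : IsComplexPlane W) {X Y : Mat3} (hX : X ∈ W)
    (hev : ∀ᶠ t : ℝ in 𝓝 0, cls (expSL (t • X) * expSL Y) =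
      cls (A (ρ (coordFun ((expSL (t • X) * expSL Y : SL3) : Mat3)))))
    (hb : IsOnSurface A ρ W (expSL Y)) (hd : dom (expSL Y : Mat3))
    (hN : coordFun (expSL Y : Mat3) ∈ retractDomain A O ρ) :
    projM (Ad (expSL Y)⁻¹ X) ∈ W := by
  set b := expSL Y with hbdef
  have hX0 := trace_of_projM (hW.projM_eq_self X hX)
  set C : ℝ → SL3 := fun t => expSL (t • X) * b with hC
  have hC0 : C 0 = b := by simp only [hC]; rw [zero_smul, expSL_zero, one_mul]
  have hC1 : HasDerivAt (fun t => (C t : Mat3)) (X * (b : Mat3)) 0 := by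
    have h1 := (hasDerivAt_expSL hX0 0).mul_const (b : Mat3)
    simp only [zero_smul, expSL_zero, Matrix.SpecialLinearGroup.coe_one, one_mul] at h1
    exact h1
  have hCs : ContDiffAt ℝ 1 (fun t => (C t : Mat3)) 0 := by
    have h1 := (contDiff_expSL_comp (n := 1) (L := fun s : ℝ => s • X)
      (contDiff_id.smul contDiff_const) fun s => trace_smul_eq_zero hX0 s)
    exact (h1.mul (contDiff_const (c := (b : Mat3)))).contDiffAt
  have hk : ContDiffAt ℝ 1 (fun r => coordFun (C r : Mat3)) 0 :=
    ContDiffAt.comp (g := coordFun) 0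
      ((contDiffAt_coordFun_id (by rw [hC0]; exact hd)).of_le (by simp)) hCs
  have hρk : ContDiffAt ℝ 1 (fun r => ρ (coordFun (C r : Mat3))) 0 :=
    ContDiffAt.comp (g := ρ) 0 (by rw [hC0]; exact hN.1) hk
  have hA1 : ContDiffAt ℝ 1 (fun y => (A y : Mat3)) (ρ (coordFun (C 0 : Mat3))) :=
    (h.smooth _ (by rw [hC0]; exact hN.2.1)).of_le (by simp)
  have hD : ContDiffAt ℝ 1 (fun r => (A (ρ (coordFun (C r : Mat3))) : Mat3)) 0 :=
    ContDiffAt.comp (g := fun y => (A y : Mat3)) 0 hA1 hρk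
  have hcoord : (fun r => coordFun (A (ρ (coordFun (C r : Mat3))) : Mat3)) =ᶠ[𝓝 0]
      fun r => coordFun (C r : Mat3) := by
    filter_upwards [hev] with r hr
    exact (coordFun_congr hr).symm
  have hcls0 := hev.self_of_nhds
  change cls (C 0) = cls (A (ρ (coordFun (C 0 : Mat3)))) at hcls0
  have key := (fderiv_coordFun_eq_iff (C₁ := fun r => A (ρ (coordFun (C r : Mat3)))) (C₂ := C)
    hD hCs (dom_congr hcls0 (by rw [hC0]; exact hd)) hcls0.symm (1 : ℝ) (1 : ℝ)).1
    (by rw [hcoord.fderiv_eq])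
  have h2 := (hA1.differentiableAt one_ne_zero).hasFDerivAt.comp (0 : ℝ)
    (hρk.differentiableAt one_ne_zero).hasFDerivAt
  have h3 : fderiv ℝ (fun r => (A (ρ (coordFun (C r : Mat3))) : Mat3)) 0 (1 : ℝ) =
      fderiv ℝ (fun y => (A y : Mat3)) (ρ (coordFun (C 0 : Mat3)))
        (fderiv ℝ (fun r => ρ (coordFun (C r : Mat3))) 0 1) :=
    congrArg (fun T : ℝ →L[ℝ] Mat3 => T 1) h2.fderiv
  have h4 : fderiv ℝ (fun r => (C r : Mat3)) 0 (1 : ℝ) = X * (b : Mat3) := hC1.deriv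
  rw [h3, h4, ← form_apply, hC0] at key
  obtain ⟨Z, hZ, hZ'⟩ := hb.exists_mem h hW hN
    (fderiv ℝ (fun r => ρ (coordFun (C r : Mat3))) 0 1)
  rw [hZ'] at key
  have h5 := Ad_injective _ key
  have h6 : Ad b⁻¹ X = ((b⁻¹ : SL3) : Mat3) * (X * (b : Mat3)) := by
    rw [Ad_apply, inv_inv, mul_assoc]
  rw [h6, ← h5]
  exact hZ

/-- `W` is the kernel of the projection to a complement, and a linear map commutes with
differentiation. -/
theorem mem_of_hasDerivAt (W : Submodule ℝ Mat3) {c : ℝ → Mat3} {c' : Mat3} {t : ℝ}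
    (hc : HasDerivAt c c' t) (h : ∀ᶠ s in 𝓝 t, c s ∈ W) : c' ∈ W := by
  obtain ⟨Q, hQ⟩ := W.exists_isCompl
  set P : Mat3 →ₗ[ℝ] Mat3 := Q.subtype ∘ₗ Submodule.projectionOnto Q W hQ.symm with hP
  have hker : ∀ M, P M = 0 ↔ M ∈ W := by
    intro M
    rw [hP, LinearMap.comp_apply, Submodule.subtype_apply, Submodule.coe_eq_zero,
      Submodule.projectionOnto_apply_eq_zero_iff]
  have h1 : HasDerivAt (fun s => P (c s)) (P c') t :=
    P.toContinuousLinearMap.hasFDerivAt.comp_hasDerivAt t hc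
  have h2 : HasDerivAt (fun s => P (c s)) 0 t :=
    (hasDerivAt_const t (0 : Mat3)).congr_of_eventuallyEq (by
      filter_upwards [h] with s hs
      exact (hker _).2 hs)
  exact (hker _).1 (h1.unique h2)

/-- The tangent planes of totally geodesic surfaces are Lie triple systems. -/
theorem lieTriple_of_projM_Ad_mem {X Y : Mat3} (hY : Y.trace = 0)
    (h : ∀ᶠ s : ℝ in 𝓝 0, projM (Ad (expSL (s • Y))⁻¹ X) ∈ W) :
    projM ((X * Y - Y * X) * Y - Y * (X * Y - Y * X)) ∈ W := by
  set φ : ℝ → Mat3 := fun s => Ad (expSL (s • Y))⁻¹ X with hφ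
  have hφ' : ∀ s, φ s = (expSL (s • (-Y)) : Mat3) * X * (expSL (s • Y) : Mat3) := by
    intro s
    simp only [hφ]
    rw [Ad_apply, inv_inv, smul_neg, expSL_neg (trace_smul_eq_zero hY s)]
  have hcomm : ∀ s : ℝ, (expSL (s • (-Y)) : Mat3) * Y = Y * (expSL (s • (-Y)) : Mat3) := by
    intro s
    rw [coe_expSL (trace_smul_eq_zero (by simp [hY]) s)]
    exact (((Commute.refl Y).neg_right.smul_right s).exp_right).eq.symm
  -- Since `φ' = [φ, Y]`, the second derivative at `0` is `[[X, Y], Y]`; two derivatives of a curve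
  -- whose `𝔪`-part lies in `W` again have their `𝔪`-part in `W`.
  have hder : ∀ s, HasDerivAt φ (φ s * Y - Y * φ s) s := by
    intro s
    have h1 := (((hasDerivAt_expSL (X := -Y) (by simp [hY]) s).mul_const X).mul
      (hasDerivAt_expSL hY s))
    have h2 : φ = fun s => (expSL (s • (-Y)) : Mat3) * X * (expSL (s • Y) : Mat3) := funext hφ'
    rw [h2]
    refine h1.congr_deriv ?_
    rw [mul_neg, hcomm]
    noncomm_ring
  have hder2 : HasDerivAt (fun s => φ s * Y - Y * φ s)
      ((φ 0 * Y - Y * φ 0) * Y - Y * (φ 0 * Y - Y * φ 0)) 0 :=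
    ((hder 0).mul_const Y).sub ((hder 0).const_mul Y)
  have hφ0 : φ 0 = X := by
    simp only [hφ]
    rw [zero_smul, expSL_zero, inv_one, Ad_one]
  rw [hφ0] at hder2
  have hp : ∀ {c : ℝ → Mat3} {c' : Mat3} {t : ℝ}, HasDerivAt c c' t →
      HasDerivAt (fun s => projM (c s)) (projM c') t := fun hc =>
    projM.toContinuousLinearMap.hasFDerivAt.comp_hasDerivAt _ hc
  refine mem_of_hasDerivAt W (hp hder2) ?_
  filter_upwards [h.eventually_nhds] with s hs
  exact mem_of_hasDerivAt W (hp (hder s)) hs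

end OnSurface

/-- The structure of a totally geodesic almost complex surface near a point. -/
theorem IsSurfaceLift.local_structure_of_one {A : E 2 → SL3} {O : Set (E 2)}
    (h : IsSurfaceLift A O) {x : E 2} (hx : x ∈ O) (hA : A x = 1) :
    (∀ X ∈ LinearMap.range (form A x), ∀ Y ∈ LinearMap.range (form A x),
      projM ((X * Y - Y * X) * Y - Y * (X * Y - Y * X)) ∈ LinearMap.range (form A x)) ∧
    ∀ᶠ y in 𝓝 x, ∃ X ∈ LinearMap.range (form A x), cls (A y) = cls (expSL X) ∧
      ∀ v, ∃ Z ∈ LinearMap.range (form A x), form A y v = Ad ((A y)⁻¹ * expSL X) Z := by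
  obtain ⟨ρ, hρ, hρ'⟩ := h.exists_retraction hx hA
  obtain ⟨h0, hN⟩ := retractDomain_mem_nhds h hx hA hρ hρ'
  obtain ⟨δ, hδ, hexp⟩ := exists_isOnSurface_exp h hx hA hρ hρ'
  have hW := h.isComplexPlane hx
  set W := LinearMap.range (form A x) with hWdef
  have hsmall : ∀ X : Mat3, ∀ᶠ t : ℝ in 𝓝 0, ‖t • X‖ < δ := by
    intro X
    have h1 : Continuous fun t : ℝ => ‖t • X‖ := (continuous_id.smul continuous_const).norm
    have h2 := h1.tendsto 0
    simp only [zero_smul, norm_zero] at h2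
    exact h2.eventually (gt_mem_nhds hδ)
  have hzero : ‖(0 : Mat3)‖ < δ := by simpa using hδ
  refine ⟨fun X hX Y hY => ?_, ?_⟩
  · refine lieTriple_of_projM_Ad_mem (trace_of_projM (hW.projM_eq_self Y hY)) ?_
    filter_upwards [hsmall Y] with s hs
    have h1 := hexp 0 W.zero_mem (s • Y) (W.smul_mem s hY) hzero hs
    rw [expSL_zero, one_mul] at h1
    refine projM_Ad_mem h hW hX ?_ h1.1 h1.2.1 h1.2.2
    filter_upwards [hsmall X] with t ht
    exact (hexp (t • X) (W.smul_mem t hX) (s • Y) (W.smul_mem s hY) ht hs).1.1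
  -- The points `[exp (θ z)]` with `z` small lie on the surface. In the parameters of `A` they are
  -- given by `ρ ∘ coordFun ∘ C`, whose derivative at `0` is the identity, so by the inverse
  -- function theorem they fill a neighbourhood of `x`.
  · set θ := (form A x).toContinuousLinearMap with hθ
    have hθ0 : ∀ z, (θ z).trace = 0 := fun z => trace_of_projM (hW.projM_eq_self _ ⟨z, rfl⟩)
    set C : E 2 → SL3 := fun z => expSL (θ z) with hC
    have hCs : ContDiffAt ℝ 1 (fun z => (C z : Mat3)) 0 :=
      (contDiff_expSL_comp (n := 1) (L := fun z => θ z) θ.contDiff hθ0).contDiffAt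
    have hC0 : C 0 = 1 := by simp only [hC]; rw [map_zero, expSL_zero]
    have hdC : dom (C 0 : Mat3) := by rw [hC0]; exact dom_one
    have hk : ContDiffAt ℝ 1 (fun z => coordFun (C z : Mat3)) 0 :=
      ContDiffAt.comp (g := coordFun) 0 ((contDiffAt_coordFun_id hdC).of_le (by simp)) hCs
    have hκ0 : coordFun (C 0 : Mat3) = y0 := by rw [hC0]; exact coordFun_one
    have hΞ : ContDiffAt ℝ 1 (fun z => ρ (coordFun (C z : Mat3))) 0 :=
      ContDiffAt.comp (g := ρ) 0 (by rw [hκ0]; exact hρ) hk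
    have hAx : ContDiffAt ℝ 1 (fun y => (A y : Mat3)) x := (h.smooth x hx).of_le (by simp)
    have hdA : dom (A x : Mat3) := by rw [hA]; exact dom_one
    have hG : ContDiffAt ℝ 1 (fun y => coordFun (A y : Mat3)) x :=
      ContDiffAt.comp (g := coordFun) x ((contDiffAt_coordFun_id hdA).of_le (by simp)) hAx
    have hGx : coordFun (A x : Mat3) = y0 := by rw [hA]; exact coordFun_one
    have hCd : ∀ z, fderiv ℝ (fun z => (C z : Mat3)) 0 z = θ z := by
      intro z
      have h1 : HasFDerivAt (fun z => (C z : Mat3)) (fderiv ℝ (fun z => (C z : Mat3)) 0) 0 :=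
        (hCs.differentiableAt one_ne_zero).hasFDerivAt
      have h2 : HasDerivAt (fun t : ℝ => t • z) z 0 := by
        simpa using (hasDerivAt_id (0 : ℝ)).smul_const z
      have h3 := HasFDerivAt.comp_hasDerivAt (l := fun z => (C z : Mat3)) (f := fun t : ℝ => t • z)
        (0 : ℝ) (by rw [zero_smul]; exact h1) h2
      have h4 := hasDerivAt_expSL (hθ0 z) 0
      rw [zero_smul, expSL_zero, Matrix.SpecialLinearGroup.coe_one, one_mul] at h4
      have h5 : ((fun z => (C z : Mat3)) ∘ fun t : ℝ => t • z) =
          fun t : ℝ => (expSL (t • θ z) : Mat3) := by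
        funext t
        simp only [hC, Function.comp_apply, map_smul]
      rw [h5] at h3
      exact h3.unique h4
    -- Both derivatives represent the map `θ`, because the derivative of `exp` at `0` is the
    -- identity.
    have hdd : fderiv ℝ (fun z => coordFun (C z : Mat3)) 0 =
        fderiv ℝ (fun y => coordFun (A y : Mat3)) x := by
      ext1 z
      refine (fderiv_coordFun_eq_iff hCs hAx hdC (by rw [hC0, hA]) z z).2 ?_
      rw [← form_apply A, hCd, hC0, hA, inv_one, one_mul, Ad_one,
        Matrix.SpecialLinearGroup.coe_one, one_mul]
      exact hW.projM_eq_self _ ⟨z, rfl⟩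
    have hΞ' : HasFDerivAt (fun z => ρ (coordFun (C z : Mat3)))
        ((ContinuousLinearEquiv.refl ℝ (E 2) : E 2 →L[ℝ] E 2)) 0 := by
      have h1 := HasFDerivAt.comp (g := ρ) (0 : E 2)
        (by rw [hκ0]; exact (hρ.differentiableAt one_ne_zero).hasFDerivAt)
        (hk.differentiableAt one_ne_zero).hasFDerivAt
      have h2 := HasFDerivAt.comp (g := ρ) x
        (by rw [hGx]; exact (hρ.differentiableAt one_ne_zero).hasFDerivAt)
        (hG.differentiableAt one_ne_zero).hasFDerivAt
      have h3 : HasFDerivAt (ρ ∘ fun y => coordFun (A y : Mat3)) (ContinuousLinearMap.id ℝ (E 2))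
          x := (hasFDerivAt_id x).congr_of_eventuallyEq hρ'
      refine h1.congr_fderiv ?_
      rw [hdd]
      exact h2.unique h3
    have hmap := (hΞ.hasStrictFDerivAt' hΞ' one_ne_zero).map_nhds_eq_of_equiv
    have hΞ0 : ρ (coordFun (C 0 : Mat3)) = x := by rw [hκ0, h0]
    rw [hΞ0] at hmap
    rw [← hmap, Filter.eventually_map]
    have hθs : ∀ᶠ z in 𝓝 (0 : E 2), ‖θ z‖ < δ := by
      have h1 : Continuous fun z => ‖θ z‖ := θ.continuous.norm
      have h2 := h1.tendsto 0
      simp only [map_zero, norm_zero] at h2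
      exact h2.eventually (gt_mem_nhds hδ)
    filter_upwards [hθs] with z hz
    have h1 := hexp 0 W.zero_mem (θ z) ⟨z, rfl⟩ hzero hz
    rw [expSL_zero, one_mul] at h1
    exact ⟨θ z, ⟨z, rfl⟩, h1.1.1.symm, fun v => h1.1.exists_mem h hW h1.2.2 v⟩

/-! ### The tangent planes of a surface -/

/-- The image of the differential of `f` at `x`, as a subspace of `𝔪` by means of the
representative `a` of `f x`. -/
noncomputable def tanPlane {S : Type*} [TopologicalSpace S] [ChartedSpace (E 2) S]
    (f : S → NKSpace) (a : SL3) (x : S) : Submodule ℝ Mat3 :=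
  LinearMap.range (horRel a (f x) ∘ₗ (mfderiv (𝓡 2) (𝓡 6) f x).toLinearMap)

section TanPlane

variable {S : Type*} [TopologicalSpace S] [ChartedSpace (E 2) S] {f : S → NKSpace}

theorem mem_tanPlane (a : SL3) (x : S) (v : TangentSpace (𝓡 2) x) :
    horRel a (f x) (mfderiv (𝓡 2) (𝓡 6) f x v) ∈ tanPlane f a x := ⟨v, rfl⟩

theorem tanPlane_mul (a h : SL3) (x : S) :
    tanPlane f (a * h) x = (tanPlane f a x).map (Ad h⁻¹) := by
  ext M
  constructor
  · rintro ⟨v, rfl⟩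
    exact ⟨_, ⟨v, rfl⟩, (horRel_mul a h _ _).symm⟩
  · rintro ⟨_, ⟨v, rfl⟩, rfl⟩
    exact ⟨v, horRel_mul a h _ _⟩

/-- The local structure of `f` at `p`: near `p` it runs in `a • [exp W]`, with tangent planes
`W`. -/
structure IsAdapted (f : S → NKSpace) (p : S) (a : SL3) (W : Submodule ℝ Mat3) : Prop where
  cls_eq : cls a = f p
  tanPlane_eq : tanPlane f a p = W
  eventually : ∀ᶠ x in 𝓝 p, ∃ X ∈ W, f x = cls (a * expSL X) ∧ tanPlane f (a * expSL X) x = W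

/-- Passing from the representative `a` to `a k⁻¹` conjugates the plane; this is how the plane is
brought to its normal form. -/
theorem IsAdapted.conj {p : S} {a : SL3} {W : Submodule ℝ Mat3} (h : IsAdapted f p a W)
    (hW : IsComplexPlane W) {k : SL3} (hk : k ∈ H) : IsAdapted f p (a * k⁻¹) (W.map (Ad k)) where
  cls_eq := by
    rw [← h.cls_eq]
    refine QuotientGroup.eq.2 ?_
    simpa using hk
  tanPlane_eq := by rw [tanPlane_mul, inv_inv, h.tanPlane_eq]
  eventually := by
    filter_upwards [h.eventually] with x hx
    obtain ⟨X, hX, hfx, hT⟩ := hx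
    have h1 : a * k⁻¹ * expSL (Ad k X) = a * expSL X * k⁻¹ := by
      rw [expSL_Ad k (trace_of_projM (hW.projM_eq_self X hX))]
      group
    refine ⟨Ad k X, ⟨X, hX, rfl⟩, ?_, ?_⟩
    · rw [h1, hfx]
      refine QuotientGroup.eq.2 ?_
      rw [inv_mul_cancel_left]
      exact H.inv_mem hk
    · rw [h1, tanPlane_mul, inv_inv, hT]

theorem IsComplexPlane.map_Ad {W : Submodule ℝ Mat3} (hW : IsComplexPlane W) {k : SL3}
    (hk : k ∈ H) : IsComplexPlane (W.map (Ad k)) where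
  finrank_eq := by
    rw [← hW.finrank_eq]
    exact (Submodule.equivMapOfInjective (Ad k) (Ad_injective k) W).finrank_eq.symm
  projM_eq_self := by
    rintro _ ⟨X, hX, rfl⟩
    rw [projM_Ad hk, hW.projM_eq_self X hX]
  J0_mem := by
    rintro _ ⟨X, hX, rfl⟩
    rw [J0_Ad hk]
    exact ⟨_, hW.J0_mem X hX, rfl⟩

/-- The type of the tangent plane is locally constant. -/
theorem isClopen_isAdapted_of (hall : ∀ p, ∃ a W, IsAdapted f p a W ∧ IsComplexPlane W)
    (V : Submodule ℝ Mat3) :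
    IsClopen {p | ∃ a, cls a = f p ∧ tanPlane f a p = V} := by
  have key : ∀ p, ∀ᶠ x in 𝓝 p, ((∃ a, cls a = f x ∧ tanPlane f a x = V) ↔
      ∃ a, cls a = f p ∧ tanPlane f a p = V) := by
    intro p
    obtain ⟨a, W, h, hW⟩ := hall p
    filter_upwards [h.eventually] with x hx
    obtain ⟨X, hX, hfx, hT⟩ := hx
    constructor
    · rintro ⟨b, hb, rfl⟩
      have hk : (a * expSL X)⁻¹ * b ∈ H := QuotientGroup.eq.1 (by
        change cls _ = cls _
        rw [← hfx, hb])
      refine ⟨a * ((a * expSL X)⁻¹ * b), ?_, ?_⟩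
      · rw [← h.cls_eq]
        refine QuotientGroup.eq.2 ?_
        have h1 := H.inv_mem hk
        have h2 : (a * ((a * expSL X)⁻¹ * b))⁻¹ * a = ((a * expSL X)⁻¹ * b)⁻¹ := by group
        rwa [h2]
      · rw [tanPlane_mul, h.tanPlane_eq, ← hT, ← tanPlane_mul, mul_inv_cancel_left]
    · rintro ⟨b, hb, rfl⟩
      have hk : a⁻¹ * b ∈ H := QuotientGroup.eq.1 (by
        change cls _ = cls _
        rw [h.cls_eq, hb])
      refine ⟨a * expSL X * (a⁻¹ * b), ?_, ?_⟩
      · rw [hfx]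
        refine QuotientGroup.eq.2 ?_
        have h1 := H.inv_mem hk
        have h2 : (a * expSL X * (a⁻¹ * b))⁻¹ * (a * expSL X) = (a⁻¹ * b)⁻¹ := by group
        rwa [h2]
      · rw [tanPlane_mul, hT, ← h.tanPlane_eq, ← tanPlane_mul, mul_inv_cancel_left]
  constructor
  · rw [← isOpen_compl_iff, isOpen_iff_eventually]
    intro p hp
    filter_upwards [key p] with x hx hx'
    exact hp (hx.1 hx')
  · rw [isOpen_iff_eventually]
    intro p hp
    filter_upwards [key p] with x hx
    exact hx.2 hp

variable [IsManifold (𝓡 2) ∞ S]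

/-- The local structure at the identity, translated by `A x` and read back on `S` through the chart.
-/
theorem exists_isAdapted (hf : IsSmoothImmersion (m := 2) (n := 6) f)
    (hgeod : IsTotallyGeodesic (m := 2) g f) (hac : IsAlmostComplex (m := 2) J f) (p : S) :
    ∃ a W, IsAdapted f p a W ∧ IsComplexPlane W ∧ ∀ X ∈ W, ∀ Y ∈ W,
      projM ((X * Y - Y * X) * Y - Y * (X * Y - Y * X)) ∈ W := by
  obtain ⟨A, O, hA, hO, hpO, hfA⟩ := exists_surfaceLift hf hgeod hac p
  set φ := chartAt (E 2) p with hφ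
  have hφd : φ.MDifferentiable (𝓡 2) (𝓡 2) := mdifferentiable_chart p
  have hplane : ∀ y ∈ O, tanPlane f (A y) (φ.symm y) = LinearMap.range (form A y) := by
    intro y hy
    have hs := (hφd.symm.mfderiv_bijective (hO hy)).2
    ext M
    constructor
    · rintro ⟨v, rfl⟩
      obtain ⟨w, rfl⟩ := hs v
      exact ⟨w, ((hfA y hy).2 w).symm⟩
    · rintro ⟨w, rfl⟩
      exact ⟨mfderiv (𝓡 2) (𝓡 2) φ.symm y w, (hfA y hy).2 w⟩
  set x := φ p with hx
  obtain ⟨hform, hB⟩ := hA.mul_left (A x)⁻¹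
  obtain ⟨h1, h2⟩ := hB.local_structure_of_one hpO (by rw [inv_mul_cancel])
  rw [hform x hpO] at h1 h2
  have hφp : φ.symm x = p := φ.left_inv (mem_chart_source _ p)
  have hcont : ContinuousAt φ p := φ.continuousAt (mem_chart_source _ p)
  refine ⟨A x, LinearMap.range (form A x), ⟨?_, ?_, ?_⟩, hA.isComplexPlane hpO, h1⟩
  · rw [(hfA x hpO).1, hφp]
  · have := hplane x hpO
    rwa [hφp] at this
  · filter_upwards [hcont.eventually h2, hcont.eventually (hA.isOpen.mem_nhds hpO),
      φ.open_source.mem_nhds (mem_chart_source _ p)] with q hq hqO hqs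
    obtain ⟨X, hX, hcls, hT⟩ := hq
    have hq' : φ.symm (φ q) = q := φ.left_inv hqs
    refine ⟨X, hX, ?_, ?_⟩
    · rw [← smul_cls, ← hcls, smul_cls, mul_inv_cancel_left, (hfA _ hqO).1, hq']
    · have h3 : A x * expSL X = A (φ q) * (((A x)⁻¹ * A (φ q))⁻¹ * expSL X) := by group
      rw [h3, tanPlane_mul]
      have h4 := hplane _ hqO
      rw [hq'] at h4
      rw [h4]
      refine Submodule.eq_of_le_of_finrank_eq ?_ ?_
      · rintro _ ⟨_, ⟨v, rfl⟩, rfl⟩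
        obtain ⟨Z, hZ, hZ'⟩ := hT v
        rw [hform _ hqO] at hZ'
        rw [hZ', Ad_inv_Ad]
        exact hZ
      · exact ((Submodule.equivMapOfInjective _ (Ad_injective _) _).finrank_eq.symm.trans
          (hA.isComplexPlane hqO).finrank_eq).trans (hA.isComplexPlane hpO).finrank_eq.symm

end TanPlane

/-! ### Classification of the tangent planes -/

/-- The element of `𝔪 ≅ ℂ³` with given complex coordinates. -/
noncomputable def ofComplex (α γ π : ℂ) : Mat3 :=
  !![α.re, -α.im, γ.re; -α.im, -α.re, γ.im; π.re, π.im, 0]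

theorem projM_ofComplex (α γ π : ℂ) : projM (ofComplex α γ π) = ofComplex α γ π := by
  rw [projM_eq]
  ext i j
  fin_cases i <;> fin_cases j <;> simp [ofComplex]

theorem exists_ofComplex {X : Mat3} (hX : projM X = X) : ∃ α γ π, X = ofComplex α γ π := by
  rw [projM_eq] at hX
  refine ⟨⟨(X 0 0 - X 1 1) / 2, -((X 0 1 + X 1 0) / 2)⟩, ⟨X 0 2, X 1 2⟩, ⟨X 2 0, X 2 1⟩, ?_⟩
  conv_lhs => rw [← hX]
  simp [ofComplex]

/-- The sign before `α.im` in `ofComplex` accounts for `J e₁ = -e₂`; with it `J` is multiplication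
by `i` on all three coordinates, and `J`-invariant planes become complex lines in `ℂ³`. -/
theorem J0_ofComplex (α γ π : ℂ) :
    J0 (ofComplex α γ π) = ofComplex (Complex.I * α) (Complex.I * γ) (Complex.I * π) := by
  rw [J0_eq]
  ext i j
  fin_cases i <;> fin_cases j <;> simp [ofComplex]

theorem ofComplex_mul (z α γ π : ℂ) :
    ofComplex (z * α) (z * γ) (z * π) =
      z.re • ofComplex α γ π + z.im • J0 (ofComplex α γ π) := by
  rw [J0_ofComplex]
  ext i j
  fin_cases i <;> fin_cases j <;> simp [ofComplex] <;> ring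

theorem ofComplex_inj {α γ π α' γ' π' : ℂ} (h : ofComplex α γ π = ofComplex α' γ' π') :
    α = α' ∧ γ = γ' ∧ π = π' := by
  have h' := fun i j => congrFun (congrFun h i) j
  have h1 := h' 0 0
  have h2 := h' 0 1
  have h3 := h' 0 2
  have h4 := h' 1 2
  have h5 := h' 2 0
  have h6 := h' 2 1
  simp [ofComplex] at h1 h2 h3 h4 h5 h6
  exact ⟨Complex.ext h1 h2, Complex.ext h3 h4, Complex.ext h5 h6⟩

theorem ofComplex_ne_zero {α γ π : ℂ} (h : α ≠ 0 ∨ γ ≠ 0 ∨ π ≠ 0) : ofComplex α γ π ≠ 0 := by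
  intro h0
  have : ofComplex α γ π = ofComplex 0 0 0 := by
    rw [h0]
    ext i j
    fin_cases i <;> fin_cases j <;> simp [ofComplex]
  obtain ⟨rfl, rfl, rfl⟩ := ofComplex_inj this
  simp at h

theorem IsComplexPlane.ofComplex_mul_mem {W : Submodule ℝ Mat3} (hW : IsComplexPlane W)
    {α γ π : ℂ} (h : ofComplex α γ π ∈ W) (z : ℂ) : ofComplex (z * α) (z * γ) (z * π) ∈ W := by
  rw [ofComplex_mul]
  exact W.add_mem (W.smul_mem _ h) (W.smul_mem _ (hW.J0_mem _ h))

theorem det_isoMat (t s : ℝ) : (isoMat t s).det = 1 := by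
  have h1 := Real.sin_sq_add_cos_sq s
  have h2 : Real.exp t * Real.exp t * Real.exp (-2 * t) = 1 := by
    rw [← Real.exp_add, ← Real.exp_add]; ring_nf; simp
  rw [Matrix.det_fin_three]
  simp [isoMat] at h2 ⊢
  linear_combination (Real.exp t * Real.exp t * Real.exp (-(2 * t))) * h1 + h2

/-- The element of `H` with given parameters. -/
noncomputable def isoSL (t s : ℝ) : SL3 := ⟨isoMat t s, det_isoMat t s⟩

theorem isoSL_mem (t s : ℝ) : isoSL t s ∈ H := ⟨t, s, rfl⟩

/-- Rotations act with weights `2, -1, -1` and dilations with weights `0, 3, -3`. Thus `s` adjusts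
the phase of `γ/α` and `t` the modulus of `π/γ`. -/
theorem Ad_isoSL (t s : ℝ) (α γ π : ℂ) :
    Ad (isoSL t s) (ofComplex α γ π) =
      ofComplex (Complex.exp (2 * s * Complex.I) * α)
        (Real.exp (3 * t) * Complex.exp (-(s * Complex.I)) * γ)
        (Real.exp (-(3 * t)) * Complex.exp (-(s * Complex.I)) * π) := by
  have hinv : ((isoSL t s)⁻¹ : SL3) = isoMat (-t) (-s) := by
    refine coe_inv_eq ?_
    change isoMat t s * _ = 1
    rw [isoMat_mul, add_neg_cancel, add_neg_cancel, isoMat_zero]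
  have h1 : Complex.exp (-(s * Complex.I)) = ⟨Real.cos s, -Real.sin s⟩ := by
    rw [← neg_mul, Complex.exp_mul_I, Complex.cos_neg, Complex.sin_neg]
    apply Complex.ext <;> simp [← Complex.ofReal_cos, ← Complex.ofReal_sin]
  have h2 : Complex.exp (2 * s * Complex.I)
      = ⟨Real.cos s ^ 2 - Real.sin s ^ 2, 2 * Real.sin s * Real.cos s⟩ := by
    rw [Complex.exp_mul_I, Complex.cos_two_mul', Complex.sin_two_mul]
    apply Complex.ext <;> simp [← Complex.ofReal_cos, ← Complex.ofReal_sin, ← Complex.ofReal_pow]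
  have e1 : Real.exp t * Real.exp (-t) = 1 := by rw [← Real.exp_add]; simp
  have e2 : Real.exp (3 * t) = Real.exp t * Real.exp (-2 * -t) := by
    rw [← Real.exp_add]; ring_nf
  have e3 : Real.exp (-(3 * t)) = Real.exp (-t) * Real.exp (-2 * t) := by
    rw [← Real.exp_add]; ring_nf
  rw [Ad_apply, hinv, h1, h2, e2, e3]
  change isoMat t s * _ * _ = _
  simp only [isoMat, Real.cos_neg, Real.sin_neg]
  generalize Real.exp t = x at *
  generalize Real.exp (-t) = y at *
  generalize Real.exp (-2 * t) = u
  generalize Real.exp (-2 * -t) = v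
  generalize Real.cos s = c
  generalize Real.sin s = σ
  ext i j
  fin_cases i <;> fin_cases j <;>
    simp [ofComplex, Matrix.mul_apply, Fin.sum_univ_three]
  · linear_combination (α.re * (c ^ 2 - σ ^ 2) - α.im * (2 * σ * c)) * e1
  · linear_combination -(α.im * (c ^ 2 - σ ^ 2) + α.re * (2 * σ * c)) * e1
  · ring
  · linear_combination -(α.im * (c ^ 2 - σ ^ 2) + α.re * (2 * σ * c)) * e1
  · linear_combination -(α.re * (c ^ 2 - σ ^ 2) - α.im * (2 * σ * c)) * e1
  · ring
  · ring
  · ring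

/-- The triple bracket `[[J X, X], X]`. -/
theorem projM_triple (α γ π : ℂ) :
    let X := ofComplex α γ π
    let ρ : ℝ := -2 * (α.re ^ 2 + α.im ^ 2) + γ.re * π.re + γ.im * π.im
    let τ : ℝ := π.re * γ.im - π.im * γ.re
    projM ((J0 X * X - X * J0 X) * X - X * (J0 X * X - X * J0 X)) =
      ofComplex (-2 * ρ * Complex.I * α) ((-3 * τ + ρ * Complex.I) * γ)
        ((3 * τ + ρ * Complex.I) * π) := by
  intro X ρ τ
  simp only [X, J0_ofComplex, projM_eq]
  ext i j
  fin_cases i <;> fin_cases j <;>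
    simp [ofComplex, ρ, τ, pow_two] <;> ring

/-- The eigenvalue conditions for a Lie triple. -/
theorem IsComplexPlane.triple {W : Submodule ℝ Mat3} (hW : IsComplexPlane W)
    (hL : ∀ X ∈ W, ∀ Y ∈ W, projM ((X * Y - Y * X) * Y - Y * (X * Y - Y * X)) ∈ W)
    {α γ π : ℂ} (h0 : α ≠ 0 ∨ γ ≠ 0 ∨ π ≠ 0) (h : ofComplex α γ π ∈ W) :
    ∃ ρ τ : ℝ, ρ = -2 * (α.re ^ 2 + α.im ^ 2) + γ.re * π.re + γ.im * π.im ∧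
      τ = π.re * γ.im - π.im * γ.re ∧ (α ≠ 0 → γ ≠ 0 → ρ = 0 ∧ τ = 0) ∧
      (α ≠ 0 → π ≠ 0 → ρ = 0 ∧ τ = 0) ∧ (γ ≠ 0 → π ≠ 0 → τ = 0) := by
  refine ⟨_, _, rfl, rfl, ?_⟩
  have h1 := hL _ (hW.J0_mem _ h) _ h
  rw [projM_triple] at h1
  -- The triple bracket lies in the complex line of `X`, so it equals `(s + i t) X`; each nonzero
  -- coordinate then determines `s + i t` through its factor in `projM_triple`.
  obtain ⟨s, t, hst⟩ := hW.exists_eq h (ofComplex_ne_zero h0) h1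
  rw [← ofComplex_mul ⟨s, t⟩] at hst
  obtain ⟨k1, k2, k3⟩ := ofComplex_inj hst
  generalize -2 * (α.re ^ 2 + α.im ^ 2) + γ.re * π.re + γ.im * π.im = ρ at *
  generalize π.re * γ.im - π.im * γ.re = τ at *
  have l1 : α ≠ 0 → s = 0 ∧ t = -2 * ρ := fun hα => by
    have := mul_right_cancel₀ hα k1
    have a1 := congrArg Complex.re this
    have a2 := congrArg Complex.im this
    simp at a1 a2
    exact ⟨a1.symm, by linarith⟩
  have l2 : γ ≠ 0 → s = -3 * τ ∧ t = ρ := fun hα => by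
    have := mul_right_cancel₀ hα k2
    have a1 := congrArg Complex.re this
    have a2 := congrArg Complex.im this
    simp at a1 a2
    exact ⟨by linarith, by linarith⟩
  have l3 : π ≠ 0 → s = 3 * τ ∧ t = ρ := fun hα => by
    have := mul_right_cancel₀ hα k3
    have a1 := congrArg Complex.re this
    have a2 := congrArg Complex.im this
    simp at a1 a2
    exact ⟨by linarith, by linarith⟩
  refine ⟨fun h1 h2 => ?_, fun h1 h2 => ?_, fun h1 h2 => ?_⟩
  · have := l1 h1; have := l2 h2
    constructor <;> linarith
  · have := l1 h1; have := l3 h2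
    constructor <;> linarith
  · have := l2 h1; have := l3 h2
    linarith

/-- The plane spanned by `X` and `J X`. -/
noncomputable def cplane (X : Mat3) : Submodule ℝ Mat3 := Submodule.span ℝ {X, J0 X}

theorem e1_eq : e1 = ofComplex 1 0 0 := by
  ext i j; fin_cases i <;> fin_cases j <;> simp [ofComplex, e1]

theorem e3_eq : e3 = ofComplex 0 (√2 : ℝ) 0 := by
  ext i j; fin_cases i <;> fin_cases j <;> simp [ofComplex, e3]

theorem e5_eq : e5 = ofComplex 0 0 (-√2 : ℝ) := by
  ext i j; fin_cases i <;> fin_cases j <;> simp [ofComplex, e5]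

theorem X2_eq : (1 / √2) • (e3 + e5) = ofComplex 0 1 (-1) := by
  ext i j; fin_cases i <;> fin_cases j <;> simp [ofComplex, e3, e5]

theorem X3_eq : (1 / √2) • (e3 - e5) = ofComplex 0 1 1 := by
  ext i j; fin_cases i <;> fin_cases j <;> simp [ofComplex, e3, e5]

theorem X4_eq : X4 = ofComplex (1 / √3 : ℝ) (√2 : ℝ) (√2 / 3 : ℝ) := by
  ext i j; fin_cases i <;> fin_cases j <;> simp [ofComplex, X4, e1, e3, e5, div_eq_inv_mul]
  all_goals rw [← div_eq_inv_mul, Real.sqrt_div_self', one_div]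

/-- The hypothesis says that `γ` times the conjugate of `π` is real, so `π/γ` is real as well.
Either sign can occur; it distinguishes the compact case from the hyperbolic one below. -/
theorem exists_pos_smul {γ π : ℂ} (hγ : γ ≠ 0) (hπ : π ≠ 0)
    (hτ : π.re * γ.im - π.im * γ.re = 0) : ∃ r : ℝ, r ≠ 0 ∧ π = r * γ := by
  refine ⟨(γ.re * π.re + γ.im * π.im) / Complex.normSq γ, ?_, ?_⟩
  all_goals have hn : Complex.normSq γ ≠ 0 := by simpa using hγ
  · intro h0
    rw [div_eq_zero_iff, or_iff_left hn] at h0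
    apply hπ
    have h1 : Complex.normSq γ * Complex.normSq π = 0 := by
      simp only [Complex.normSq_apply]
      linear_combination (π.re * γ.im - π.im * γ.re) * hτ + (γ.re * π.re + γ.im * π.im) * h0
    simpa [hn] using h1
  · apply Complex.ext
    · simp
      rw [Complex.normSq_apply] at *
      rw [div_mul_eq_mul_div, eq_div_iff hn]
      linear_combination γ.im * hτ
    · simp
      rw [Complex.normSq_apply] at *
      rw [div_mul_eq_mul_div, eq_div_iff hn]
      linear_combination -γ.re * hτ

theorem exists_exp_eq {r : ℝ} (hr : 0 < r) : ∃ t : ℝ, r = Real.exp (-(6 * t)) :=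
  ⟨-(Real.log r) / 6, by rw [show -(6 * (-(Real.log r) / 6)) = Real.log r by ring,
    Real.exp_log hr]⟩

/-- Up to the isotropy group, there are six Lie triples which are complex lines. -/
theorem IsComplexPlane.classification {W : Submodule ℝ Mat3} (hW : IsComplexPlane W)
    (hL : ∀ X ∈ W, ∀ Y ∈ W, projM ((X * Y - Y * X) * Y - Y * (X * Y - Y * X)) ∈ W) :
    ∃ k ∈ H, ∃ X, (X = e1 ∨ X = (1 / √2) • (e3 + e5) ∨ X = (1 / √2) • (e3 - e5) ∨ X = X4 ∨
      X = e3 ∨ X = e5) ∧ W.map (Ad k) = cplane X := by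
  -- A complex plane is spanned over `ℂ` by any nonzero vector in it, so one vector of the list has
  -- to be found in `W`, up to `H`.
  suffices h : ∃ k ∈ H, ∃ X, projM X = X ∧ X ≠ 0 ∧ (X = e1 ∨ X = (1 / √2) • (e3 + e5) ∨
      X = (1 / √2) • (e3 - e5) ∨ X = X4 ∨ X = e3 ∨ X = e5) ∧ Ad k X ∈ W by
    obtain ⟨k, hk, X, hX, hX0, hc, hm⟩ := h
    refine ⟨k⁻¹, H.inv_mem hk, X, hc, ?_⟩
    exact (hW.map_Ad (H.inv_mem hk)).eq_span ⟨_, hm, Ad_inv_Ad k X⟩ hX0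
  obtain ⟨X, hXW, hX0⟩ : ∃ X ∈ W, X ≠ 0 := by
    refine W.exists_mem_ne_zero_of_ne_bot fun h => ?_
    have := hW.finrank_eq
    rw [h, finrank_bot] at this
    exact absurd this (by norm_num)
  obtain ⟨α, γ, π, rfl⟩ := exists_ofComplex (hW.projM_eq_self X hXW)
  have h0 : α ≠ 0 ∨ γ ≠ 0 ∨ π ≠ 0 := by
    by_contra! h
    obtain ⟨rfl, rfl, rfl⟩ := h
    apply hX0
    ext i j
    fin_cases i <;> fin_cases j <;> simp [ofComplex]
  obtain ⟨ρ, τ, hρ, hτ, k1, k2, k3⟩ := hW.triple hL h0 hXW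
  have s2 : √2 ≠ 0 := by positivity
  by_cases hα : α = 0
  · subst hα
    by_cases hγ : γ = 0
    · subst hγ
      have hπ : π ≠ 0 := by simpa using h0
      refine ⟨1, H.one_mem, e5, ?_, ?_, by simp, ?_⟩
      · rw [e5_eq, projM_ofComplex]
      · rw [e5_eq]; exact ofComplex_ne_zero (by simp [s2])
      · rw [Ad_one, e5_eq]
        have := hW.ofComplex_mul_mem hXW ((-√2 : ℝ) / π)
        simpa [hπ] using this
    · by_cases hπ : π = 0
      · subst hπ
        refine ⟨1, H.one_mem, e3, ?_, ?_, by simp, ?_⟩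
        · rw [e3_eq, projM_ofComplex]
        · rw [e3_eq]; exact ofComplex_ne_zero (by simp [s2])
        · rw [Ad_one, e3_eq]
          have := hW.ofComplex_mul_mem hXW ((√2 : ℝ) / γ)
          simpa [hγ] using this
      · have hτ0 := k3 hγ hπ
        obtain ⟨r, hr, rfl⟩ := exists_pos_smul hγ hπ (hτ ▸ hτ0)
        -- The dilation multiplies `π/γ` by `exp (-6 t)`; it is used to reduce `r` to its sign `ε`.
        have key : ∀ t ε : ℝ, r = ε * Real.exp (-(6 * t)) →
            Ad (isoSL t 0) (ofComplex 0 1 ε) ∈ W := by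
          intro t ε h
          have := hW.ofComplex_mul_mem hXW (Real.exp (3 * t) / γ)
          rw [Ad_isoSL]
          convert this using 2
          · simp
          · field_simp; simp
          · field_simp
            rw [h]
            have : Real.exp (3 * t) * Real.exp (-(6 * t)) = Real.exp (-(3 * t)) := by
              rw [← Real.exp_add]; ring_nf
            rw [← this]
            push_cast
            simp
            ring
        rcases lt_or_gt_of_ne hr with hneg | hpos
        · obtain ⟨t, ht⟩ := exists_exp_eq (neg_pos.2 hneg)
          refine ⟨isoSL t 0, isoSL_mem _ _, _, ?_, ?_, Or.inr (Or.inl rfl), ?_⟩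
          · rw [X2_eq, projM_ofComplex]
          · rw [X2_eq]; exact ofComplex_ne_zero (by simp)
          · rw [X2_eq]
            simpa using key t (-1) (by linarith)
        · obtain ⟨t, ht⟩ := exists_exp_eq hpos
          refine ⟨isoSL t 0, isoSL_mem _ _, _, ?_, ?_, Or.inr (Or.inr (Or.inl rfl)), ?_⟩
          · rw [X3_eq, projM_ofComplex]
          · rw [X3_eq]; exact ofComplex_ne_zero (by simp)
          · rw [X3_eq]
            simpa using key t 1 (by linarith)
  · by_cases hγπ : γ = 0 ∧ π = 0
    · obtain ⟨rfl, rfl⟩ := hγπ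
      refine ⟨1, H.one_mem, e1, ?_, ?_, by simp, ?_⟩
      · rw [e1_eq, projM_ofComplex]
      · rw [e1_eq]; exact ofComplex_ne_zero (by simp)
      · rw [Ad_one, e1_eq]
        have := hW.ofComplex_mul_mem hXW (1 / α)
        simpa [hα] using this
    -- A nonzero `α` next to another nonzero coordinate forces `ρ = τ = 0`. Then the real inner
    -- product of `γ` and `π` is `2 |α|² > 0`, so no coordinate vanishes and `r > 0`.
    · have hρτ : ρ = 0 ∧ τ = 0 := by
        by_cases hγ : γ = 0
        · exact k2 hα (fun h => hγπ ⟨hγ, h⟩)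
        · exact k1 hα hγ
      rw [hρ, hτ] at hρτ
      have hαn : 0 < Complex.normSq α := Complex.normSq_pos.2 hα
      have hαn' := hαn
      rw [Complex.normSq_apply] at hαn'
      have hγ : γ ≠ 0 := by
        rintro rfl
        simp at hρτ
        nlinarith
      have hπ : π ≠ 0 := by
        rintro rfl
        simp at hρτ
        nlinarith
      obtain ⟨r, hr, rfl⟩ := exists_pos_smul hγ hπ hρτ.2
      have hγn : 0 < Complex.normSq γ := Complex.normSq_pos.2 hγ
      have hrr : r * Complex.normSq γ = 2 * Complex.normSq α := by
        have := hρτ.1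
        simp at this
        simp only [Complex.normSq_apply]
        linear_combination this
      have hrpos : 0 < r := by
        by_contra hc
        nlinarith
      -- The factor `3` is there because the last two coordinates of `X4` have ratio `1/3`.
      obtain ⟨t, ht⟩ := exists_exp_eq (mul_pos three_pos hrpos)
      set θ := Complex.arg (γ / α) with hθ
      -- By `hrr` and `ht`, `|γ/α|² = 2/r = 6 exp (6 t)`.
      have hpol : γ = α * ((√6 * Real.exp (3 * t) : ℝ) * Complex.exp (θ * Complex.I)) := by
        have h1 := Complex.norm_mul_exp_arg_mul_I (γ / α)
        have h2 : ‖γ / α‖ = √6 * Real.exp (3 * t) := by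
          have h4 : Real.exp (3 * t) ^ 2 * Real.exp (-(6 * t)) = 1 := by
            rw [← Real.exp_nat_mul, ← Real.exp_add]; ring_nf; simp
          rw [← ht] at h4
          have h3 : ‖γ / α‖ ^ 2 = (√6 * Real.exp (3 * t)) ^ 2 := by
            rw [← Complex.normSq_eq_norm_sq, Complex.normSq_div, mul_pow,
              Real.sq_sqrt (by norm_num)]
            rw [div_eq_iff hαn.ne']
            have h5 : (3 * r) ≠ 0 := by positivity
            apply mul_left_cancel₀ h5
            linear_combination 3 * hrr - 6 * Complex.normSq α * h4
          exact (pow_left_inj₀ (norm_nonneg _) (by positivity) two_ne_zero).1 h3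
        rw [h2] at h1
        rw [← hθ] at h1
        rw [h1]
        field_simp
      have hs3 : (√3 : ℂ) ≠ 0 := by
        rw [Complex.ofReal_ne_zero]; positivity
      have hs6 : (√6 : ℂ) = √3 * √2 := by
        rw [← Complex.ofReal_mul, ← Real.sqrt_mul (by norm_num)]; norm_num
      -- By the weights `2` and `-1`, rotation by `s` changes the phase of `γ/α` by `-3 s`.
      refine ⟨isoSL t (-θ / 3), isoSL_mem _ _, X4, ?_, ?_, by simp, ?_⟩
      · rw [X4_eq, projM_ofComplex]
      · rw [X4_eq]; exact ofComplex_ne_zero (by simp)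
      · rw [X4_eq, Ad_isoSL]
        have := hW.ofComplex_mul_mem hXW
          (Complex.exp (2 * ((-θ / 3 : ℝ) : ℂ) * Complex.I) / (√3 * α))
        have q1 : Complex.exp (2 * ((-θ / 3 : ℝ) : ℂ) * Complex.I) * Complex.exp (θ * Complex.I) =
            Complex.exp (-(((-θ / 3 : ℝ) : ℂ) * Complex.I)) := by
          rw [← Complex.exp_add]; push_cast; ring_nf
        have q2 : (r : ℂ) * Real.exp (3 * t) = Real.exp (-(3 * t)) / 3 := by
          have : 3 * r * Real.exp (3 * t) = Real.exp (-(3 * t)) := by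
            rw [ht, ← Real.exp_add]; ring_nf
          rw [← this]; push_cast; ring
        have q3 : Complex.exp (2 * ((-θ / 3 : ℝ) : ℂ) * Complex.I) / (√3 * α) * γ =
            Real.exp (3 * t) * Complex.exp (-(((-θ / 3 : ℝ) : ℂ) * Complex.I)) * (√2 : ℝ) := by
          rw [hpol, ← q1]
          push_cast [hs6]
          field_simp
        have q4 : Complex.exp (2 * ((-θ / 3 : ℝ) : ℂ) * Complex.I) / (√3 * α) * (r * γ) =
            Real.exp (-(3 * t)) * Complex.exp (-(((-θ / 3 : ℝ) : ℂ) * Complex.I)) *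
              (√2 / 3 : ℝ) := by
          rw [mul_left_comm, q3]
          push_cast at q2 ⊢
          linear_combination Complex.exp (-((-θ / 3 : ℂ) * Complex.I)) * (√2 : ℝ) * q2
        rw [q3, q4] at this
        convert this using 2
        push_cast
        field_simp

/-! ### Maps defined on the homogeneous space -/

section Maps

variable {k : ℕ} {M : Type*} [TopologicalSpace M] [ChartedSpace (E k) M]

/-- The map `y ↦ cls (p.out * secSL y)` is the inverse of the chart at `p`, so smoothness can be
tested on matrix valued maps. -/
theorem contMDiffAt_of_comp_secSL {Φ : NKSpace → M} {p : NKSpace}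
    (h : ContMDiffAt (𝓡 6) (𝓡 k) ∞ (fun y : E 6 => Φ (cls (p.out * secSL y))) y0) :
    ContMDiffAt (𝓡 6) (𝓡 k) ∞ Φ p := by
  have hc : ContMDiffAt (𝓡 6) (𝓡 6) ∞ (chartAt (E 6) p) p :=
    contMDiffAt_of_mem_maximalAtlas (IsManifold.chart_mem_maximalAtlas p) (mem_chart_source _ p)
  have hp : chartAt (E 6) p p = y0 := chart_self p
  have h1 : ContMDiffAt (𝓡 6) (𝓡 k) ∞
      ((fun y : E 6 => Φ (cls (p.out * secSL y))) ∘ chartAt (E 6) p) p := by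
    refine ContMDiffAt.comp (I' := 𝓡 6) p ?_ hc
    rw [hp]
    exact h
  refine h1.congr_of_eventuallyEq ?_
  filter_upwards [(chartAt (E 6) p).open_source.mem_nhds (mem_chart_source _ p)] with q hq
  change Φ q = Φ (cls (p.out * secSL (chartAt (E 6) p q)))
  rw [← chart_symm_eq p (chartAt (E 6) p q)]
  exact congrArg Φ ((chartAt (E 6) p).left_inv hq).symm

theorem mfderiv_congr_point {Φ : NKSpace → M} {p q : NKSpace} (h : q = p) (u : E 6) :
    (mfderiv (𝓡 6) (𝓡 k) Φ q u : E k) = mfderiv (𝓡 6) (𝓡 k) Φ p u := by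
  subst h; rfl

/-- The differential of a map in terms of the curves `t ↦ [a exp (t X)]`. -/
theorem mfderiv_eq_curve {Φ : NKSpace → M} {p : NKSpace} {a : SL3}
    (hΦ : MDifferentiableAt (𝓡 6) (𝓡 k) Φ p) (h : cls a = p) (v : TangentSpace (𝓡 6) p) :
    (mfderiv (𝓡 6) (𝓡 k) Φ p v : E k) =
      mfderiv 𝓘(ℝ, ℝ) (𝓡 k) (fun t : ℝ => Φ (cls (a * expSL (t • horRel a p v)))) 0 (1 : ℝ) := by
  set X := horRel a p v with hX
  have hXp : projM X = X := projM_horRel h v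
  have hX0 := trace_of_projM hXp
  set γ : ℝ → NKSpace := fun t => cls (a * expSL (t • X)) with hγ
  have hγ0 : γ 0 = p := by simp only [hγ]; rw [zero_smul, expSL_zero, mul_one, h]
  have hγd : MDifferentiableAt 𝓘(ℝ, ℝ) (𝓡 6) γ 0 :=
    (contMDiffAt_cls (contDiff_mul_expSL a hX0).contDiffAt).mdifferentiableAt (by simp)
  have hv : (mfderiv 𝓘(ℝ, ℝ) (𝓡 6) γ 0 (1 : ℝ) : E 6) = v := by
    refine horRel_injective a p ?_
    exact (horRel_congr hγ0.symm _).trans (horRel_curve a hXp)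
  have hc := mfderiv_comp (I' := 𝓡 6) (I'' := 𝓡 k) (0 : ℝ) (hγ0.symm ▸ hΦ) hγd
  have h2 : (mfderiv 𝓘(ℝ, ℝ) (𝓡 k) (Φ ∘ γ) 0 (1 : ℝ) : E k) =
      mfderiv (𝓡 6) (𝓡 k) Φ (γ 0) (mfderiv 𝓘(ℝ, ℝ) (𝓡 6) γ 0 (1 : ℝ)) :=
    congrArg (fun T : ℝ →L[ℝ] E k => T 1) hc
  refine Eq.trans ?_ h2.symm
  refine Eq.trans ?_ (mfderiv_congr_point hγ0 _).symm
  exact congrArg (fun u : E 6 => (mfderiv (𝓡 6) (𝓡 k) Φ p u : E k)) hv.symm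

end Maps

/-! ### Isometries -/

theorem contMDiff_smul (b : SL3) : ContMDiff (𝓡 6) (𝓡 6) ∞ (fun q : NKSpace => b • q) := by
  intro p
  refine contMDiffAt_of_comp_secSL ?_
  have h : ContDiffAt ℝ ∞ (fun y : E 6 => ((b * (p.out * secSL y) : SL3) : Mat3)) y0 := by
    simp only [Matrix.SpecialLinearGroup.coe_mul]
    exact contDiffAt_const.mul (contDiffAt_const.mul
      (contDiffAt_coe_secSL (by simp [detFun_y0])))
  exact contMDiffAt_cls h

/-- Translation by `b` as a diffeomorphism. -/
noncomputable def smulDiffeo (b : SL3) : NKSpace ≃ₘ^∞⟮𝓡 6, 𝓡 6⟯ NKSpace where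
  toEquiv := MulAction.toPerm b
  contMDiff_toFun := contMDiff_smul b
  contMDiff_invFun := contMDiff_smul b⁻¹

theorem smulDiffeo_apply (b : SL3) (q : NKSpace) : smulDiffeo b q = b • q := rfl

/-- A diffeomorphism that maps the geodesics through a point to such geodesics, preserving the
inner products of the initial velocities, is an isometry. -/
theorem isIsom_of_curve {Φ : NKSpace ≃ₘ^∞⟮𝓡 6, 𝓡 6⟯ NKSpace} {c : SL3 → SL3} {L : Mat3 → Mat3}
    (hL : ∀ X, projM X = X → projM (L X) = L X)
    (h : ∀ a X, projM X = X → Φ (cls (a * expSL X)) = cls (c a * expSL (L X)))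
    (hs : ∀ (t : ℝ) X, L (t • X) = t • L X)
    (htr : ∀ X Y, (L X * L Y).trace = (X * Y).trace) : IsIsom g Φ := by
  intro p v w
  obtain ⟨a, rfl⟩ : ∃ a, cls a = p := ⟨_, cls_out p⟩
  have hΦ : MDifferentiableAt (𝓡 6) (𝓡 6) Φ (cls a) :=
    Φ.contMDiff.mdifferentiableAt (by simp)
  have hb : Φ (cls a) = cls (c a) := by
    have := h a ((0 : ℝ) • 0) (by simp)
    rw [hs] at this
    simpa [expSL_zero] using this
  have key : ∀ v : TangentSpace (𝓡 6) (cls a),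
      horRel (c a) (Φ (cls a)) (mfderiv (𝓡 6) (𝓡 6) Φ (cls a) v) = L (horRel a _ v) := by
    intro v
    have h1 := mfderiv_eq_curve hΦ rfl v
    have hXp : projM (horRel a _ v) = horRel a _ v := projM_horRel rfl v
    set X := horRel a _ v
    have h2 : (fun t : ℝ => Φ (cls (a * expSL (t • X)))) =
        fun t : ℝ => cls (c a * expSL (t • L X)) := by
      funext t
      rw [h a (t • X) (by rw [map_smul, hXp]), hs]
    rw [h2] at h1
    refine Eq.trans ?_ (horRel_curve (c a) (hL X hXp))
    refine (congrArg (fun u : E 6 => horRel (c a) (Φ (cls a)) u) h1).trans (horRel_congr ?_ _)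
    rw [hb, zero_smul, expSL_zero, mul_one]
  rw [g_eq_horRel (c a), key, key, htr, ← g_eq_horRel]

theorem isIsom_smul (b : SL3) : IsIsom g (smulDiffeo b) := by
  refine isIsom_of_curve (c := fun a => b * a) (L := id) (fun X h => h) ?_ (fun _ _ => rfl)
    (fun _ _ => rfl)
  intro a X _
  rw [smulDiffeo_apply, smul_cls, mul_assoc]; rfl

theorem IsIsom.trans {Φ Φ' : NKSpace ≃ₘ^∞⟮𝓡 6, 𝓡 6⟯ NKSpace} (h : IsIsom g Φ)
    (h' : IsIsom g Φ') : IsIsom g (Φ.trans Φ') := by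
  intro p v w
  have hc := mfderiv_comp (I' := 𝓡 6) (I'' := 𝓡 6) p
    (Φ'.contMDiff.mdifferentiableAt (x := Φ p) (by simp))
    (Φ.contMDiff.mdifferentiableAt (x := p) (by simp))
  have key : ∀ v : TangentSpace (𝓡 6) p, (mfderiv (𝓡 6) (𝓡 6) (Φ.trans Φ') p v : E 6) =
      mfderiv (𝓡 6) (𝓡 6) Φ' (Φ p) (mfderiv (𝓡 6) (𝓡 6) Φ p v) := fun v =>
    congrArg (fun T : E 6 →L[ℝ] E 6 => T v) hc
  refine Eq.trans ?_ ((h' (Φ p) _ _).trans (h p v w))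
  exact congrArg₂ (fun x y : E 6 => g (Φ' (Φ p)) x y) (key v) (key w)

/-- The automorphism `a ↦ (aᵀ)⁻¹` of `SL(3,ℝ)`. -/
noncomputable def outer (a : SL3) : SL3 := a⁻¹.transpose

theorem coe_outer (a : SL3) : (outer a : Mat3) = ((a⁻¹ : SL3) : Mat3).transpose := rfl

theorem outer_mul (a b : SL3) : outer (a * b) = outer a * outer b := by
  refine Subtype.ext ?_
  rw [Matrix.SpecialLinearGroup.coe_mul, coe_outer, coe_outer, coe_outer, mul_inv_rev,
    Matrix.SpecialLinearGroup.coe_mul, Matrix.transpose_mul]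

theorem outer_one : outer 1 = 1 := by
  refine Subtype.ext ?_
  rw [coe_outer]; simp

theorem outer_inv (a : SL3) : outer a⁻¹ = (outer a)⁻¹ :=
  eq_inv_of_mul_eq_one_left (by rw [← outer_mul, inv_mul_cancel, outer_one])

theorem outer_outer (a : SL3) : outer (outer a) = a := by
  refine Subtype.ext ?_
  rw [coe_outer, ← outer_inv, coe_outer, inv_inv, Matrix.transpose_transpose]

theorem outer_mem {h : SL3} (hh : h ∈ H) : outer h ∈ H := by
  obtain ⟨α, β, γ, hd, hm⟩ := exists_of_mem_H hh
  refine mem_H_of (α := α * γ) (β := β * γ) (γ := α ^ 2 + β ^ 2) ?_ ?_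
  · rw [coe_outer, coe_inv_of_mem_H hd hm]
    ext i j
    fin_cases i <;> fin_cases j <;> simp
  · linear_combination ((α ^ 2 + β ^ 2) * γ + 1) * hd

theorem outer_expSL {X : Mat3} (hX : X.trace = 0) : outer (expSL X) = expSL (-X.transpose) := by
  refine Subtype.ext ?_
  rw [coe_outer, ← expSL_neg hX, coe_expSL (by simp [hX]), coe_expSL (by simp [hX]),
    ← Matrix.exp_transpose, Matrix.transpose_neg]

/-- The map of the homogeneous space induced by `outer`. -/
noncomputable def outerQ (p : NKSpace) : NKSpace := cls (outer p.out)

theorem outerQ_cls (a : SL3) : outerQ (cls a) = cls (outer a) := by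
  refine QuotientGroup.eq.2 ?_
  rw [← outer_inv, ← outer_mul]
  exact outer_mem (out_inv_mul_mem a)

theorem outerQ_outerQ (p : NKSpace) : outerQ (outerQ p) = p := by
  obtain ⟨a, rfl⟩ : ∃ a, cls a = p := ⟨_, cls_out p⟩
  rw [outerQ_cls, outerQ_cls, outer_outer]

theorem contMDiff_outerQ : ContMDiff (𝓡 6) (𝓡 6) ∞ outerQ := by
  intro p
  refine contMDiffAt_of_comp_secSL ?_
  simp only [outerQ_cls]
  have h : ContDiffAt ℝ ∞ (fun y : E 6 => ((outer (p.out * secSL y) : SL3) : Mat3)) y0 := by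
    have h1 : ContDiffAt ℝ ∞ (fun y : E 6 => ((p.out * secSL y : SL3) : Mat3)) y0 := by
      simp only [Matrix.SpecialLinearGroup.coe_mul]
      exact contDiffAt_const.mul (contDiffAt_coe_secSL (by simp [detFun_y0]))
    have h2 := contDiffAt_mat.1 (contDiffAt_inv_coe h1)
    exact contDiffAt_mat.2 fun i j => h2 j i
  exact contMDiffAt_cls h

/-- The involution `outerQ` as a diffeomorphism. -/
noncomputable def outerDiffeo : NKSpace ≃ₘ^∞⟮𝓡 6, 𝓡 6⟯ NKSpace where
  toFun := outerQ
  invFun := outerQ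
  left_inv := outerQ_outerQ
  right_inv := outerQ_outerQ
  contMDiff_toFun := contMDiff_outerQ
  contMDiff_invFun := contMDiff_outerQ

/-- On `𝔪` the induced map is `X ↦ -Xᵀ`, which preserves the trace form. It sends `e₅, e₆` to `e₃,
e₄` and so identifies the two degenerate planes. -/
theorem isIsom_outer : IsIsom g outerDiffeo := by
  refine isIsom_of_curve (c := outer) (L := fun X => -X.transpose) ?_ ?_ ?_ ?_
  · intro X hX
    rw [← hX, projM_eq, projM_eq]
    ext i j
    fin_cases i <;> fin_cases j <;> simp
    all_goals ring
  · intro a X hX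
    change outerQ _ = _
    rw [outerQ_cls, outer_mul, outer_expSL (trace_of_projM hX)]
  · intro t X
    simp
  · intro X Y
    rw [neg_mul_neg, ← Matrix.transpose_mul, Matrix.trace_transpose, Matrix.trace_mul_comm]

/-! ### Charts adapted to a parametrization -/

/-- The inverse function theorem, restricted to the open set where the derivative is invertible;
this makes the inverse smooth on all of its domain and not only at the image of `x`. -/
theorem exists_smooth_inverse {n : ℕ} {h : E n → E n} {x : E n} {U : Set (E n)} (hU : IsOpen U)
    (hx : x ∈ U) (hh : ∀ y ∈ U, ContDiffAt ℝ ∞ h y) (hinj : Function.Injective (fderiv ℝ h x)) :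
    ∃ e : OpenPartialHomeomorph (E n) (E n), x ∈ e.source ∧ e.source ⊆ U ∧ (∀ y, e y = h y) ∧
      ∀ y ∈ e.target, ContDiffAt ℝ ∞ e.symm y := by
  set V : Set (E n) := {y | y ∈ U ∧ IsUnit (fderiv ℝ h y)} with hV
  have hVo : IsOpen V := by
    rw [isOpen_iff_mem_nhds]
    rintro y ⟨hy, hu⟩
    have hc : ContinuousAt (fderiv ℝ h) y :=
      ((hh y hy).fderiv_right (m := 0) (by simp)).continuousAt
    exact Filter.inter_mem (hU.mem_nhds hy) (hc.eventually (Units.isOpen.mem_nhds hu))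
  have hxu : IsUnit (fderiv ℝ h x) := by
    have hb : Function.Bijective (fderiv ℝ h x).toLinearMap :=
      ⟨hinj, LinearMap.injective_iff_surjective.1 hinj⟩
    let L : E n ≃L[ℝ] E n := (LinearEquiv.ofBijective _ hb).toContinuousLinearEquiv
    exact ⟨ContinuousLinearEquiv.toUnit L, ContinuousLinearMap.ext fun _ => rfl⟩
  have hder : ∀ y ∈ V, ∃ L : E n ≃L[ℝ] E n, HasFDerivAt h (L : E n →L[ℝ] E n) y := by
    rintro y ⟨hy, u, hu⟩
    refine ⟨ContinuousLinearEquiv.ofUnit u, ?_⟩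
    have := ((hh y hy).differentiableAt (by simp)).hasFDerivAt
    rw [← hu] at this
    exact this
  obtain ⟨L, hL⟩ := hder x ⟨hx, hxu⟩
  set e₀ := (hh x hx).toOpenPartialHomeomorph h hL (by simp) with he₀
  have hcoe : ∀ y, e₀ y = h y := fun y => rfl
  refine ⟨e₀.restrOpen V hVo, ⟨(hh x hx).mem_toOpenPartialHomeomorph_source hL (by simp), hx, hxu⟩,
    fun y hy => hy.2.1, hcoe, ?_⟩
  intro y hy
  set e := e₀.restrOpen V hVo
  have hy' : e.symm y ∈ V := (e.map_target hy).2
  obtain ⟨L', hL'⟩ := hder _ hy'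
  exact e.contDiffAt_symm hy hL' (hh _ hy'.1)

section Charts

variable {S : Type*} [TopologicalSpace S] [ChartedSpace (E 2) S] [IsManifold (𝓡 2) ∞ S]

/-- The map `w`, read in a chart, has a smooth local inverse; composing the two gives a member of
the maximal atlas. -/
theorem exists_chart_eq {w : S → E 2} {p : S} {U : Set S} (hU : IsOpen U) (hp : p ∈ U)
    (hw : ∀ x ∈ U, ContMDiffAt (𝓡 2) (𝓡 2) ∞ w x)
    (hinj : Function.Injective (mfderiv (𝓡 2) (𝓡 2) w p)) :
    ∃ ψ ∈ IsManifold.maximalAtlas (𝓡 2) ∞ S, p ∈ ψ.source ∧ ψ.source ⊆ U ∧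
      ∀ x ∈ ψ.source, ψ x = w x := by
  set φ := chartAt (E 2) p with hφ
  have hφm : φ ∈ IsManifold.maximalAtlas (𝓡 2) ∞ S := IsManifold.chart_mem_maximalAtlas p
  have hps : p ∈ φ.source := mem_chart_source _ p
  set O : Set (E 2) := φ.target ∩ φ.symm ⁻¹' U with hO
  have hOo : IsOpen O := φ.isOpen_inter_preimage_symm hU
  have hinv : φ.symm (φ p) = p := φ.left_inv hps
  have hpO : φ p ∈ O := ⟨φ.map_source hps, by
    rw [Set.mem_preimage, hinv]; exact hp⟩
  have hsm : ∀ y ∈ O, ContMDiffAt (𝓡 2) (𝓡 2) ∞ φ.symm y := fun y hy =>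
    contMDiffAt_symm_of_mem_maximalAtlas hφm hy.1
  have hh : ∀ y ∈ O, ContDiffAt ℝ ∞ (w ∘ φ.symm) y := fun y hy =>
    contMDiffAt_iff_contDiffAt.1 ((hw _ hy.2).comp y (hsm y hy))
  have hφd : φ.MDifferentiable (𝓡 2) (𝓡 2) := mdifferentiable_chart p
  have hinj' : Function.Injective (fderiv ℝ (w ∘ φ.symm) (φ p)) := by
    have hc := mfderiv_comp (I' := 𝓡 2) (I'' := 𝓡 2) (φ p)
      ((hw _ hpO.2).mdifferentiableAt (by simp)) ((hsm _ hpO).mdifferentiableAt (by simp))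
    rw [mfderiv_eq_fderiv] at hc
    have h1 := (hφd.symm.mfderiv_bijective hpO.1).1
    have h2 : Function.Injective (mfderiv (𝓡 2) (𝓡 2) w (φ.symm (φ p))) := by
      rw [hinv]; exact hinj
    have h3 := h2.comp h1
    intro u v huv
    refine h3 ?_
    have h4 : ∀ u : E 2, (fderiv ℝ (w ∘ φ.symm) (φ p) u : E 2) =
        mfderiv (𝓡 2) (𝓡 2) w (φ.symm (φ p)) (mfderiv (𝓡 2) (𝓡 2) φ.symm (φ p) u) := fun u =>
      congrArg (fun T : E 2 →L[ℝ] E 2 => T u) hc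
    exact (h4 u).symm.trans (huv.trans (h4 v))
  obtain ⟨e, hes, heO, hee, hesymm⟩ := exists_smooth_inverse hOo hpO hh hinj'
  have hsrc : ∀ x ∈ (φ.trans e).source, x ∈ φ.source ∧ φ x ∈ O ∧ x ∈ U := by
    intro x hx
    rw [OpenPartialHomeomorph.trans_source] at hx
    have h1 : φ x ∈ O := heO hx.2
    refine ⟨hx.1, h1, ?_⟩
    have := h1.2
    rwa [Set.mem_preimage, φ.left_inv hx.1] at this
  have hval : ∀ x ∈ (φ.trans e).source, (φ.trans e) x = w x := by
    intro x hx
    change e (φ x) = w x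
    rw [hee, Function.comp_apply, φ.left_inv (hsrc x hx).1]
  refine ⟨φ.trans e, ?_, ?_, fun x hx => (hsrc x hx).2.2, hval⟩
  · refine OpenPartialHomeomorph.mem_maximalAtlas_of_contMDiffOn _ ?_ ?_
    · intro x hx
      exact ((hw x (hsrc x hx).2.2).contMDiffWithinAt).congr hval (hval x hx)
    · intro y hy
      rw [OpenPartialHomeomorph.trans_target] at hy
      refine ContMDiffAt.contMDiffWithinAt ?_
      exact (contMDiffAt_symm_of_mem_maximalAtlas hφm hy.2).comp y
        (contMDiffAt_iff_contDiffAt.2 (hesymm y hy.1))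
  · rw [OpenPartialHomeomorph.trans_source]
    exact ⟨hps, hes⟩

/-- If `f` takes values in `Φ ∘ F`, and `n` is a left inverse of `F` on these values, then
`n ∘ Φ⁻¹ ∘ f` is a chart in which `f` is given by `Φ ∘ F`. -/
theorem exists_chart_of_leftInverse {f : S → NKSpace}
    (hf : IsSmoothImmersion (m := 2) (n := 6) f) (Φ : NKSpace ≃ₘ^∞⟮𝓡 6, 𝓡 6⟯ NKSpace)
    {F : E 2 → NKSpace} (hF : ContMDiff (𝓡 2) (𝓡 6) ∞ F) {n : NKSpace → E 2} {p : S} {N : Set S}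
    (hn : ∀ᶠ x in 𝓝 p, ContMDiffAt (𝓡 6) (𝓡 2) ∞ n (Φ.symm (f x)))
    (hfn : ∀ᶠ x in 𝓝 p, f x = Φ (F (n (Φ.symm (f x))))) (hN : N ∈ 𝓝 p) :
    ∃ ψ ∈ IsManifold.maximalAtlas (𝓡 2) ∞ S, p ∈ ψ.source ∧ ψ.source ⊆ N ∧
      ∀ x ∈ ψ.source, ψ x = n (Φ.symm (f x)) ∧ f x = Φ (F (ψ x)) := by
  obtain ⟨U, hUs, hU, hpU⟩ := eventually_nhds_iff.1 (hn.and (hfn.and hN))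
  set w : S → E 2 := fun x => n (Φ.symm (f x)) with hw
  have hws : ∀ x ∈ U, ContMDiffAt (𝓡 2) (𝓡 2) ∞ w x := fun x hx =>
    (hUs x hx).1.comp x ((Φ.symm.contMDiff _).comp x (hf.1 x))
  have hG : ContMDiff (𝓡 2) (𝓡 6) ∞ (fun y => Φ (F y)) := Φ.contMDiff.comp hF
  have heq : f =ᶠ[𝓝 p] (fun y => Φ (F y)) ∘ w := by
    filter_upwards [hfn] with x hx
    exact hx
  -- Near `p` the immersion `f` factors through `w`, so the differential of `w` at `p` is injective.
  have hinj : Function.Injective (mfderiv (𝓡 2) (𝓡 2) w p) := by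
    have h1 := heq.mfderiv_eq (I := 𝓡 2) (I' := 𝓡 6)
    have hc := mfderiv_comp (I' := 𝓡 2) (I'' := 𝓡 6) p
      ((hG (w p)).mdifferentiableAt (by simp)) ((hws p hpU).mdifferentiableAt (by simp))
    intro u v huv
    refine hf.2 p ?_
    have h2 : ∀ u : TangentSpace (𝓡 2) p, (mfderiv (𝓡 2) (𝓡 6) f p u : E 6) =
        mfderiv (𝓡 2) (𝓡 6) (fun y => Φ (F y)) (w p) (mfderiv (𝓡 2) (𝓡 2) w p u) := fun u =>
      (congrArg (fun T : E 2 →L[ℝ] E 6 => T u) h1).trans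
        (congrArg (fun T : E 2 →L[ℝ] E 6 => T u) hc)
    refine (h2 u).trans (Eq.trans ?_ (h2 v).symm)
    exact congrArg (fun z : E 2 => (mfderiv (𝓡 2) (𝓡 6) (fun y => Φ (F y)) (w p) z : E 6)) huv
  obtain ⟨ψ, hψ, hpψ, hψU, hψw⟩ := exists_chart_eq hU hpU hws hinj
  refine ⟨ψ, hψ, hpψ, fun x hx => (hUs x (hψU hx)).2.2, fun x hx => ⟨hψw x hx, ?_⟩⟩
  rw [hψw x hx]
  exact (hUs x (hψU hx)).2.1

end Charts

/-! ### Local congruence and local isometry with a model surface -/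

section Model

variable {S : Type*} [TopologicalSpace S] [ChartedSpace (E 2) S] {f : S → NKSpace}

theorem projM_of_mem_cplane {X Z : Mat3} (hX : projM X = X) (hZ : Z ∈ cplane X) :
    projM Z = Z := by
  obtain ⟨a, b, rfl⟩ := Submodule.mem_span_pair.1 hZ
  rw [map_add, map_smul, map_smul, hX, projM_J0]

theorem mem_cplane_smul {X Z : Mat3} (hZ : Z ∈ cplane X) (t : ℝ) : t • Z ∈ cplane X :=
  (cplane X).smul_mem t hZ

/-- The differential along `f` of a map that is known on the orbit of `K`. -/
theorem mfderiv_comp_orbit {m : ℕ} (hf : IsSmoothImmersion (m := 2) (n := 6) f) {X : Mat3}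
    {Ψ : NKSpace → E m} {c b : SL3} {x : S} (hfx : f x = cls (c * b))
    (hT : tanPlane f (c * b) x = cplane X) {D : Mat3 → E m}
    (hD : ∀ Z ∈ cplane X, HasDerivAt (fun t : ℝ => Ψ (cls (b * expSL (t • Z)))) (D Z) 0)
    (hΨ : MDifferentiableAt (𝓡 6) (𝓡 m) Ψ (cls b)) (v : TangentSpace (𝓡 2) x) :
    (mfderiv (𝓡 2) (𝓡 m) (fun x => Ψ (c⁻¹ • f x)) x v : E m) =
      D (horRel (c * b) (f x) (mfderiv (𝓡 2) (𝓡 6) f x v)) := by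
  set Z := horRel (c * b) (f x) (mfderiv (𝓡 2) (𝓡 6) f x v) with hZ
  have hZm : Z ∈ cplane X := hT ▸ mem_tanPlane (c * b) x v
  have hb : c⁻¹ • f x = cls b := by rw [hfx, smul_cls, inv_mul_cancel_left]
  have hΘ : MDifferentiableAt (𝓡 6) (𝓡 m) (fun q : NKSpace => Ψ (c⁻¹ • q)) (f x) := by
    refine MDifferentiableAt.comp (I' := 𝓡 6) (f x) ?_
      ((contMDiff_smul c⁻¹).mdifferentiableAt (by simp))
    rw [hb]; exact hΨ
  have h1 := mfderiv_eq_curve hΘ hfx.symm (mfderiv (𝓡 2) (𝓡 6) f x v)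
  have h2 : (fun t : ℝ => Ψ (c⁻¹ • cls (c * b * expSL (t • Z)))) =
      fun t : ℝ => Ψ (cls (b * expSL (t • Z))) := by
    funext t
    rw [smul_cls]
    congr 2
    group
  have hc := mfderiv_comp (I' := 𝓡 6) (I'' := 𝓡 m) x hΘ ((hf.1 x).mdifferentiableAt (by simp))
  have h3 : (mfderiv (𝓡 2) (𝓡 m) (fun x => Ψ (c⁻¹ • f x)) x v : E m) =
      mfderiv (𝓡 6) (𝓡 m) (fun q : NKSpace => Ψ (c⁻¹ • q)) (f x) (mfderiv (𝓡 2) (𝓡 6) f x v) :=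
    congrArg (fun T : E 2 →L[ℝ] E m => T v) hc
  refine h3.trans (h1.trans ?_)
  rw [← hZ, h2, mfderiv_eq_fderiv]
  exact (hD Z hZm).deriv

/-- Polar coordinates degenerate at `[Id]`, so the local inverse `n` of `F` may live near another
point `[k]` of the orbit. The translation by `c = a k⁻¹` moves that point to `f p`, and the points
`k exp Z` remain in `K`. -/
theorem isLocallyCongruent_of_model [IsManifold (𝓡 2) ∞ S]
    (hf : IsSmoothImmersion (m := 2) (n := 6) f) {X : Mat3}
    (hall : ∀ p, ∃ a, IsAdapted f p a (cplane X)) {F : E 2 → NKSpace}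
    (hF : ContMDiff (𝓡 2) (𝓡 6) ∞ F) {K : Subgroup SL3}
    (hK : ∀ Z ∈ cplane X, expSL Z ∈ K) {k : SL3} (hk : k ∈ K) {n : NKSpace → E 2}
    (hn : ∀ᶠ q in 𝓝 (cls k), ContMDiffAt (𝓡 6) (𝓡 2) ∞ n q)
    (hnF : ∀ᶠ q in 𝓝 (cls k), q ∈ orbit K → F (n q) = q) (p : S) {N : Set NKSpace}
    (hN : N ∈ 𝓝 (cls k)) :
    ∃ c : SL3, ∃ ψ ∈ IsManifold.maximalAtlas (𝓡 2) ∞ S, p ∈ ψ.source ∧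
      ∀ x ∈ ψ.source, c⁻¹ • f x ∈ N ∧ ψ x = n (c⁻¹ • f x) ∧ f x = c • F (ψ x) ∧
        ∃ b ∈ K, f x = cls (c * b) ∧ tanPlane f (c * b) x = cplane X := by
  obtain ⟨a, ha⟩ := hall p
  set c := a * k⁻¹ with hc
  have hcp : c⁻¹ • f p = cls k := by
    rw [← ha.cls_eq, smul_cls]; congr 1; rw [hc]; group
  have hcont : Filter.Tendsto (fun x => c⁻¹ • f x) (𝓝 p) (𝓝 (cls k)) := by
    rw [← hcp]
    exact ((contMDiff_smul c⁻¹).continuous.comp hf.1.continuous).continuousAt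
  have hb : ∀ᶠ x in 𝓝 p, ∃ b ∈ K, f x = cls (c * b) ∧ tanPlane f (c * b) x = cplane X := by
    filter_upwards [ha.eventually] with x hx
    obtain ⟨Z, hZ, hfx, hT⟩ := hx
    have h1 : c * (k * expSL Z) = a * expSL Z := by rw [hc]; group
    exact ⟨k * expSL Z, K.mul_mem hk (hK Z hZ), by rw [h1, hfx], by rw [h1, hT]⟩
  have hfn : ∀ᶠ x in 𝓝 p, f x = c • F (n (c⁻¹ • f x)) := by
    filter_upwards [hcont.eventually hnF, hb] with x hx hxb
    obtain ⟨b, hb, hfx, -⟩ := hxb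
    rw [hx ⟨b, hb, by rw [hfx, smul_cls, inv_mul_cancel_left]⟩, smul_inv_smul]
  obtain ⟨ψ, hψ, hpψ, hψN, hψ'⟩ := exists_chart_of_leftInverse hf (smulDiffeo c) hF
    (n := n) (p := p) (hcont.eventually hn) hfn (Filter.inter_mem hb (hcont hN))
  exact ⟨c, ψ, hψ, hpψ, fun x hx => ⟨(hψN hx).2, (hψ' x hx).1, (hψ' x hx).2, (hψN hx).1⟩⟩

/-- The conclusions about a surface with tangent planes conjugate to the plane of `X`, in terms of
a parametrization `F` of an orbit with local left inverse `n`, and of a map `Ψ` that is isometric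
on the orbit. -/
theorem conclusion_of_model [IsManifold (𝓡 2) ∞ S]
    (hf : IsSmoothImmersion (m := 2) (n := 6) f) {X : Mat3}
    (hall : ∀ p, ∃ a, IsAdapted f p a (cplane X)) {F : E 2 → NKSpace}
    (hF : ContMDiff (𝓡 2) (𝓡 6) ∞ F) {K : Subgroup SL3}
    (hK : ∀ Z ∈ cplane X, expSL Z ∈ K) {k : SL3} (hk : k ∈ K) {n : NKSpace → E 2}
    (hn : ∀ᶠ q in 𝓝 (cls k), ContMDiffAt (𝓡 6) (𝓡 2) ∞ n q)
    (hnF : ∀ᶠ q in 𝓝 (cls k), q ∈ orbit K → F (n q) = q)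
    {m ν : ℕ} {Q : Set (E m)} {Ψ : NKSpace → E m}
    (hΨ : ∀ b ∈ K, ContMDiffAt (𝓡 6) (𝓡 m) ∞ Ψ (cls b)) {V : Set (E 2)}
    (hV : V ∈ 𝓝 (n (cls k))) (hinj : Set.InjOn (fun y => Ψ (F y)) V)
    (himg : ∀ V' ⊆ V, IsOpen V' → ∃ O, IsOpen O ∧ (fun y => Ψ (F y)) '' V' = O ∩ Q)
    {D : SL3 → Mat3 → E m}
    (hD : ∀ b ∈ K, ∀ Z ∈ cplane X,
      HasDerivAt (fun t : ℝ => Ψ (cls (b * expSL (t • Z)))) (D b Z) 0)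
    (hiso : ∀ b ∈ K, ∀ Z ∈ cplane X, ∀ Z' ∈ cplane X,
      semiEuclid ν (D b Z) (D b Z') = -(1 / 2) * (Z * Z').trace) :
    IsLocallyIsometricTo (m := 2) (pullback g f) ν Q ∧ IsLocallyCongruent g f F := by
  constructor
  · intro p
    have hnc : ContinuousAt n (cls k) := hn.self_of_nhds.continuousAt
    obtain ⟨c, ψ, hψ, hpψ, H⟩ := isLocallyCongruent_of_model hf hall hF hK hk hn hnF p (hnc hV)
    have hVψ : ∀ x ∈ ψ.source, ψ x ∈ V := fun x hx => by
      rw [(H x hx).2.1]; exact (H x hx).1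
    have hval : ∀ x ∈ ψ.source, Ψ (c⁻¹ • f x) = Ψ (F (ψ x)) := fun x hx => by
      conv_lhs => rw [(H x hx).2.2.1, inv_smul_smul]
    have himage : (fun x => Ψ (c⁻¹ • f x)) '' ψ.source = (fun y => Ψ (F y)) '' ψ.target := by
      ext z
      constructor
      · rintro ⟨x, hx, rfl⟩
        exact ⟨ψ x, ψ.map_source hx, (hval x hx).symm⟩
      · rintro ⟨y, hy, rfl⟩
        refine ⟨ψ.symm y, ψ.map_target hy, ?_⟩
        have := hval _ (ψ.map_target hy)
        rwa [ψ.right_inv hy] at this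
    refine ⟨ψ.source, fun x => Ψ (c⁻¹ • f x), ψ.open_source, hpψ, ?_, ?_, ?_, ?_⟩
    · intro x hx
      obtain ⟨b, hb, hfx, -⟩ := (H x hx).2.2.2
      refine ContMDiffAt.contMDiffWithinAt ?_
      refine ContMDiffAt.comp (I' := 𝓡 6) x ?_ (((contMDiff_smul c⁻¹) _).comp x (hf.1 x))
      have : c⁻¹ • f x = cls b := by rw [hfx, smul_cls, inv_mul_cancel_left]
      rw [this]
      exact hΨ b hb
    · intro x hx x' hx' h
      have h' : Ψ (F (ψ x)) = Ψ (F (ψ x')) := by rw [← hval x hx, ← hval x' hx']; exact h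
      exact ψ.injOn hx hx' (hinj (hVψ x hx) (hVψ x' hx') h')
    · rw [himage]
      refine himg _ ?_ ψ.open_target
      intro y hy
      rw [← ψ.right_inv hy]
      exact hVψ _ (ψ.map_target hy)
    · intro x hx v w
      obtain ⟨b, hb, hfx, hT⟩ := (H x hx).2.2.2
      have key := mfderiv_comp_orbit hf hfx hT (hD b hb) ((hΨ b hb).mdifferentiableAt (by simp))
      have hmem : ∀ v : TangentSpace (𝓡 2) x,
          horRel (c * b) (f x) (mfderiv (𝓡 2) (𝓡 6) f x v) ∈ cplane X := fun v =>
        hT ▸ mem_tanPlane (c * b) x v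
      refine (congrArg₂ (semiEuclid ν) (key v) (key w)).trans ?_
      rw [hiso b hb _ (hmem v) _ (hmem w), ← g_eq_horRel]
      rfl
  · intro p
    obtain ⟨c, ψ, hψ, hpψ, H⟩ := isLocallyCongruent_of_model hf hall hF hK hk hn hnF p
      Filter.univ_mem
    exact ⟨smulDiffeo c, isIsom_smul c, ψ, hψ, hpψ, fun x hx => (H x hx).2.2.1⟩

theorem contMDiff_cls_expSL {L : E 2 → Mat3} (hL : ContDiff ℝ ∞ L) (h : ∀ y, (L y).trace = 0) :
    ContMDiff (𝓡 2) (𝓡 6) ∞ (fun y => cls (expSL (L y))) := fun _ =>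
  contMDiffAt_cls (contDiff_expSL_comp hL h).contDiffAt

end Model

/-! ### Maps induced on the homogeneous space -/

/-- `ψ` is smooth on the open set `Ω`, and `Ω` and `ψ` are invariant under `H`. -/
structure IsInvariantMap {m : ℕ} (Ω : Set SL3) (ψ : Mat3 → E m) : Prop where
  isOpen : IsOpen Ω
  smooth : ∀ a ∈ Ω, ContDiffAt ℝ ∞ ψ (a : Mat3)
  mul_mem : ∀ a ∈ Ω, ∀ h ∈ H, a * h ∈ Ω
  map_mul : ∀ a ∈ Ω, ∀ h ∈ H, ψ ((a * h : SL3) : Mat3) = ψ (a : Mat3)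

/-- The map induced by an invariant map. -/
noncomputable def descend {m : ℕ} (ψ : Mat3 → E m) (q : NKSpace) : E m := ψ (q.out : Mat3)

section Descend

variable {m : ℕ} {Ω : Set SL3} {ψ : Mat3 → E m}

theorem IsInvariantMap.descend_cls (h : IsInvariantMap Ω ψ) {a : SL3} (ha : a ∈ Ω) :
    descend ψ (cls a) = ψ (a : Mat3) := by
  have := h.map_mul a ha _ (inv_mul_out_mem a)
  rwa [mul_inv_cancel_left] at this

/-- Invariance makes the arbitrary choice of `q.out` harmless: near `cls a` the induced map is `ψ`
evaluated on a smooth local section. -/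
theorem IsInvariantMap.contMDiffAt_descend (h : IsInvariantMap Ω ψ) {a : SL3} (ha : a ∈ Ω) :
    ContMDiffAt (𝓡 6) (𝓡 m) ∞ (descend ψ) (cls a) := by
  have hout : (cls a).out ∈ Ω := by
    have := h.mul_mem a ha _ (inv_mul_out_mem a)
    rwa [mul_inv_cancel_left] at this
  refine contMDiffAt_of_comp_secSL ?_
  set b := (cls a).out
  have hs : ContDiffAt ℝ ∞ (fun y : E 6 => ((b * secSL y : SL3) : Mat3)) y0 := by
    simp only [Matrix.SpecialLinearGroup.coe_mul]
    exact contDiffAt_const.mul (contDiffAt_coe_secSL (by simp [detFun_y0]))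
  have hb : b * secSL y0 = b := by rw [secSL_y0, mul_one]
  have h1 : ContDiffAt ℝ ∞ (fun y : E 6 => ψ ((b * secSL y : SL3) : Mat3)) y0 := by
    refine ContDiffAt.comp (g := ψ) y0 ?_ hs
    rw [hb]; exact h.smooth b hout
  refine (contMDiffAt_iff_contDiffAt.2 h1).congr_of_eventuallyEq ?_
  have hc : ContinuousAt (fun y : E 6 => b * secSL y) y0 := continuousAt_SL.2 hs.continuousAt
  have hm : b * secSL y0 ∈ Ω := by rwa [hb]
  filter_upwards [hc (h.isOpen.mem_nhds hm)] with y hy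
  exact h.descend_cls hy

theorem IsInvariantMap.eventually_contMDiffAt (h : IsInvariantMap Ω ψ) {a : SL3} (ha : a ∈ Ω) :
    ∀ᶠ q in 𝓝 (cls a), ContMDiffAt (𝓡 6) (𝓡 m) ∞ (descend ψ) q := by
  have hopen : IsOpen (cls '' Ω) := QuotientGroup.isOpenMap_coe _ h.isOpen
  filter_upwards [hopen.mem_nhds ⟨a, ha, rfl⟩] with q hq
  obtain ⟨b, hb, rfl⟩ := hq
  exact h.contMDiffAt_descend hb

end Descend

/-! ### Surfaces of revolution -/

/-- A surface of revolution in polar coordinates. -/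
noncomputable def polar (r : ℝ) (σ χ : ℝ → ℝ) (y : E 2) : E 3 :=
  !₂[r * (σ (2 * y 0) * Real.cos (y 1)), r * (σ (2 * y 0) * Real.sin (y 1)), r * χ (2 * y 0)]

/-- The horizontal part of the polar coordinates. -/
noncomputable def polarPlane (r : ℝ) (σ : ℝ → ℝ) (y : E 2) : E 2 :=
  !₂[r * (σ (2 * y 0) * Real.cos (y 1)), r * (σ (2 * y 0) * Real.sin (y 1))]

theorem contDiff_polarPlane (r : ℝ) {σ : ℝ → ℝ} (hσ : ContDiff ℝ ∞ σ) :
    ContDiff ℝ ∞ (polarPlane r σ) := by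
  have h0 : ContDiff ℝ ∞ (fun y : E 2 => y 0) := (EuclideanSpace.proj 0 : E 2 →L[ℝ] ℝ).contDiff
  have h1 : ContDiff ℝ ∞ (fun y : E 2 => y 1) := (EuclideanSpace.proj 1 : E 2 →L[ℝ] ℝ).contDiff
  have hs : ContDiff ℝ ∞ (fun y : E 2 => σ (2 * y 0)) := hσ.comp (contDiff_const.mul h0)
  rw [contDiff_euclidean]
  intro i
  fin_cases i
  · exact contDiff_const.mul (hs.mul (Real.contDiff_cos.comp h1))
  · exact contDiff_const.mul (hs.mul (Real.contDiff_sin.comp h1))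

/-- At angle `0` the derivative is diagonal with entries `2 r χ(2u)` and `r σ(2u)`. -/
theorem fderiv_polarPlane_injective {r : ℝ} (hr : r ≠ 0) {σ χ : ℝ → ℝ} (hσ : ContDiff ℝ ∞ σ)
    {u : ℝ} (hd : HasDerivAt σ (χ (2 * u)) (2 * u)) (h1 : σ (2 * u) ≠ 0) (h2 : χ (2 * u) ≠ 0) :
    Function.Injective (fderiv ℝ (polarPlane r σ) !₂[u, 0]) := by
  set x : E 2 := !₂[u, 0] with hx
  have hx0 : x 0 = u := rfl
  have hx1 : x 1 = 0 := rfl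
  have hD := ((contDiff_polarPlane r hσ).differentiable (by simp) x).hasFDerivAt
  have p0 : HasFDerivAt (fun y : E 2 => y 0) (EuclideanSpace.proj 0 : E 2 →L[ℝ] ℝ) x :=
    (EuclideanSpace.proj 0 : E 2 →L[ℝ] ℝ).hasFDerivAt
  have p1 : HasFDerivAt (fun y : E 2 => y 1) (EuclideanSpace.proj 1 : E 2 →L[ℝ] ℝ) x :=
    (EuclideanSpace.proj 1 : E 2 →L[ℝ] ℝ).hasFDerivAt
  have ps : HasFDerivAt (fun y : E 2 => σ (2 * y 0))
      (χ (2 * u) • ((2 : ℝ) • (EuclideanSpace.proj 0 : E 2 →L[ℝ] ℝ))) x :=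
    HasDerivAt.comp_hasFDerivAt (h₂ := σ) x (by rw [hx0]; exact hd) (p0.const_mul 2)
  have q0 := (ps.mul p1.cos).const_mul r
  have q1 := (ps.mul p1.sin).const_mul r
  rw [injective_iff_map_eq_zero]
  intro v hv
  have c0 := congrArg (fun T : E 2 →L[ℝ] ℝ => T v)
    (((EuclideanSpace.proj 0 : E 2 →L[ℝ] ℝ).hasFDerivAt.comp x hD).unique q0)
  have c1 := congrArg (fun T : E 2 →L[ℝ] ℝ => T v)
    (((EuclideanSpace.proj 1 : E 2 →L[ℝ] ℝ).hasFDerivAt.comp x hD).unique q1)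
  simp [hv, hx0, hx1, hr, h1, h2] at c0 c1
  ext i
  fin_cases i
  · exact c0
  · exact c1

section Revolution

variable {S : Type*} [TopologicalSpace S] [ChartedSpace (E 2) S] {f : S → NKSpace}

/-- The map `ψ` turns the parametrization into a surface of revolution. By `hQ` the part of `Q` in
the upper half space is a graph over the horizontal plane, so the local inverse `e.symm` of the
plane polar coordinates, applied to the horizontal part of `ψ`, inverts `F` on the orbit. -/
theorem conclusion_of_polar [IsManifold (𝓡 2) ∞ S]
    (hf : IsSmoothImmersion (m := 2) (n := 6) f) {X : Mat3}
    (hall : ∀ p, ∃ a, IsAdapted f p a (cplane X)) {F : E 2 → NKSpace}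
    (hF : ContMDiff (𝓡 2) (𝓡 6) ∞ F) {K : Subgroup SL3}
    (hK : ∀ Z ∈ cplane X, expSL Z ∈ K)
    {r : ℝ} (hr : 0 < r) {σ χ : ℝ → ℝ} (hσ : ContDiff ℝ ∞ σ) (hχ : Continuous χ) {u : ℝ}
    (hd : HasDerivAt σ (χ (2 * u)) (2 * u)) (hσu : σ (2 * u) ≠ 0) (hχu : 0 < χ (2 * u))
    {ν : ℕ} {Q : Set (E 3)}
    (hQ : ∀ z ∈ Q, ∀ z' ∈ Q, 0 < z 2 → 0 < z' 2 → z 0 = z' 0 → z 1 = z' 1 → z = z')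
    {Ω : Set SL3} {ψ : Mat3 → E 3} (hψ : IsInvariantMap Ω ψ) (hKΩ : ∀ b ∈ K, b ∈ Ω)
    (hψQ : ∀ b ∈ K, ψ (b : Mat3) ∈ Q)
    (hinj : ∀ b ∈ K, ∀ b' ∈ K, ψ (b : Mat3) = ψ (b' : Mat3) → cls b = cls b')
    (hψF : ∀ y, ∃ b ∈ K, F y = cls b ∧ ψ (b : Mat3) = polar r σ χ y)
    {D : SL3 → Mat3 → E 3}
    (hD : ∀ b ∈ K, ∀ Z ∈ cplane X,
      HasDerivAt (fun t : ℝ => ψ ((b * expSL (t • Z) : SL3) : Mat3)) (D b Z) 0)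
    (hiso : ∀ b ∈ K, ∀ Z ∈ cplane X, ∀ Z' ∈ cplane X,
      semiEuclid ν (D b Z) (D b Z') = -(1 / 2) * (Z * Z').trace) :
    IsLocallyIsometricTo (m := 2) (pullback g f) ν Q ∧ IsLocallyCongruent g f F := by
  have hΨ : ∀ b ∈ K, descend ψ (cls b) = ψ (b : Mat3) := fun b hb => hψ.descend_cls (hKΩ b hb)
  have hΨF : ∀ y, descend ψ (F y) = polar r σ χ y := fun y => by
    obtain ⟨b, hb, hFy, hp⟩ := hψF y
    rw [hFy, hΨ b hb, hp]
  have hPQ : ∀ y, polar r σ χ y ∈ Q := fun y => by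
    obtain ⟨b, hb, -, hp⟩ := hψF y
    exact hp ▸ hψQ b hb
  set x : E 2 := !₂[u, 0] with hx
  obtain ⟨k, hk, hFk, hpk⟩ := hψF x
  have hU : IsOpen {y : E 2 | 0 < χ (2 * y 0)} :=
    isOpen_lt continuous_const (hχ.comp (by fun_prop))
  obtain ⟨e, hxe, heU, hee, hes⟩ := exists_smooth_inverse hU (x := x) hχu
    (fun y _ => (contDiff_polarPlane r hσ).contDiffAt)
    (fderiv_polarPlane_injective hr.ne' hσ hd hσu hχu.ne')
  let π : E 3 → E 2 := fun z => !₂[z 0, z 1]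
  have hπ : ContDiff ℝ ∞ π := by
    rw [contDiff_euclidean]
    intro i
    fin_cases i
    · exact (EuclideanSpace.proj 0 : E 3 →L[ℝ] ℝ).contDiff
    · exact (EuclideanSpace.proj 1 : E 3 →L[ℝ] ℝ).contDiff
  have hπe : ∀ y, π (polar r σ χ y) = e y := fun y => by
    rw [hee]; rfl
  have hpos : ∀ y ∈ e.source, 0 < (polar r σ χ y) 2 := fun y hy => mul_pos hr (heU hy)
  have hΨk : descend ψ (cls k) = polar r σ χ x := by rw [hΨ k hk, hpk]
  have hsm := hψ.eventually_contMDiffAt (hKΩ k hk)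
  have hcont : ContinuousAt (descend ψ) (cls k) := hsm.self_of_nhds.continuousAt
  have htarget : ∀ᶠ q in 𝓝 (cls k), π (descend ψ q) ∈ e.target := by
    have h1 : ContinuousAt (fun q => π (descend ψ q)) (cls k) :=
      hπ.continuous.continuousAt.comp hcont
    refine h1 (e.open_target.mem_nhds ?_)
    change π (descend ψ (cls k)) ∈ e.target
    rw [hΨk, hπe]
    exact e.map_source hxe
  have hz : ∀ᶠ q in 𝓝 (cls k), 0 < (descend ψ q) 2 := by
    have h1 : ContinuousAt (fun q => (descend ψ q) 2) (cls k) :=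
      (EuclideanSpace.proj 2 : E 3 →L[ℝ] ℝ).continuous.continuousAt.comp hcont
    refine h1.eventually (lt_mem_nhds ?_)
    change 0 < (descend ψ (cls k)) 2
    rw [hΨk]
    exact hpos x hxe
  have heq : ∀ q ∈ orbit K, π (descend ψ q) ∈ e.target → 0 < (descend ψ q) 2 →
      F (e.symm (π (descend ψ q))) = q := by
    rintro _ ⟨b, hb, rfl⟩ ht hpz
    rw [hΨ b hb] at ht hpz ⊢
    set y := e.symm (π (ψ (b : Mat3))) with hy
    have hys : y ∈ e.source := e.map_target ht
    have h1 : π (polar r σ χ y) = π (ψ (b : Mat3)) := by rw [hπe, hy, e.right_inv ht]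
    have h2 : polar r σ χ y = ψ (b : Mat3) :=
      hQ _ (hPQ y) _ (hψQ b hb) (hpos y hys) hpz (congrArg (fun z : E 2 => z 0) h1)
        (congrArg (fun z : E 2 => z 1) h1)
    obtain ⟨b', hb', hFy, hp⟩ := hψF y
    rw [hFy]
    exact hinj b' hb' b hb (by rw [hp, h2])
  refine conclusion_of_model hf hall hF hK hk (n := fun q => e.symm (π (descend ψ q)))
    (Ψ := descend ψ) (V := e.source) (D := D) ?_ ?_ ?_ ?_ ?_ ?_ ?_ hiso
  · filter_upwards [hsm, htarget] with q hq ht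
    exact ((hes _ ht).comp_contMDiffAt (f := fun q => π (descend ψ q))
      (hπ.contDiffAt.comp_contMDiffAt hq))
  · filter_upwards [htarget, hz] with q h1 h2 h3
    exact heq q h3 h1 h2
  · exact fun b hb => hψ.contMDiffAt_descend (hKΩ b hb)
  · refine e.open_source.mem_nhds ?_
    rw [hΨk, hπe, e.left_inv hxe]
    exact hxe
  · intro y hy y' hy' h
    refine e.injOn hy hy' ?_
    have h' : polar r σ χ y = polar r σ χ y' := by rw [← hΨF, ← hΨF]; exact h
    rw [← hπe, ← hπe, h']
  · intro V' hV' hVo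
    -- The image is the part of `Q` in the upper half space over the open set `e '' V'`.
    refine ⟨π ⁻¹' (e '' V') ∩ {z | 0 < z 2}, ?_, ?_⟩
    · exact ((e.isOpen_image_of_subset_source hVo hV').preimage hπ.continuous).inter
        (isOpen_lt continuous_const (by fun_prop))
    · ext z
      constructor
      · rintro ⟨y, hy, rfl⟩
        change descend ψ (F y) ∈ _
        rw [hΨF]
        exact ⟨⟨⟨y, hy, (hπe y).symm⟩, hpos y (hV' hy)⟩, hPQ y⟩
      · rintro ⟨⟨⟨y, hy, hyz⟩, hz0⟩, hzQ⟩
        refine ⟨y, hy, ?_⟩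
        change descend ψ (F y) = z
        rw [hΨF]
        rw [← hπe] at hyz
        exact hQ _ (hPQ y) _ hzQ (hpos y (hV' hy)) hz0 (congrArg (fun z : E 2 => z 0) hyz)
          (congrArg (fun z : E 2 => z 1) hyz)
  · intro b hb Z hZ
    refine (hD b hb Z hZ).congr_of_eventuallyEq (Filter.Eventually.of_forall fun t => ?_)
    exact hΨ _ (K.mul_mem hb (hK _ (mem_cplane_smul hZ t)))

/-- The range of a parametrization is the orbit, if all points of the orbit are reached by polar
coordinates. -/
theorem range_eq_orbit_of_polar {F : E 2 → NKSpace} {K : Subgroup SL3} {r : ℝ} {σ χ : ℝ → ℝ}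
    {ψ : Mat3 → E 3}
    (hinj : ∀ b ∈ K, ∀ b' ∈ K, ψ (b : Mat3) = ψ (b' : Mat3) → cls b = cls b')
    (hψF : ∀ y, ∃ b ∈ K, F y = cls b ∧ ψ (b : Mat3) = polar r σ χ y)
    (hsurj : ∀ b ∈ K, ∃ y, ψ (b : Mat3) = polar r σ χ y) : Set.range F = orbit K := by
  ext q
  constructor
  · rintro ⟨y, rfl⟩
    obtain ⟨b, hb, h, -⟩ := hψF y
    exact ⟨b, hb, h.symm⟩
  · rintro ⟨b, hb, rfl⟩
    obtain ⟨y, hy⟩ := hsurj b hb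
    obtain ⟨b', hb', h, hp⟩ := hψF y
    exact ⟨y, by rw [h, hinj b' hb' b hb (by rw [hp, hy])]⟩

end Revolution

/-! ### The orbits of `SO(3)` and `SO⁺(2,1)` -/

/-- The exponential of matrices with `N³ = ∓N`. -/
theorem exp_smul_of_cube {N : Mat3} {ε : ℝ} (hε : ε * ε = 1) (hN : N * (N * N) = -ε • N)
    {σ χ : ℝ → ℝ} (hσ : ∀ s, HasDerivAt σ (χ s) s) (hχ : ∀ s, HasDerivAt χ (-ε * σ s) s)
    (hσ0 : σ 0 = 0) (hχ0 : χ 0 = 1) (s : ℝ) :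
    NormedSpace.exp (s • N) = 1 + σ s • N + (ε * (1 - χ s)) • (N * N) := by
  set B : ℝ → Mat3 := fun s => 1 + σ s • N + (ε * (1 - χ s)) • (N * N) with hB
  -- The relation `N³ = -ε N` makes the candidate `B` a solution of `B' = B N`; hence `B s * exp (-s
  -- N)` is constant.
  have hBd : ∀ s, HasDerivAt B (B s * N) s := by
    intro s
    have h1 := ((hσ s).smul_const N).const_add (1 : Mat3)
    have h2 := (((hχ s).const_sub 1).const_mul ε).smul_const (N * N)
    refine (h1.add h2).congr_deriv ?_
    simp only [hB, add_mul, one_mul, smul_mul_assoc, mul_assoc, hN]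
    have h3 : ε * -(-ε * σ s) = σ s := by linear_combination σ s * hε
    have h4 : (ε * (1 - χ s)) • -ε • N = (χ s - 1) • N := by
      rw [smul_smul]
      congr 1
      linear_combination (χ s - 1) * hε
    rw [h3, h4]
    module
  have hEd : ∀ s : ℝ, HasDerivAt (fun s : ℝ => NormedSpace.exp (s • (-N)))
      (-N * NormedSpace.exp (s • (-N))) s := fun s => hasDerivAt_exp_smul_const' (𝕂 := ℝ) (-N) s
  have hc : ∀ s, HasDerivAt (fun s => B s * NormedSpace.exp (s • (-N))) 0 s := by
    intro s
    refine ((hBd s).mul (hEd s)).congr_deriv ?_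
    rw [mul_assoc, neg_mul, mul_neg, add_neg_cancel]
  have hconst := is_const_of_deriv_eq_zero (fun s => (hc s).differentiableAt)
    (fun s => (hc s).deriv) s 0
  have h0 : B 0 = 1 := by simp [hB, hσ0, hχ0]
  have h1 : B s * NormedSpace.exp (s • (-N)) = 1 := by
    simpa [h0] using hconst
  have h2 : NormedSpace.exp (s • (-N)) * NormedSpace.exp (s • N) = 1 := by
    rw [smul_neg, ← Matrix.exp_add_of_commute _ _ (Commute.refl (s • N)).neg_left, neg_add_cancel,
      NormedSpace.exp_zero]
  calc NormedSpace.exp (s • N)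
      = B s * NormedSpace.exp (s • (-N)) * NormedSpace.exp (s • N) := by rw [h1, one_mul]
    _ = B s := by rw [mul_assoc, h2, mul_one]

/-- The Gram matrix `diag(1, 1, ε)`. -/
def gram (ε : ℝ) : Mat3 := Matrix.diagonal ![1, 1, ε]

theorem gram_one : gram 1 = 1 := by
  ext i j; fin_cases i <;> fin_cases j <;> simp [gram]

theorem gram_mul_gram {ε : ℝ} (hε : ε * ε = 1) : gram ε * gram ε = 1 := by
  rw [gram, Matrix.diagonal_mul_diagonal, ← Matrix.diagonal_one]
  congr 1
  ext i
  fin_cases i <;> simp [hε]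

/-- The norm of the third column. -/
def colNorm (ε : ℝ) (A : Mat3) : ℝ := ε * (A 0 2 ^ 2 + A 1 2 ^ 2) + A 2 2 ^ 2

/-- The third column. -/
noncomputable def colL : Mat3 →L[ℝ] E 3 :=
  LinearMap.toContinuousLinearMap
    { toFun := fun A => !₂[A 0 2, A 1 2, A 2 2]
      map_add' := fun A B => by ext i; fin_cases i <;> simp
      map_smul' := fun c A => by ext i; fin_cases i <;> simp }

theorem colL_apply (A : Mat3) : colL A = !₂[A 0 2, A 1 2, A 2 2] := rfl

/-- The normalized third column. -/
noncomputable def colMap (ε : ℝ) (A : Mat3) : E 3 := (√(colNorm ε A))⁻¹ • colL A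

theorem colMap_of_norm_eq_one {ε : ℝ} {A : Mat3} (h : colNorm ε A = 1) :
    colMap ε A = colL A := by
  rw [colMap, h]; simp

theorem contDiff_colNorm (ε : ℝ) : ContDiff ℝ ∞ (colNorm ε) := by
  have h : ∀ i j, ContDiff ℝ ∞ (fun A : Mat3 => A i j) := fun i j => (entryL i j).contDiff
  exact (contDiff_const.mul (((h 0 2).pow 2).add ((h 1 2).pow 2))).add ((h 2 2).pow 2)

/-- An element of `H` multiplies the third column by a positive number, which the normalization
removes. -/
theorem isInvariantMap_colMap (ε : ℝ) :
    IsInvariantMap {a : SL3 | 0 < colNorm ε (a : Mat3)} (colMap ε) := by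
  have key : ∀ (a : SL3), ∀ h ∈ H, ∃ γ : ℝ, 0 < γ ∧
      colNorm ε ((a * h : SL3) : Mat3) = γ ^ 2 * colNorm ε (a : Mat3) ∧
      colL ((a * h : SL3) : Mat3) = γ • colL (a : Mat3) := by
    intro a h hh
    obtain ⟨α, β, γ, hd, hm⟩ := exists_of_mem_H hh
    refine ⟨γ, ?_, ?_, ?_⟩
    · by_contra hc
      nlinarith [sq_nonneg α, sq_nonneg β]
    · rw [Matrix.SpecialLinearGroup.coe_mul, hm]
      simp [colNorm, Matrix.mul_apply, Fin.sum_univ_three]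
      ring
    · rw [Matrix.SpecialLinearGroup.coe_mul, hm]
      ext i
      fin_cases i <;> simp [colL_apply, Matrix.mul_apply, Fin.sum_univ_three, mul_comm]
  refine ⟨?_, ?_, ?_, ?_⟩
  · have hc : Continuous fun a : SL3 => colNorm ε (a : Mat3) := by
      have h := continuous_entry
      exact (continuous_const.mul (((h 0 2).pow 2).add ((h 1 2).pow 2))).add ((h 2 2).pow 2)
    exact isOpen_lt continuous_const hc
  · intro a ha
    have h1 : √(colNorm ε (a : Mat3)) ≠ 0 := (Real.sqrt_pos.2 ha).ne'
    exact (((contDiff_colNorm ε).contDiffAt.sqrt (ne_of_gt ha)).inv h1).smul colL.contDiff.contDiffAt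
  · intro a ha h hh
    obtain ⟨γ, hγ, h1, -⟩ := key a h hh
    change 0 < colNorm ε _
    rw [h1]
    exact mul_pos (pow_pos hγ 2) ha
  · intro a ha h hh
    obtain ⟨γ, hγ, h1, h2⟩ := key a h hh
    rw [colMap, colMap, h1, h2, Real.sqrt_mul (sq_nonneg γ), Real.sqrt_sq hγ.le, smul_smul]
    congr 1
    field_simp

/-! ### Isometries of the form `diag(1, 1, ε)` -/

section Gram

variable {ε : ℝ} {b : SL3}

theorem gram_entries (hb : (b : Mat3).transpose * gram ε * (b : Mat3) = gram ε) (i j : Fin 3) :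
    (b : Mat3) 0 i * (b : Mat3) 0 j + (b : Mat3) 1 i * (b : Mat3) 1 j +
      ε * ((b : Mat3) 2 i * (b : Mat3) 2 j) = gram ε i j := by
  rw [← hb]
  simp only [gram, Matrix.mul_apply, Fin.sum_univ_three, Matrix.transpose_apply]
  simp
  ring

/-- The last diagonal entry of `hb` reads `x² + y² + ε z² = ε`; multiply it by `ε`. -/
theorem colNorm_of_gram (hε : ε * ε = 1)
    (hb : (b : Mat3).transpose * gram ε * (b : Mat3) = gram ε) : colNorm ε (b : Mat3) = 1 := by
  have h := gram_entries hb 2 2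
  simp [gram] at h
  rw [colNorm]
  linear_combination ε * h + (1 - (b : Mat3) 2 2 ^ 2) * hε

theorem gram_inv_mul {b' : SL3} (hb : (b : Mat3).transpose * gram ε * (b : Mat3) = gram ε)
    (hb' : (b' : Mat3).transpose * gram ε * (b' : Mat3) = gram ε) :
    ((b⁻¹ * b' : SL3) : Mat3).transpose * gram ε * ((b⁻¹ * b' : SL3) : Mat3) = gram ε := by
  rw [Matrix.SpecialLinearGroup.coe_mul, Matrix.transpose_mul]
  have h1 : ((b⁻¹ : SL3) : Mat3).transpose * gram ε * ((b⁻¹ : SL3) : Mat3) = gram ε := by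
    conv_lhs => rw [← hb]
    have h2 : ((b⁻¹ : SL3) : Mat3).transpose * (b : Mat3).transpose = 1 := by
      rw [← Matrix.transpose_mul, coe_mul_inv, Matrix.transpose_one]
    calc _ = (((b⁻¹ : SL3) : Mat3).transpose * (b : Mat3).transpose) * gram ε *
          ((b : Mat3) * ((b⁻¹ : SL3) : Mat3)) := by simp only [mul_assoc]
      _ = gram ε := by rw [h2, coe_mul_inv, one_mul, mul_one]
  calc _ = (b' : Mat3).transpose * (((b⁻¹ : SL3) : Mat3).transpose * gram ε *
        ((b⁻¹ : SL3) : Mat3)) * (b' : Mat3) := by simp only [mul_assoc]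
    _ = gram ε := by rw [h1, hb']

/-- An isometry of `gram ε` that fixes the third basis vector is in `H`. -/
theorem mem_H_of_gram (hε : ε * ε = 1) (hb : (b : Mat3).transpose * gram ε * (b : Mat3) = gram ε)
    (h0 : (b : Mat3) 0 2 = 0) (h1 : (b : Mat3) 1 2 = 0) (h2 : (b : Mat3) 2 2 = 1) : b ∈ H := by
  have hε0 : ε ≠ 0 := fun h => by simp [h] at hε
  -- Orthogonality to the fixed third vector kills the rest of the third row; the remaining block is
  -- orthogonal of determinant one, hence a rotation.
  have e02 := gram_entries hb 0 2
  have e12 := gram_entries hb 1 2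
  have e00 := gram_entries hb 0 0
  have e11 := gram_entries hb 1 1
  have e01 := gram_entries hb 0 1
  have hdet := b.det_coe
  rw [Matrix.det_fin_three] at hdet
  simp [gram, h0, h1, h2, hε0] at e02 e12 e00 e11 e01 hdet
  rw [e02, e12] at e01
  rw [e02] at e00
  rw [e12] at e11
  simp at e00 e01 e11
  have k1 : (b : Mat3) 1 1 = (b : Mat3) 0 0 := by
    linear_combination -(b : Mat3) 1 1 * e00 + (b : Mat3) 0 0 * hdet + (b : Mat3) 1 0 * e01
  have k2 : (b : Mat3) 1 0 = -(b : Mat3) 0 1 := by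
    linear_combination -(b : Mat3) 1 0 * e11 + (b : Mat3) 1 1 * e01 - (b : Mat3) 0 1 * hdet
  refine mem_H_of (α := (b : Mat3) 0 0) (β := (b : Mat3) 0 1) (γ := 1) ?_ ?_
  · rw [← k1, ← k2]
    conv_lhs => rw [Matrix.eta_fin_three (b : Mat3)]
    rw [h0, h1, h2, e02, e12]
    rw [k1]
  · rw [k1, k2] at hdet
    linear_combination hdet

/-- If the third columns agree then `b⁻¹ b'` is an isometry fixing the third basis vector, so
`mem_H_of_gram` applies. -/
theorem cls_eq_of_colL_eq (hε : ε * ε = 1) {b' : SL3}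
    (hb : (b : Mat3).transpose * gram ε * (b : Mat3) = gram ε)
    (hb' : (b' : Mat3).transpose * gram ε * (b' : Mat3) = gram ε)
    (h : colL (b : Mat3) = colL (b' : Mat3)) : cls b = cls b' := by
  refine QuotientGroup.eq.2 ?_
  have hcol : ∀ i, (b' : Mat3) i 2 = (b : Mat3) i 2 := by
    intro i
    have := congrArg (fun z : E 3 => z i) h
    fin_cases i <;> exact this.symm
  have hcol' : ∀ i, ((b⁻¹ * b' : SL3) : Mat3) i 2 = (1 : Mat3) i 2 := by
    intro i
    rw [← coe_inv_mul b, Matrix.SpecialLinearGroup.coe_mul, Matrix.mul_apply, Matrix.mul_apply]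
    simp only [hcol]
  exact mem_H_of_gram hε (gram_inv_mul hb hb') (by rw [hcol']; simp) (by rw [hcol']; simp)
    (by rw [hcol']; simp)

theorem exists_of_mem_cplane_column {Z : Mat3} (hZ : Z ∈ cplane (ofComplex 0 1 (-ε : ℝ))) :
    ∃ c d : ℝ, Z = !![0, 0, c; 0, 0, d; -(ε * c), -(ε * d), 0] := by
  obtain ⟨c, d, rfl⟩ := Submodule.mem_span_pair.1 hZ
  refine ⟨c, d, ?_⟩
  rw [J0_ofComplex]
  ext i j
  fin_cases i <;> fin_cases j <;> simp [ofComplex, mul_comm]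

/-- Vectors of this plane are skew for the form: `Zᵀ = -G Z G⁻¹` with `G = gram ε`. Exponentiating
gives `(exp Z)ᵀ = G exp (-Z) G⁻¹`. -/
theorem gram_expSL (hε : ε * ε = 1) {Z : Mat3} (hZ : Z ∈ cplane (ofComplex 0 1 (-ε : ℝ))) :
    (expSL Z : Mat3).transpose * gram ε * (expSL Z : Mat3) = gram ε := by
  have htr : Z.trace = 0 := trace_of_projM (projM_of_mem_cplane (projM_ofComplex _ _ _) hZ)
  have hG := gram_mul_gram hε
  have hu : IsUnit (gram ε) := (Units.mk (gram ε) (gram ε) hG hG).isUnit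
  have hi : (gram ε)⁻¹ = gram ε := Matrix.inv_eq_right_inv hG
  have h1 : Z.transpose = gram ε * (-Z) * (gram ε)⁻¹ := by
    rw [hi]
    obtain ⟨c, d, rfl⟩ := exists_of_mem_cplane_column hZ
    ext i j
    fin_cases i <;> fin_cases j <;>
      simp [gram, Matrix.diagonal_mul, Matrix.mul_diagonal, mul_comm] <;>
      first
        | linear_combination c * hε
        | linear_combination d * hε
        | linear_combination -c * hε
        | linear_combination -d * hε
  have h2 : NormedSpace.exp (-Z) * NormedSpace.exp Z = 1 := by
    rw [← Matrix.exp_add_of_commute _ _ (Commute.refl Z).neg_left, neg_add_cancel,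
      NormedSpace.exp_zero]
  rw [coe_expSL htr, ← Matrix.exp_transpose, h1, Matrix.exp_conj _ _ hu, hi]
  calc _ = gram ε * (NormedSpace.exp (-Z) * ((gram ε * gram ε) * NormedSpace.exp Z)) := by
        simp only [mul_assoc]
    _ = gram ε := by rw [hG, one_mul, h2, mul_one]

theorem hasDerivAt_colMap (hε : ε * ε = 1)
    (hb : (b : Mat3).transpose * gram ε * (b : Mat3) = gram ε) {Z : Mat3}
    (hZ : Z ∈ cplane (ofComplex 0 1 (-ε : ℝ))) :
    HasDerivAt (fun t : ℝ => colMap ε ((b * expSL (t • Z) : SL3) : Mat3))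
      (colL ((b : Mat3) * Z)) 0 := by
  have htr : Z.trace = 0 := trace_of_projM (projM_of_mem_cplane (projM_ofComplex _ _ _) hZ)
  have h1 := colL.hasFDerivAt.comp_hasDerivAt (0 : ℝ) (hasDerivAt_mul_expSL b htr 0)
  rw [zero_smul, expSL_zero, mul_one] at h1
  refine h1.congr_of_eventuallyEq (Filter.Eventually.of_forall fun t => ?_)
  refine colMap_of_norm_eq_one (colNorm_of_gram hε ?_)
  rw [Matrix.SpecialLinearGroup.coe_mul, Matrix.transpose_mul]
  calc _ = (expSL (t • Z) : Mat3).transpose * ((b : Mat3).transpose * gram ε * (b : Mat3)) *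
        (expSL (t • Z) : Mat3) := by simp only [mul_assoc]
    _ = gram ε := by rw [hb, gram_expSL hε (mem_cplane_smul hZ t)]

/-- The target scalar product is `ε` times the form preserved by `b`, so `b` can be removed; for the
third columns `(c, d, 0)` and `(c', d', 0)` both sides are `ε (c c' + d d')`. -/
theorem colL_isometric (hε : ε * ε = 1)
    (hb : (b : Mat3).transpose * gram ε * (b : Mat3) = gram ε) {Z Z' : Mat3}
    (hZ : Z ∈ cplane (ofComplex 0 1 (-ε : ℝ))) (hZ' : Z' ∈ cplane (ofComplex 0 1 (-ε : ℝ))) :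
    let v := colL ((b : Mat3) * Z)
    let w := colL ((b : Mat3) * Z')
    ε * (v 0 * w 0 + v 1 * w 1) + v 2 * w 2 = -(1 / 2) * (Z * Z').trace := by
  obtain ⟨c, d, rfl⟩ := exists_of_mem_cplane_column hZ
  obtain ⟨c', d', rfl⟩ := exists_of_mem_cplane_column hZ'
  have e00 := gram_entries hb 0 0
  have e11 := gram_entries hb 1 1
  have e01 := gram_entries hb 0 1
  simp [gram] at e00 e01 e11
  simp [colL_apply, Matrix.mul_apply, Fin.sum_univ_three, Matrix.trace_fin_three]
  generalize (b : Mat3) = B at *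
  linear_combination ε * c * c' * e00 + ε * d * d' * e11 + ε * (c * d' + d * c') * e01 +
    (-(B 2 0 * B 2 0) * c * c' - B 2 1 * B 2 1 * d * d' - B 2 0 * B 2 1 * (c * d' + d * c')) * hε

/-- The third column of the exponential in polar coordinates. -/
theorem colL_expSL (hε : ε * ε = 1) {σ χ : ℝ → ℝ} (hσ : ∀ s, HasDerivAt σ (χ s) s)
    (hχ : ∀ s, HasDerivAt χ (-ε * σ s) s) (hσ0 : σ 0 = 0) (hχ0 : χ 0 = 1) (y : E 2) :
    colL (expSL ((2 * y 0) • (Real.cos (y 1) • ofComplex 0 1 (-ε : ℝ) +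
      Real.sin (y 1) • J0 (ofComplex 0 1 (-ε : ℝ)))) : Mat3) = polar 1 σ χ y := by
  set N := Real.cos (y 1) • ofComplex 0 1 (-ε : ℝ) + Real.sin (y 1) • J0 (ofComplex 0 1 (-ε : ℝ))
    with hN
  have hcs := Real.sin_sq_add_cos_sq (y 1)
  have hNe : N = !![0, 0, Real.cos (y 1); 0, 0, Real.sin (y 1);
      -(ε * Real.cos (y 1)), -(ε * Real.sin (y 1)), 0] := by
    rw [hN, J0_ofComplex]
    ext i j
    fin_cases i <;> fin_cases j <;> simp [ofComplex, mul_comm]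
  have htr : N.trace = 0 := by rw [hNe]; simp [Matrix.trace_fin_three]
  have hcube : N * (N * N) = -ε • N := by
    rw [hNe]
    ext i j
    fin_cases i <;> fin_cases j <;> simp [Matrix.mul_apply, Fin.sum_univ_three]
    · linear_combination -(ε * Real.cos (y 1)) * hcs
    · linear_combination -(ε * Real.sin (y 1)) * hcs
    · linear_combination (ε * ε * Real.cos (y 1)) * hcs
    · linear_combination (ε * ε * Real.sin (y 1)) * hcs
  rw [coe_expSL (trace_smul_eq_zero htr _), exp_smul_of_cube hε hcube hσ hχ hσ0 hχ0, hNe]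
  ext i
  fin_cases i <;> simp [colL_apply, polar]
  linear_combination -(1 - χ (2 * y 0)) * hcs -
    (1 - χ (2 * y 0)) * (Real.sin (y 1) ^ 2 + Real.cos (y 1) ^ 2) * hε

end Gram

theorem exists_polar_angle (x y : ℝ) :
    ∃ v : ℝ, x = √(x ^ 2 + y ^ 2) * Real.cos v ∧ y = √(x ^ 2 + y ^ 2) * Real.sin v := by
  refine ⟨Complex.arg ⟨x, y⟩, ?_⟩
  have h : ‖(⟨x, y⟩ : ℂ)‖ = √(x ^ 2 + y ^ 2) := by
    rw [Complex.norm_def, Complex.normSq_apply]; ring_nf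
  rw [← h]
  exact ⟨(Complex.norm_mul_cos_arg ⟨x, y⟩).symm, (Complex.norm_mul_sin_arg ⟨x, y⟩).symm⟩

theorem exists_eq_polar {r : ℝ} {σ χ : ℝ → ℝ} {x y z s : ℝ} (hx : σ s = √(x ^ 2 + y ^ 2))
    (hz : χ s = z) : ∃ w : E 2, (!₂[r * x, r * y, r * z] : E 3) = polar r σ χ w := by
  obtain ⟨v, h1, h2⟩ := exists_polar_angle x y
  refine ⟨!₂[s / 2, v], ?_⟩
  ext i
  have hs : 2 * (s / 2) = s := by ring
  fin_cases i
  · simp [polar, hs, hx, ← h1]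
  · simp [polar, hs, hx, ← h2]
  · simp [polar, hs, hz]

theorem exists_polar_of_mem_cplane {X Z : Mat3} (hZ : Z ∈ cplane X) :
    ∃ ρ v : ℝ, Z = ρ • (Real.cos v • X + Real.sin v • J0 X) := by
  obtain ⟨a, b, rfl⟩ := Submodule.mem_span_pair.1 hZ
  obtain ⟨v, h1, h2⟩ := exists_polar_angle a b
  refine ⟨√(a ^ 2 + b ^ 2), v, ?_⟩
  rw [smul_add, smul_smul, smul_smul, ← h1, ← h2]

theorem polar_mem_cplane (X : Mat3) (ρ v : ℝ) :
    ρ • (Real.cos v • X + Real.sin v • J0 X) ∈ cplane X :=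
  (cplane X).smul_mem _ ((cplane X).add_mem
    ((cplane X).smul_mem _ (Submodule.subset_span (by simp)))
    ((cplane X).smul_mem _ (Submodule.subset_span (by simp))))

theorem contDiff_polarArg (A B : Mat3) (c : ℝ) :
    ContDiff ℝ ∞ (fun y : E 2 => (c * y 0) • (Real.cos (y 1) • A + Real.sin (y 1) • B)) := by
  have h0 : ContDiff ℝ ∞ (fun y : E 2 => y 0) := (EuclideanSpace.proj 0 : E 2 →L[ℝ] ℝ).contDiff
  have h1 : ContDiff ℝ ∞ (fun y : E 2 => y 1) := (EuclideanSpace.proj 1 : E 2 →L[ℝ] ℝ).contDiff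
  exact (contDiff_const.mul h0).smul (((Real.contDiff_cos.comp h1).smul contDiff_const).add
    ((Real.contDiff_sin.comp h1).smul contDiff_const))

/-- On the upper half space the equation of the pseudosphere determines the third coordinate from
the first two. -/
theorem pseudosphere_ext {ε : ℝ} {ν : ℕ} {r : ℝ}
    (hν : ∀ v w : E 3, semiEuclid ν v w = ε * (v 0 * w 0 + v 1 * w 1) + v 2 * w 2) :
    ∀ z ∈ pseudosphere 2 ν r, ∀ z' ∈ pseudosphere 2 ν r, 0 < z 2 → 0 < z' 2 →
      z 0 = z' 0 → z 1 = z' 1 → z = z' := by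
  intro z hz z' hz' h2 h2' h0 h1
  have e1 : semiEuclid ν z z = r ^ 2 := hz
  have e2 : semiEuclid ν z' z' = r ^ 2 := hz'
  rw [hν] at e1 e2
  rw [h0, h1] at e1
  have h3 : z 2 = z' 2 := by nlinarith
  ext i
  fin_cases i
  · exact h0
  · exact h1
  · exact h3

/-! ### The model surfaces of `SO(3)` and `SO⁺(2,1)`, treated together -/

section Column

variable {S : Type*} [TopologicalSpace S] [ChartedSpace (E 2) S] [IsManifold (𝓡 2) ∞ S]
  {f : S → NKSpace} {ε : ℝ} {K : Subgroup SL3} {σ χ : ℝ → ℝ}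

/-- The parametrization of the orbit of a group of isometries of `gram ε`. -/
noncomputable def columnParam (ε : ℝ) (y : E 2) : NKSpace :=
  cls (expSL ((2 * y 0) • (Real.cos (y 1) • ofComplex 0 1 (-ε : ℝ) +
    Real.sin (y 1) • J0 (ofComplex 0 1 (-ε : ℝ)))))

theorem columnParam_spec (hε : ε * ε = 1)
    (hK : ∀ Z ∈ cplane (ofComplex 0 1 (-ε : ℝ)), expSL Z ∈ K)
    (hσ : ∀ s, HasDerivAt σ (χ s) s) (hχ : ∀ s, HasDerivAt χ (-ε * σ s) s)
    (hσ0 : σ 0 = 0) (hχ0 : χ 0 = 1) (y : E 2) :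
    ∃ b ∈ K, columnParam ε y = cls b ∧ colMap ε (b : Mat3) = polar 1 σ χ y := by
  refine ⟨_, hK _ (polar_mem_cplane _ (2 * y 0) (y 1)), rfl, ?_⟩
  rw [colMap_of_norm_eq_one (colNorm_of_gram hε (gram_expSL hε (polar_mem_cplane _ _ _))),
    colL_expSL hε hσ hχ hσ0 hχ0]

theorem cls_eq_of_colMap_eq (hε : ε * ε = 1)
    (hKg : ∀ b ∈ K, (b : Mat3).transpose * gram ε * (b : Mat3) = gram ε) :
    ∀ b ∈ K, ∀ b' ∈ K, colMap ε (b : Mat3) = colMap ε (b' : Mat3) → cls b = cls b' := by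
  intro b hb b' hb' h
  rw [colMap_of_norm_eq_one (colNorm_of_gram hε (hKg b hb)),
    colMap_of_norm_eq_one (colNorm_of_gram hε (hKg b' hb'))] at h
  exact cls_eq_of_colL_eq hε (hKg b hb) (hKg b' hb') h

/-- For `ε = 1` the pair `σ, χ` is sine and cosine and the induced metric is the round one; for `ε =
-1` it is `sinh` and `cosh` and the induced metric is negative definite. -/
theorem conclusion_of_column (hf : IsSmoothImmersion (m := 2) (n := 6) f)
    (hall : ∀ p, ∃ a, IsAdapted f p a (cplane (ofComplex 0 1 (-ε : ℝ)))) (hε : ε * ε = 1)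
    (hKg : ∀ b ∈ K, (b : Mat3).transpose * gram ε * (b : Mat3) = gram ε)
    (hK : ∀ Z ∈ cplane (ofComplex 0 1 (-ε : ℝ)), expSL Z ∈ K)
    (hσ : ∀ s, HasDerivAt σ (χ s) s) (hχ : ∀ s, HasDerivAt χ (-ε * σ s) s)
    (hσ0 : σ 0 = 0) (hχ0 : χ 0 = 1) (hσs : ContDiff ℝ ∞ σ) {u : ℝ} (hσu : σ (2 * u) ≠ 0)
    (hχu : 0 < χ (2 * u)) {ν : ℕ}
    (hν : ∀ v w : E 3, semiEuclid ν v w = ε * (v 0 * w 0 + v 1 * w 1) + v 2 * w 2) :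
    IsLocallyIsometricTo (m := 2) (pullback g f) ν (pseudosphere 2 ν 1) ∧
      IsLocallyCongruent g f (columnParam ε) := by
  have hF : ContMDiff (𝓡 2) (𝓡 6) ∞ (columnParam ε) :=
    contMDiff_cls_expSL (contDiff_polarArg _ _ 2) fun y =>
      trace_of_projM (projM_of_mem_cplane (projM_ofComplex _ _ _) (polar_mem_cplane _ _ _))
  refine conclusion_of_polar hf hall hF hK one_pos hσs
    (continuous_iff_continuousAt.2 fun s => (hχ s).continuousAt) (hσ _) hσu hχu
    (pseudosphere_ext hν) (isInvariantMap_colMap ε) ?_ ?_ (cls_eq_of_colMap_eq hε hKg)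
    (columnParam_spec hε hK hσ hχ hσ0 hχ0)
    (fun b hb Z hZ => hasDerivAt_colMap hε (hKg b hb) hZ) ?_
  · intro b hb
    change 0 < colNorm ε _
    rw [colNorm_of_gram hε (hKg b hb)]
    exact one_pos
  · intro b hb
    have h1 := colNorm_of_gram hε (hKg b hb)
    change semiEuclid ν _ _ = _
    rw [hν, colMap_of_norm_eq_one h1, one_pow]
    refine Eq.trans ?_ h1
    rw [colNorm]
    simp only [colL_apply]
    simp
    ring
  · intro b hb Z hZ Z' hZ'
    rw [hν]
    exact colL_isometric hε (hKg b hb) hZ hZ'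

end Column

theorem ofComplex_one_neg_one : (1 / √2) • (e3 + e5) = ofComplex 0 1 (-1 : ℝ) := by
  rw [X2_eq]; simp

theorem ofComplex_one_one : (1 / √2) • (e3 - e5) = ofComplex 0 1 (-(-1) : ℝ) := by
  rw [X3_eq]; simp

theorem f2_eq : f2 = columnParam 1 := by
  have h : (1 / √2) • (e4 + e6) = J0 (ofComplex 0 1 (-1 : ℝ)) := by
    rw [J0_ofComplex]
    ext i j; fin_cases i <;> fin_cases j <;> simp [ofComplex, e4, e6]
  funext y
  rw [f2, ofComplex_one_neg_one, h]; rfl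

theorem f3_eq : f3 = columnParam (-1) := by
  have h : (1 / √2) • (e4 - e6) = J0 (ofComplex 0 1 (-(-1) : ℝ)) := by
    rw [J0_ofComplex]
    ext i j; fin_cases i <;> fin_cases j <;> simp [ofComplex, e4, e6]
  funext y
  rw [f3, ofComplex_one_one, h]; rfl

theorem K2_gram : ∀ b ∈ K2, (b : Mat3).transpose * gram 1 * (b : Mat3) = gram 1 := by
  intro b hb
  rw [gram_one, mul_one]
  exact hb

theorem expSL_mem_K2 : ∀ Z ∈ cplane (ofComplex 0 1 (-1 : ℝ)), expSL Z ∈ K2 := by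
  intro Z hZ
  have h := gram_expSL (ε := 1) (by norm_num) hZ
  rw [gram_one, mul_one] at h
  exact h

theorem K3_gram : ∀ b ∈ K3, (b : Mat3).transpose * gram (-1) * (b : Mat3) = gram (-1) :=
  fun _ hb => hb.1

theorem hasDerivAt_cos' (s : ℝ) : HasDerivAt Real.cos (-1 * Real.sin s) s := by
  rw [neg_one_mul]; exact Real.hasDerivAt_cos s

theorem hasDerivAt_cosh' (s : ℝ) : HasDerivAt Real.cosh (-(-1) * Real.sinh s) s := by
  rw [neg_neg, one_mul]; exact Real.hasDerivAt_cosh s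

theorem expSL_mem_K3 : ∀ Z ∈ cplane (ofComplex 0 1 (-(-1) : ℝ)), expSL Z ∈ K3 := by
  intro Z hZ
  refine ⟨gram_expSL (ε := -1) (by norm_num) hZ, ?_⟩
  obtain ⟨ρ, v, rfl⟩ := exists_polar_of_mem_cplane hZ
  -- The lower right entry of the exponential is `cosh ρ`. The coordinate is `ρ / 2` because `polar`
  -- doubles it.
  have h := colL_expSL (ε := -1) (by norm_num) Real.hasDerivAt_sinh hasDerivAt_cosh'
    Real.sinh_zero Real.cosh_zero !₂[ρ / 2, v]
  have h2 := congrArg (fun z : E 3 => z 2) h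
  simp only [colL_apply, polar] at h2
  simp at h2
  have h3 : 2 * (ρ / 2) = ρ := by ring
  rw [h3] at h2
  have h4 := Real.cosh_pos ρ
  rw [← h2] at h4
  simpa using h4

theorem semiEuclid_zero (v w : E 3) :
    semiEuclid 0 v w = 1 * (v 0 * w 0 + v 1 * w 1) + v 2 * w 2 := by
  simp [semiEuclid, Fin.sum_univ_three]

theorem semiEuclid_two (v w : E 3) :
    semiEuclid 2 v w = -1 * (v 0 * w 0 + v 1 * w 1) + v 2 * w 2 := by
  simp [semiEuclid, Fin.sum_univ_three]
  ring

theorem range_f2 : Set.range f2 = orbit K2 := by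
  rw [f2_eq]
  refine range_eq_orbit_of_polar (cls_eq_of_colMap_eq (by norm_num) K2_gram)
    (columnParam_spec (by norm_num) expSL_mem_K2 Real.hasDerivAt_sin hasDerivAt_cos'
      Real.sin_zero Real.cos_zero) ?_
  intro b hb
  have h := colNorm_of_gram (by norm_num) (K2_gram b hb)
  rw [colMap_of_norm_eq_one h, colL_apply]
  rw [colNorm] at h
  have h1 : Real.sin (Real.arccos ((b : Mat3) 2 2)) =
      √((b : Mat3) 0 2 ^ 2 + (b : Mat3) 1 2 ^ 2) := by
    rw [Real.sin_arccos]
    congr 1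
    linarith
  have h2 : Real.cos (Real.arccos ((b : Mat3) 2 2)) = (b : Mat3) 2 2 :=
    Real.cos_arccos (by nlinarith [sq_nonneg ((b : Mat3) 0 2), sq_nonneg ((b : Mat3) 1 2)])
      (by nlinarith [sq_nonneg ((b : Mat3) 0 2), sq_nonneg ((b : Mat3) 1 2)])
  obtain ⟨w, hw⟩ := exists_eq_polar (r := 1) h1 h2
  exact ⟨w, by rw [← hw]; simp⟩

theorem exists_hyperbolic {x y z : ℝ} (h : z ^ 2 = 1 + (x ^ 2 + y ^ 2)) (hz : 0 < z) :
    ∃ s, Real.sinh s = √(x ^ 2 + y ^ 2) ∧ Real.cosh s = z := by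
  refine ⟨Real.arsinh √(x ^ 2 + y ^ 2), Real.sinh_arsinh _, ?_⟩
  rw [Real.cosh_arsinh, Real.sq_sqrt (by positivity), ← h, Real.sqrt_sq hz.le]

theorem range_f3 : Set.range f3 = orbit K3 := by
  rw [f3_eq]
  refine range_eq_orbit_of_polar (cls_eq_of_colMap_eq (by norm_num) K3_gram)
    (columnParam_spec (by norm_num) expSL_mem_K3 Real.hasDerivAt_sinh hasDerivAt_cosh'
      Real.sinh_zero Real.cosh_zero) ?_
  intro b hb
  have h := colNorm_of_gram (by norm_num) (K3_gram b hb)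
  rw [colMap_of_norm_eq_one h, colL_apply]
  rw [colNorm] at h
  obtain ⟨s, h1, h2⟩ := exists_hyperbolic (x := (b : Mat3) 0 2) (y := (b : Mat3) 1 2)
    (z := (b : Mat3) 2 2) (by linarith) hb.2
  obtain ⟨w, hw⟩ := exists_eq_polar (r := 1) h1 h2
  exact ⟨w, by rw [← hw]; simp⟩

section Conclusions

variable {S : Type*} [TopologicalSpace S] [ChartedSpace (E 2) S] [IsManifold (𝓡 2) ∞ S]
  {f : S → NKSpace}

theorem conclusion_f2 (hf : IsSmoothImmersion (m := 2) (n := 6) f)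
    (hall : ∀ p, ∃ a, IsAdapted f p a (cplane ((1 / √2) • (e3 + e5)))) :
    IsLocallyIsometricTo (m := 2) (pullback g f) 0 (pseudosphere 2 0 1) ∧
      IsLocallyCongruent g f f2 := by
  rw [f2_eq]
  rw [ofComplex_one_neg_one] at hall
  -- The base point must avoid the pole and the equator; at the angle `π/4` sine and cosine are both
  -- positive.
  have h4 : 2 * (Real.pi / 8) = Real.pi / 4 := by ring
  refine conclusion_of_column hf hall (by norm_num) K2_gram expSL_mem_K2 Real.hasDerivAt_sin
    hasDerivAt_cos' Real.sin_zero Real.cos_zero Real.contDiff_sin (u := Real.pi / 8) ?_ ?_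
    semiEuclid_zero
  · rw [h4, Real.sin_pi_div_four]; positivity
  · rw [h4, Real.cos_pi_div_four]; positivity

theorem conclusion_f3 (hf : IsSmoothImmersion (m := 2) (n := 6) f)
    (hall : ∀ p, ∃ a, IsAdapted f p a (cplane ((1 / √2) • (e3 - e5)))) :
    IsLocallyIsometricTo (m := 2) (pullback g f) 2 (pseudosphere 2 2 1) ∧
      IsLocallyCongruent g f f3 := by
  rw [f3_eq]
  rw [ofComplex_one_one] at hall
  refine conclusion_of_column hf hall (by norm_num) K3_gram expSL_mem_K3 Real.hasDerivAt_sinh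
    hasDerivAt_cosh' Real.sinh_zero Real.cosh_zero Real.contDiff_sinh (u := 1) ?_
    (Real.cosh_pos _) semiEuclid_two
  exact (Real.sinh_pos_iff.2 (by norm_num)).ne'

end Conclusions

/-! ### The orbit of `SL(2,ℝ)` -/

theorem mem_K1_iff (b : SL3) : b ∈ K1 ↔ (b : Mat3) 0 2 = 0 ∧ (b : Mat3) 1 2 = 0 ∧
    (b : Mat3) 2 0 = 0 ∧ (b : Mat3) 2 1 = 0 ∧ (b : Mat3) 2 2 = 1 := by
  constructor
  · rintro ⟨c, rfl⟩
    exact ⟨rfl, rfl, rfl, rfl, rfl⟩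
  · rintro ⟨h1, h2, h3, h4, h5⟩
    have hdet := b.det_coe
    rw [Matrix.det_fin_three, h1, h2, h3, h4, h5] at hdet
    refine ⟨⟨!![(b : Mat3) 0 0, (b : Mat3) 0 1; (b : Mat3) 1 0, (b : Mat3) 1 1], ?_⟩, ?_⟩
    · rw [Matrix.det_fin_two]
      simp
      linarith
    · refine Subtype.ext ?_
      change !![(b : Mat3) 0 0, (b : Mat3) 0 1, 0; (b : Mat3) 1 0, (b : Mat3) 1 1, 0; 0, 0, 1] =
        (b : Mat3)
      conv_rhs => rw [Matrix.eta_fin_three (b : Mat3), h1, h2, h3, h4, h5]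

theorem det_of_mem_K1 {b : SL3} (hb : b ∈ K1) :
    (b : Mat3) 0 0 * (b : Mat3) 1 1 - (b : Mat3) 0 1 * (b : Mat3) 1 0 = 1 := by
  obtain ⟨h1, h2, h3, h4, h5⟩ := (mem_K1_iff b).1 hb
  have hdet := b.det_coe
  rw [Matrix.det_fin_three, h1, h2, h3, h4, h5] at hdet
  linarith

/-- The determinant of the upper left block. -/
def blockDet (A : Mat3) : ℝ := A 0 0 * A 1 1 - A 0 1 * A 1 0

/-- The coordinates of the symmetric matrix `B Bᵀ`, for the upper left block `B`. -/
noncomputable def symCoord (A : Mat3) : E 3 :=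
  !₂[(A 0 0 ^ 2 + A 0 1 ^ 2 - (A 1 0 ^ 2 + A 1 1 ^ 2)) / 2, A 0 0 * A 1 0 + A 0 1 * A 1 1,
    (A 0 0 ^ 2 + A 0 1 ^ 2 + (A 1 0 ^ 2 + A 1 1 ^ 2)) / 2]

/-- The normalized coordinates of `B Bᵀ`. -/
noncomputable def symMap (A : Mat3) : E 3 := ((2 * blockDet A)⁻¹) • symCoord A

theorem symMap_of_blockDet_eq_one {A : Mat3} (h : blockDet A = 1) :
    symMap A = (1 / 2 : ℝ) • symCoord A := by
  rw [symMap, h]; norm_num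

theorem contDiff_blockDet : ContDiff ℝ ∞ blockDet := by
  have h : ∀ i j, ContDiff ℝ ∞ (fun A : Mat3 => A i j) := fun i j => (entryL i j).contDiff
  exact ((h 0 0).mul (h 1 1)).sub ((h 0 1).mul (h 1 0))

theorem contDiff_symCoord : ContDiff ℝ ∞ symCoord := by
  have h : ∀ i j, ContDiff ℝ ∞ (fun A : Mat3 => A i j) := fun i j => (entryL i j).contDiff
  have h0 := ((h 0 0).pow 2).add ((h 0 1).pow 2)
  have h1 := ((h 1 0).pow 2).add ((h 1 1).pow 2)
  rw [contDiff_euclidean]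
  intro i
  fin_cases i
  · exact (h0.sub h1).div_const 2
  · exact ((h 0 0).mul (h 1 0)).add ((h 0 1).mul (h 1 1))
  · exact (h0.add h1).div_const 2

/-- The upper block of an element of `H` is a similarity, so it multiplies both `B Bᵀ` and the
determinant of `B` by `α² + β²`; the quotient is invariant. -/
theorem isInvariantMap_symMap : IsInvariantMap {a : SL3 | 0 < blockDet (a : Mat3)} symMap := by
  have key : ∀ (a : SL3), ∀ h ∈ H, ∃ δ : ℝ, 0 < δ ∧
      blockDet ((a * h : SL3) : Mat3) = δ * blockDet (a : Mat3) ∧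
      symCoord ((a * h : SL3) : Mat3) = δ • symCoord (a : Mat3) := by
    intro a h hh
    obtain ⟨α, β, γ, hd, hm⟩ := exists_of_mem_H hh
    refine ⟨α ^ 2 + β ^ 2, ?_, ?_, ?_⟩
    · rcases (add_nonneg (sq_nonneg α) (sq_nonneg β)).lt_or_eq with h | h
      · exact h
      · rw [← h] at hd; simp at hd
    · rw [Matrix.SpecialLinearGroup.coe_mul, hm]
      simp [blockDet, Matrix.mul_apply, Fin.sum_univ_three]
      ring
    · rw [Matrix.SpecialLinearGroup.coe_mul, hm]
      ext i
      fin_cases i <;> simp [symCoord, Matrix.mul_apply, Fin.sum_univ_three] <;> ring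
  refine ⟨?_, ?_, ?_, ?_⟩
  · have hc : Continuous fun a : SL3 => blockDet (a : Mat3) := by
      have h := continuous_entry
      exact ((h 0 0).mul (h 1 1)).sub ((h 0 1).mul (h 1 0))
    exact isOpen_lt continuous_const hc
  · intro a ha
    have h1 : 2 * blockDet (a : Mat3) ≠ 0 := mul_ne_zero two_ne_zero (ne_of_gt ha)
    exact ((contDiffAt_const.mul contDiff_blockDet.contDiffAt).inv h1).smul
      contDiff_symCoord.contDiffAt
  · intro a ha h hh
    obtain ⟨δ, hδ, h1, -⟩ := key a h hh
    change 0 < blockDet _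
    rw [h1]
    exact mul_pos hδ ha
  · intro a ha h hh
    obtain ⟨δ, hδ, h1, h2⟩ := key a h hh
    have ha' : blockDet (a : Mat3) ≠ 0 := ne_of_gt ha
    rw [symMap, symMap, h1, h2, smul_smul]
    congr 1
    field_simp

/-- Equal values mean `b bᵀ = b' b'ᵀ`, so `b⁻¹ b'` is orthogonal; it also fixes the third basis
vector, hence lies in `H`. -/
theorem cls_eq_of_symMap_eq : ∀ b ∈ K1, ∀ b' ∈ K1, symMap (b : Mat3) = symMap (b' : Mat3) →
    cls b = cls b' := by
  intro b hb b' hb' h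
  rw [symMap_of_blockDet_eq_one (det_of_mem_K1 hb), symMap_of_blockDet_eq_one (det_of_mem_K1 hb')]
    at h
  have h' : symCoord (b : Mat3) = symCoord (b' : Mat3) :=
    smul_right_injective _ (by norm_num : (1 / 2 : ℝ) ≠ 0) h
  have c0 := congrArg (fun z : E 3 => z 0) h'
  have c1 := congrArg (fun z : E 3 => z 1) h'
  have c2 := congrArg (fun z : E 3 => z 2) h'
  simp [symCoord] at c0 c1 c2
  have hsym : (b : Mat3) * (b : Mat3).transpose = (b' : Mat3) * (b' : Mat3).transpose := by
    obtain ⟨h1, h2, h3, h4, h5⟩ := (mem_K1_iff b).1 hb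
    obtain ⟨k1, k2, k3, k4, k5⟩ := (mem_K1_iff b').1 hb'
    generalize (b : Mat3) = B at *
    generalize (b' : Mat3) = B' at *
    ext i j
    fin_cases i <;> fin_cases j <;>
      simp [Matrix.mul_apply, Fin.sum_univ_three, h1, h2, h3, h4, h5, k1, k2, k3, k4, k5] <;>
      linarith
  refine QuotientGroup.eq.2 ?_
  have hc := K1.mul_mem (K1.inv_mem hb) hb'
  obtain ⟨h1, h2, -, -, h5⟩ := (mem_K1_iff _).1 hc
  refine mem_H_of_gram (ε := 1) (by norm_num) ?_ h1 h2 h5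
  rw [gram_one, mul_one]
  refine mul_eq_one_comm.1 ?_
  rw [Matrix.SpecialLinearGroup.coe_mul, Matrix.transpose_mul]
  calc _ = ((b⁻¹ : SL3) : Mat3) * ((b' : Mat3) * (b' : Mat3).transpose) *
        ((b⁻¹ : SL3) : Mat3).transpose := by simp only [mul_assoc]
    _ = (((b⁻¹ : SL3) : Mat3) * (b : Mat3)) * (((b⁻¹ : SL3) : Mat3) * (b : Mat3)).transpose := by
        rw [← hsym, Matrix.transpose_mul]; simp only [mul_assoc]
    _ = 1 := by rw [coe_inv_mul, Matrix.transpose_one, mul_one]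

theorem J0_e1 : J0 e1 = -e2 := by
  rw [J0_eq]
  ext i j; fin_cases i <;> fin_cases j <;> simp [e1, e2]

/-- The exponential of a unit vector of `span {e₁, e₂}`. -/
theorem exp_block (v s : ℝ) : NormedSpace.exp (s • (Real.cos v • e1 + Real.sin v • e2)) =
    !![Real.cosh s + Real.sinh s * Real.cos v, Real.sinh s * Real.sin v, 0;
      Real.sinh s * Real.sin v, Real.cosh s - Real.sinh s * Real.cos v, 0; 0, 0, 1] := by
  have hcs := Real.sin_sq_add_cos_sq v
  have hNe : Real.cos v • e1 + Real.sin v • e2 =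
      !![Real.cos v, Real.sin v, 0; Real.sin v, -Real.cos v, 0; 0, 0, 0] := by
    ext i j
    fin_cases i <;> fin_cases j <;> simp [e1, e2]
  have hsq : (Real.cos v • e1 + Real.sin v • e2) * (Real.cos v • e1 + Real.sin v • e2) =
      !![1, 0, 0; 0, 1, 0; 0, 0, 0] := by
    rw [hNe]
    ext i j
    fin_cases i <;> fin_cases j <;> simp [Matrix.mul_apply, Fin.sum_univ_three] <;>
      first | ring1 | linear_combination hcs
  have hcube : (Real.cos v • e1 + Real.sin v • e2) * ((Real.cos v • e1 + Real.sin v • e2) *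
      (Real.cos v • e1 + Real.sin v • e2)) = -(-1 : ℝ) • (Real.cos v • e1 + Real.sin v • e2) := by
    rw [hsq, hNe]
    ext i j
    fin_cases i <;> fin_cases j <;> simp [Matrix.mul_apply, Fin.sum_univ_three]
  rw [exp_smul_of_cube (ε := -1) (by norm_num) hcube Real.hasDerivAt_sinh hasDerivAt_cosh'
    Real.sinh_zero Real.cosh_zero, hsq, hNe]
  ext i j
  fin_cases i <;> fin_cases j <;> simp <;> ring

theorem mem_cplane_e1_iff {Z : Mat3} :
    Z ∈ cplane e1 ↔ ∃ ρ v : ℝ, Z = ρ • (Real.cos v • e1 + Real.sin v • e2) := by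
  constructor
  · intro hZ
    obtain ⟨ρ, v, rfl⟩ := exists_polar_of_mem_cplane hZ
    -- The angle changes sign because `J e₁ = -e₂`.
    exact ⟨ρ, -v, by rw [J0_e1, Real.cos_neg, Real.sin_neg, neg_smul, smul_neg]⟩
  · rintro ⟨ρ, v, rfl⟩
    have := polar_mem_cplane e1 ρ (-v)
    rwa [J0_e1, Real.cos_neg, Real.sin_neg, neg_smul, smul_neg, neg_neg] at this

theorem trace_block (s v : ℝ) : (s • (Real.cos v • e1 + Real.sin v • e2)).trace = 0 := by
  simp [e1, e2, Matrix.trace_fin_three]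

theorem expSL_mem_K1 : ∀ Z ∈ cplane e1, expSL Z ∈ K1 := by
  intro Z hZ
  obtain ⟨ρ, v, rfl⟩ := mem_cplane_e1_iff.1 hZ
  rw [mem_K1_iff, coe_expSL (trace_block ρ v), exp_block]
  simp

/-- The matrix `exp (s N)` is symmetric, so `B Bᵀ` is the block of `exp (2 s N)`; this is why
`polar` doubles its argument. The radius `1/2` comes from the normalization in `symMap`. -/
theorem f1_spec (y : E 2) : ∃ b ∈ K1, f1 y = cls b ∧
    symMap (b : Mat3) = polar (1 / 2) Real.sinh Real.cosh y := by
  have hb := expSL_mem_K1 _ (mem_cplane_e1_iff.2 ⟨y 0, y 1, rfl⟩)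
  refine ⟨_, hb, rfl, ?_⟩
  rw [symMap_of_blockDet_eq_one (det_of_mem_K1 hb), coe_expSL (trace_block _ _), exp_block]
  have hcs := Real.sin_sq_add_cos_sq (y 1)
  ext i
  fin_cases i <;> simp [symCoord, polar, Real.sinh_two_mul, Real.cosh_two_mul]
  · ring
  · ring
  · linear_combination Real.sinh (y 0) ^ 2 * hcs

/-- This is `det (B Bᵀ) = 1`, expressed through half the trace and the trace-free part of `B Bᵀ`. -/
theorem norm_symCoord {A : Mat3} (h : blockDet A = 1) :
    (symCoord A) 2 ^ 2 = 1 + ((symCoord A) 0 ^ 2 + (symCoord A) 1 ^ 2) := by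
  simp only [symCoord, blockDet] at *
  simp
  linear_combination (A 0 0 * A 1 1 - A 0 1 * A 1 0 + 1) * h

theorem range_f1 : Set.range f1 = orbit K1 := by
  refine range_eq_orbit_of_polar cls_eq_of_symMap_eq f1_spec ?_
  intro b hb
  have hd := det_of_mem_K1 hb
  have hz : 0 < (symCoord (b : Mat3)) 2 := by
    simp only [symCoord]
    simp
    -- The coordinate is half a sum of squares of entries; if it were not positive the first row
    -- would vanish, contradicting determinant one.
    by_contra hc
    have e0 : (b : Mat3) 0 0 = 0 := by
      nlinarith [sq_nonneg ((b : Mat3) 0 0), sq_nonneg ((b : Mat3) 0 1),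
        sq_nonneg ((b : Mat3) 1 0), sq_nonneg ((b : Mat3) 1 1)]
    have e1 : (b : Mat3) 0 1 = 0 := by
      nlinarith [sq_nonneg ((b : Mat3) 0 0), sq_nonneg ((b : Mat3) 0 1),
        sq_nonneg ((b : Mat3) 1 0), sq_nonneg ((b : Mat3) 1 1)]
    rw [e0, e1] at hd
    simp at hd
  obtain ⟨s, h1, h2⟩ := exists_hyperbolic (norm_symCoord hd) hz
  obtain ⟨w, hw⟩ := exists_eq_polar (r := 1 / 2) h1 h2
  refine ⟨w, ?_⟩
  rw [← hw, symMap_of_blockDet_eq_one hd]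
  ext i
  fin_cases i <;> simp

/-- The differential of `symCoord`, on matrices of determinant one. -/
noncomputable def symDeriv (A M : Mat3) : E 3 :=
  (1 / 2 : ℝ) • !₂[A 0 0 * M 0 0 + A 0 1 * M 0 1 - (A 1 0 * M 1 0 + A 1 1 * M 1 1),
    M 0 0 * A 1 0 + A 0 0 * M 1 0 + (M 0 1 * A 1 1 + A 0 1 * M 1 1),
    A 0 0 * M 0 0 + A 0 1 * M 0 1 + (A 1 0 * M 1 0 + A 1 1 * M 1 1)]

theorem hasDerivAt_euclidean_of {k : ℕ} {c : ℝ → E k} {c' : E k} {t : ℝ}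
    (h : ∀ i, HasDerivAt (fun s => c s i) (c' i) t) : HasDerivAt c c' t :=
  ((PiLp.continuousLinearEquiv 2 ℝ fun _ : Fin k => ℝ).symm.hasFDerivAt.comp_hasDerivAt t
    (hasDerivAt_pi.2 h) :)

theorem hasDerivAt_symMap {b : SL3} (hb : b ∈ K1) {Z : Mat3} (hZ : Z ∈ cplane e1) :
    HasDerivAt (fun t : ℝ => symMap ((b * expSL (t • Z) : SL3) : Mat3))
      (symDeriv (b : Mat3) ((b : Mat3) * Z)) 0 := by
  have htr : Z.trace = 0 := by
    obtain ⟨ρ, v, rfl⟩ := mem_cplane_e1_iff.1 hZ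
    exact trace_block ρ v
  have hfun : (fun t : ℝ => symMap ((b * expSL (t • Z) : SL3) : Mat3)) =
      fun t : ℝ => (1 / 2 : ℝ) • symCoord ((b * expSL (t • Z) : SL3) : Mat3) := by
    funext t
    exact symMap_of_blockDet_eq_one
      (det_of_mem_K1 (K1.mul_mem hb (expSL_mem_K1 _ (mem_cplane_smul hZ t))))
  rw [hfun]
  have hB := hasDerivAt_mul_expSL b htr 0
  have hB0 : ((b * expSL ((0 : ℝ) • Z) : SL3) : Mat3) = (b : Mat3) := by
    rw [zero_smul, expSL_zero, mul_one]
  rw [hB0] at hB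
  have h : ∀ i j, HasDerivAt (fun t : ℝ => ((b * expSL (t • Z) : SL3) : Mat3) i j)
      (((b : Mat3) * Z) i j) 0 := fun i j => (entryL i j).hasFDerivAt.comp_hasDerivAt (0 : ℝ) hB
  have h0 := ((h 0 0).pow 2).add ((h 0 1).pow 2)
  have h1 := ((h 1 0).pow 2).add ((h 1 1).pow 2)
  have hsym : HasDerivAt (fun t : ℝ => symCoord ((b * expSL (t • Z) : SL3) : Mat3))
      ((2 : ℝ) • symDeriv (b : Mat3) ((b : Mat3) * Z)) 0 := by
    refine hasDerivAt_euclidean_of ?_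
    intro i
    fin_cases i
    · refine ((h0.sub h1).div_const 2).congr_deriv ?_
      rw [hB0]
      simp [symDeriv]
      ring
    · refine (((h 0 0).mul (h 1 0)).add ((h 0 1).mul (h 1 1))).congr_deriv ?_
      rw [hB0]
      simp [symDeriv]
    · refine ((h0.add h1).div_const 2).congr_deriv ?_
      rw [hB0]
      simp [symDeriv]
      ring
  refine (hsym.const_smul (1 / 2 : ℝ)).congr_deriv ?_
  rw [smul_smul]; norm_num

section Conclusion

variable {S : Type*} [TopologicalSpace S] [ChartedSpace (E 2) S] [IsManifold (𝓡 2) ∞ S]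
  {f : S → NKSpace}

theorem conclusion_f1 (hf : IsSmoothImmersion (m := 2) (n := 6) f)
    (hall : ∀ p, ∃ a, IsAdapted f p a (cplane e1)) :
    IsLocallyIsometricTo (m := 2) (pullback g f) 2 (pseudosphere 2 2 (1 / 2)) ∧
      IsLocallyCongruent g f f1 := by
  have hF : ContMDiff (𝓡 2) (𝓡 6) ∞ f1 := by
    have := contMDiff_cls_expSL (contDiff_polarArg e1 e2 1) fun y => trace_block _ _
    simp only [one_mul] at this
    exact this
  refine conclusion_of_polar hf hall hF expSL_mem_K1 (by norm_num) Real.contDiff_sinh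
    Real.continuous_cosh (u := 1) (Real.hasDerivAt_sinh _)
    (Real.sinh_pos_iff.2 (by norm_num)).ne' (Real.cosh_pos _) (pseudosphere_ext semiEuclid_two)
    isInvariantMap_symMap ?_ ?_ cls_eq_of_symMap_eq f1_spec
    (fun b hb Z hZ => hasDerivAt_symMap hb hZ) ?_
  · intro b hb
    change 0 < blockDet _
    rw [blockDet, det_of_mem_K1 hb]
    exact one_pos
  · intro b hb
    have h1 : blockDet (b : Mat3) = 1 := det_of_mem_K1 hb
    change semiEuclid 2 _ _ = _
    rw [semiEuclid_two, symMap_of_blockDet_eq_one h1]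
    have := norm_symCoord h1
    simp
    linear_combination (1 / 4 : ℝ) * this
  · intro b hb Z hZ Z' hZ'
    obtain ⟨c, d, rfl⟩ := Submodule.mem_span_pair.1 hZ
    obtain ⟨c', d', rfl⟩ := Submodule.mem_span_pair.1 hZ'
    have hd := det_of_mem_K1 hb
    rw [semiEuclid_two, J0_e1]
    generalize (b : Mat3) = B at *
    simp [symDeriv, Matrix.mul_apply, Fin.sum_univ_three, Matrix.trace_fin_three, e1, e2]
    -- The left side is the right side times the square of the determinant, and `(det + 1) * hd`
    -- says that this square is `1`.
    linear_combination (-(c * c' + d * d')) * (B 0 0 * B 1 1 - B 0 1 * B 1 0 + 1) * hd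

end Conclusion

/-! ### The orbits of abelian groups -/

section Abelian

variable {X Y : Mat3}

/-- The homomorphism `(u, v) ↦ exp (u X + v Y)`. -/
noncomputable def expHom (hX : X.trace = 0) (hY : Y.trace = 0) (h : Commute X Y) :
    Multiplicative (ℝ × ℝ) →* SL3 where
  toFun m := expSL (m.toAdd.1 • X + m.toAdd.2 • Y)
  map_one' := by
    change expSL ((0 : ℝ) • X + (0 : ℝ) • Y) = 1
    rw [zero_smul, zero_smul, add_zero, expSL_zero]
  map_mul' m m' := by
    change expSL ((m.toAdd.1 + m'.toAdd.1) • X + (m.toAdd.2 + m'.toAdd.2) • Y) = _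
    rw [← expSL_add]
    · congr 1; module
    · simp [hX, hY]
    · simp [hX, hY]
    · exact (((Commute.refl X).smul_left _).smul_right _ |>.add_right
        ((h.smul_left _).smul_right _)).add_left
        ((h.symm.smul_left _).smul_right _ |>.add_right
          (((Commute.refl Y).smul_left _).smul_right _))

/-- For commuting `X` and `Y` the generators already form a subgroup, so taking the closure adds
nothing. -/
theorem expSpan_eq_range (hX : X.trace = 0) (hY : Y.trace = 0) (h : Commute X Y) :
    expSpan X Y = (expHom hX hY h).range := by
  rw [expSpan, ← Subgroup.closure_eq (expHom hX hY h).range]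
  congr 1
  ext a
  have key : ∀ u v : ℝ, (expSL (u • X + v • Y) : Mat3) = NormedSpace.exp (u • X + v • Y) :=
    fun u v => coe_expSL (by simp [hX, hY])
  constructor
  · rintro ⟨u, v, hu⟩
    exact ⟨Multiplicative.ofAdd (u, v), Subtype.ext ((key u v).trans hu.symm)⟩
  · rintro ⟨m, rfl⟩
    exact ⟨m.toAdd.1, m.toAdd.2, key _ _⟩

theorem mem_expSpan_iff (hX : X.trace = 0) (hY : Y.trace = 0) (h : Commute X Y) {b : SL3} :
    b ∈ expSpan X Y ↔ ∃ u v : ℝ, b = expSL (u • X + v • Y) := by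
  rw [expSpan_eq_range hX hY h]
  constructor
  · rintro ⟨m, rfl⟩
    exact ⟨m.toAdd.1, m.toAdd.2, rfl⟩
  · rintro ⟨u, v, rfl⟩
    exact ⟨Multiplicative.ofAdd (u, v), rfl⟩

theorem range_eq_orbit_expSpan (hX : X.trace = 0) (hY : Y.trace = 0) (h : Commute X Y) :
    Set.range (fun y : E 2 => cls (expSL (y 0 • X + y 1 • Y))) = orbit (expSpan X Y) := by
  ext q
  constructor
  · rintro ⟨y, rfl⟩
    exact ⟨_, (mem_expSpan_iff hX hY h).2 ⟨y 0, y 1, rfl⟩, rfl⟩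
  · rintro ⟨b, hb, rfl⟩
    obtain ⟨u, v, rfl⟩ := (mem_expSpan_iff hX hY h).1 hb
    exact ⟨!₂[u, v], rfl⟩

/-- The group `expSpan X Y` is isomorphic to `ℝ²`, if there are coordinates on it. -/
theorem nonempty_continuousMulEquiv (hX : X.trace = 0) (hY : Y.trace = 0) (h : Commute X Y)
    {Ω : Set SL3} {ψ : Mat3 → E 2} (hψ : IsInvariantMap Ω ψ)
    (hΩ : ∀ u v : ℝ, expSL (u • X + v • Y) ∈ Ω)
    (hval : ∀ u v : ℝ, ψ (expSL (u • X + v • Y) : Mat3) = !₂[u, v]) :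
    Nonempty (Multiplicative (ℝ × ℝ) ≃ₜ* expSpan X Y) := by
  have hc1 : Continuous (fun m : Multiplicative (ℝ × ℝ) =>
      expSL (m.toAdd.1 • X + m.toAdd.2 • Y)) := by
    have h1 : ContDiff ℝ ∞ (fun z : ℝ × ℝ => (expSL (z.1 • X + z.2 • Y) : Mat3)) :=
      contDiff_expSL_comp (L := fun z : ℝ × ℝ => z.1 • X + z.2 • Y)
        ((contDiff_fst.smul contDiff_const).add (contDiff_snd.smul contDiff_const))
        (fun z => by simp [hX, hY])
    have h2 : Continuous (fun z : ℝ × ℝ => expSL (z.1 • X + z.2 • Y)) :=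
      continuous_iff_continuousAt.2 fun z => continuousAt_SL.2 h1.continuous.continuousAt
    exact h2.comp continuous_toAdd
  have hc2 : Continuous (fun b : expSpan X Y => ψ ((b : SL3) : Mat3)) := by
    refine continuous_iff_continuousAt.2 fun b => ?_
    have hb : (b : SL3) ∈ Ω := by
      obtain ⟨u, v, hb⟩ := (mem_expSpan_iff hX hY h).1 b.2
      rw [hb]; exact hΩ u v
    have h2 : ContinuousAt (fun b : expSpan X Y => ((b : SL3) : Mat3)) b :=
      continuousAt_SL.1 continuous_subtype_val.continuousAt
    exact ContinuousAt.comp (g := ψ) (hψ.smooth _ hb).continuousAt h2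
  refine ⟨
    { toFun := fun m => ⟨expSL (m.toAdd.1 • X + m.toAdd.2 • Y),
        (mem_expSpan_iff hX hY h).2 ⟨_, _, rfl⟩⟩
      invFun := fun b => Multiplicative.ofAdd
        (ψ ((b : SL3) : Mat3) 0, ψ ((b : SL3) : Mat3) 1)
      left_inv := ?_
      right_inv := ?_
      map_mul' := fun m m' => Subtype.ext ((expHom hX hY h).map_mul m m')
      continuous_toFun := hc1.subtype_mk _
      continuous_invFun := ?_ }⟩
  · intro m
    change Multiplicative.ofAdd (ψ (expSL (m.toAdd.1 • X + m.toAdd.2 • Y) : Mat3) 0,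
      ψ (expSL (m.toAdd.1 • X + m.toAdd.2 • Y) : Mat3) 1) = m
    rw [hval]; rfl
  · intro b
    obtain ⟨u, v, hb⟩ := (mem_expSpan_iff hX hY h).1 b.2
    refine Subtype.ext ?_
    change expSL (ψ ((b : SL3) : Mat3) 0 • X + ψ ((b : SL3) : Mat3) 1 • Y) = (b : SL3)
    rw [hb, hval]; rfl
  · refine continuous_ofAdd.comp (Continuous.prodMk ?_ ?_)
    · exact (EuclideanSpace.proj 0 : E 2 →L[ℝ] ℝ).continuous.comp hc2
    · exact (EuclideanSpace.proj 1 : E 2 →L[ℝ] ℝ).continuous.comp hc2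

end Abelian

/-! ### The degenerate orbit -/

/-- The affine coordinates of the third column. -/
noncomputable def affineMap (A : Mat3) : E 2 := !₂[A 0 2 / A 2 2, A 1 2 / A 2 2]

theorem isInvariantMap_affineMap : IsInvariantMap {a : SL3 | 0 < (a : Mat3) 2 2} affineMap := by
  have key : ∀ (a : SL3), ∀ h ∈ H, ∃ γ : ℝ, 0 < γ ∧
      ∀ i, ((a * h : SL3) : Mat3) i 2 = (a : Mat3) i 2 * γ := by
    intro a h hh
    obtain ⟨α, β, γ, hd, hm⟩ := exists_of_mem_H hh
    refine ⟨γ, ?_, fun i => ?_⟩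
    · by_contra hc
      nlinarith [sq_nonneg α, sq_nonneg β]
    · rw [Matrix.SpecialLinearGroup.coe_mul, hm]
      simp [Matrix.mul_apply, Fin.sum_univ_three]
  refine ⟨isOpen_lt continuous_const (continuous_entry 2 2), ?_, ?_, ?_⟩
  · intro a ha
    have h : ∀ i j, ContDiffAt ℝ ∞ (fun A : Mat3 => A i j) (a : Mat3) :=
      fun i j => (entryL i j).contDiff.contDiffAt
    have h2 : (a : Mat3) 2 2 ≠ 0 := ne_of_gt ha
    rw [contDiffAt_euclidean]
    intro i
    fin_cases i
    · exact (h 0 2).div (h 2 2) h2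
    · exact (h 1 2).div (h 2 2) h2
  · intro a ha h hh
    obtain ⟨γ, hγ, h1⟩ := key a h hh
    change 0 < ((a * h : SL3) : Mat3) 2 2
    rw [h1]
    exact mul_pos ha hγ
  · intro a ha h hh
    obtain ⟨γ, hγ, h1⟩ := key a h hh
    rw [affineMap, affineMap, h1, h1, h1, mul_div_mul_right _ _ hγ.ne',
      mul_div_mul_right _ _ hγ.ne']

theorem trace_e3 (s : ℝ) : (s • e3).trace = 0 := by simp [e3, Matrix.trace_fin_three]

theorem trace_e4 (s : ℝ) : (s • e4).trace = 0 := by simp [e4, Matrix.trace_fin_three]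

theorem commute_e3_e4 (s : ℝ) : Commute (s • e3) (s • e4) := by
  refine (Commute.smul_left ?_ s).smul_right s
  change e3 * e4 = e4 * e3
  ext i j
  fin_cases i <;> fin_cases j <;> simp [e3, e4, Matrix.mul_apply, Fin.sum_univ_three]

/-- The exponent `N` satisfies `N² = 0`, so `(1 + t N) exp (-t N)` has derivative zero and `exp N =
1 + N`. -/
theorem coe_expSL_nilpotent (u v : ℝ) :
    (expSL (u • (1 / √2) • e3 + v • (1 / √2) • e4) : Mat3) = !![1, 0, u; 0, 1, v; 0, 0, 1] := by
  have h : u • (1 / √2) • e3 + v • (1 / √2) • e4 = !![0, 0, u; 0, 0, v; 0, 0, 0] := by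
    ext i j
    fin_cases i <;> fin_cases j <;> simp [e3, e4]
  rw [coe_expSL (by rw [h]; simp [Matrix.trace_fin_three]), h]
  set N : Mat3 := !![0, 0, u; 0, 0, v; 0, 0, 0] with hN
  have hsq : N * N = 0 := by
    rw [hN]
    ext i j
    fin_cases i <;> fin_cases j <;> simp [Matrix.mul_apply, Fin.sum_univ_three]
  have hd : ∀ t : ℝ, HasDerivAt (fun t : ℝ => (1 + t • N) * NormedSpace.exp (t • (-N))) 0 t := by
    intro t
    have d1 := ((hasDerivAt_id t).smul_const N).const_add (1 : Mat3)
    have d2 := hasDerivAt_exp_smul_const' (𝕂 := ℝ) (-N) t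
    refine (d1.mul d2).congr_deriv ?_
    rw [one_smul, ← mul_assoc, ← add_mul]
    simp [add_mul, hsq]
  have hconst := is_const_of_deriv_eq_zero (fun t => (hd t).differentiableAt)
    (fun t => (hd t).deriv) 1 0
  have h2 : (1 + N) * NormedSpace.exp (-N) = 1 := by simpa using hconst
  have h3 : NormedSpace.exp (-N) * NormedSpace.exp N = 1 := by
    rw [← Matrix.exp_add_of_commute _ _ (Commute.refl N).neg_left, neg_add_cancel,
      NormedSpace.exp_zero]
  calc NormedSpace.exp N = (1 + N) * NormedSpace.exp (-N) * NormedSpace.exp N := by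
        rw [h2, one_mul]
    _ = 1 + N := by rw [mul_assoc, h3, mul_one]
    _ = _ := by
        rw [hN]
        ext i j
        fin_cases i <;> fin_cases j <;> simp

theorem affineMap_expSL (u v : ℝ) :
    affineMap (expSL (u • (1 / √2) • e3 + v • (1 / √2) • e4) : Mat3) = !₂[u, v] := by
  rw [coe_expSL_nilpotent, affineMap]
  simp

theorem expSL_mem_affine (u v : ℝ) :
    expSL (u • (1 / √2) • e3 + v • (1 / √2) • e4) ∈ {a : SL3 | 0 < (a : Mat3) 2 2} := by
  change 0 < (expSL _ : Mat3) 2 2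
  rw [coe_expSL_nilpotent]
  simp

theorem f5_eq : f5 = fun y : E 2 => cls (expSL (y 0 • (1 / √2) • e3 + y 1 • (1 / √2) • e4)) := by
  funext y
  rw [f5]
  congr 2
  module

/-- Rescaling the generators makes `affineMap` return exactly the parameters `u, v` of `f5`. -/
theorem K5_eq : K5 = expSpan ((1 / √2) • e3) ((1 / √2) • e4) := by
  have h2 : √2 ≠ 0 := by positivity
  rw [K5, expSpan, expSpan]
  congr 1
  ext a
  constructor
  · rintro ⟨u, v, h⟩
    refine ⟨u * √2, v * √2, ?_⟩
    rw [h, smul_smul, smul_smul]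
    congr 3 <;> field_simp
  · rintro ⟨u, v, h⟩
    exact ⟨u * (1 / √2), v * (1 / √2), by rw [h, smul_smul, smul_smul]⟩

theorem range_f5 : Set.range f5 = orbit K5 := by
  rw [f5_eq, K5_eq]
  exact range_eq_orbit_expSpan (trace_e3 _) (trace_e4 _) (commute_e3_e4 _)

theorem nonempty_K5 : Nonempty (Multiplicative (ℝ × ℝ) ≃ₜ* K5) := by
  rw [K5_eq]
  exact nonempty_continuousMulEquiv (trace_e3 _) (trace_e4 _) (commute_e3_e4 _)
    isInvariantMap_affineMap expSL_mem_affine affineMap_expSL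

theorem J0_e3 : J0 e3 = e4 := by
  rw [J0_eq]
  ext i j; fin_cases i <;> fin_cases j <;> simp [e3, e4]

theorem J0_e5 : J0 e5 = e6 := by
  rw [J0_eq]
  ext i j; fin_cases i <;> fin_cases j <;> simp [e5, e6]

theorem contMDiff_f5 : ContMDiff (𝓡 2) (𝓡 6) ∞ f5 := by
  rw [f5_eq]
  have h0 : ContDiff ℝ ∞ (fun y : E 2 => y 0) := (EuclideanSpace.proj 0 : E 2 →L[ℝ] ℝ).contDiff
  have h1 : ContDiff ℝ ∞ (fun y : E 2 => y 1) := (EuclideanSpace.proj 1 : E 2 →L[ℝ] ℝ).contDiff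
  refine contMDiff_cls_expSL ((h0.smul contDiff_const).add (h1.smul contDiff_const)) fun y => ?_
  simp [e3, e4, Matrix.trace_fin_three]

theorem exists_f5_eq {Z : Mat3} (hZ : Z ∈ cplane e3) : ∃ y, cls (expSL Z) = f5 y := by
  obtain ⟨u, v, rfl⟩ := Submodule.mem_span_pair.1 hZ
  have h2 : √2 ≠ 0 := by positivity
  refine ⟨!₂[u * √2, v * √2], ?_⟩
  rw [f5_eq, J0_e3]
  change _ = cls (expSL ((u * √2) • (1 / √2) • e3 + (v * √2) • (1 / √2) • e4))
  rw [smul_smul, smul_smul]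
  congr 4 <;> field_simp

/-- The planes are totally isotropic, so every vector is a null vector of the induced metric and any
nonzero one will do. -/
theorem isDegenerate_of_trace {S : Type*} [TopologicalSpace S] [ChartedSpace (E 2) S]
    {f : S → NKSpace} {V : Submodule ℝ Mat3}
    (hV : ∀ Z ∈ V, ∀ Z' ∈ V, (Z * Z').trace = 0) (hall : ∀ p, ∃ a, IsAdapted f p a V) :
    IsDegenerate (m := 2) (pullback g f) := by
  intro p
  obtain ⟨a, ha⟩ := hall p
  refine ⟨(EuclideanSpace.single 0 1 : E 2), ?_, fun w => ?_⟩
  · intro h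
    have h0 := congrArg (fun z : E 2 => z 0) (h : (EuclideanSpace.single 0 1 : E 2) = 0)
    simp at h0
    exact one_ne_zero (α := ℝ) h0
  · change g (f p) _ _ = 0
    rw [g_eq_horRel a, hV _ (ha.tanPlane_eq ▸ mem_tanPlane a p _) _
      (ha.tanPlane_eq ▸ mem_tanPlane a p _), mul_zero]

section Conclusion

variable {S : Type*} [TopologicalSpace S] [ChartedSpace (E 2) S] [IsManifold (𝓡 2) ∞ S]
  {f : S → NKSpace}

/-- The affine coordinates of the third column are a global left inverse of `f5`, smooth along its
image, and hence give the chart. -/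
theorem exists_chart_f5 (hf : IsSmoothImmersion (m := 2) (n := 6) f) {p : S}
    (Φ : NKSpace ≃ₘ^∞⟮𝓡 6, 𝓡 6⟯ NKSpace) (h : ∀ᶠ x in 𝓝 p, ∃ y, f x = Φ (f5 y)) :
    ∃ ψ ∈ IsManifold.maximalAtlas (𝓡 2) ∞ S, p ∈ ψ.source ∧
      ∀ x ∈ ψ.source, f x = Φ (f5 (ψ x)) := by
  have hn : ∀ y, descend affineMap (f5 y) = y := by
    intro y
    rw [f5_eq]
    change descend affineMap (cls _) = y
    rw [isInvariantMap_affineMap.descend_cls (expSL_mem_affine _ _), affineMap_expSL]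
    ext i
    fin_cases i <;> rfl
  have hs : ∀ y, ContMDiffAt (𝓡 6) (𝓡 2) ∞ (descend affineMap) (f5 y) := by
    intro y
    rw [f5_eq]
    exact isInvariantMap_affineMap.contMDiffAt_descend (expSL_mem_affine _ _)
  obtain ⟨ψ, hψ, hp, -, hψ'⟩ := exists_chart_of_leftInverse hf Φ contMDiff_f5
    (n := descend affineMap) (p := p) (N := Set.univ) (by
      filter_upwards [h] with x hx
      obtain ⟨y, hy⟩ := hx
      rw [hy, Φ.symm_apply_apply]
      exact hs y) (by
      filter_upwards [h] with x hx
      obtain ⟨y, hy⟩ := hx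
      rw [hy, Φ.symm_apply_apply, hn]) Filter.univ_mem
  exact ⟨ψ, hψ, hp, fun x hx => (hψ' x hx).2⟩

theorem conclusion_e3 (hf : IsSmoothImmersion (m := 2) (n := 6) f)
    (hall : ∀ p, ∃ a, IsAdapted f p a (cplane e3)) :
    IsDegenerate (m := 2) (pullback g f) ∧ IsLocallyCongruent g f f5 := by
  refine ⟨isDegenerate_of_trace ?_ hall, fun p => ?_⟩
  · intro Z hZ Z' hZ'
    obtain ⟨u, v, rfl⟩ := Submodule.mem_span_pair.1 hZ
    obtain ⟨u', v', rfl⟩ := Submodule.mem_span_pair.1 hZ'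
    rw [J0_e3]
    simp [e3, e4, Matrix.trace_fin_three]
  · obtain ⟨a, ha⟩ := hall p
    obtain ⟨ψ, hψ, hp, h⟩ := exists_chart_f5 hf (smulDiffeo a) (p := p) (by
      filter_upwards [ha.eventually] with x hx
      obtain ⟨Z, hZ, hfx, -⟩ := hx
      obtain ⟨y, hy⟩ := exists_f5_eq hZ
      exact ⟨y, by rw [hfx, ← hy]; rfl⟩)
    exact ⟨smulDiffeo a, isIsom_smul a, ψ, hψ, hp, h⟩

/-- The isometry induced by `outer` carries `[exp Z]`, with `Z` in the plane of `e5`, to a point of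
the orbit in the plane of `e3`. -/
theorem conclusion_e5 (hf : IsSmoothImmersion (m := 2) (n := 6) f)
    (hall : ∀ p, ∃ a, IsAdapted f p a (cplane e5)) :
    IsDegenerate (m := 2) (pullback g f) ∧ IsLocallyCongruent g f f5 := by
  refine ⟨isDegenerate_of_trace ?_ hall, fun p => ?_⟩
  · intro Z hZ Z' hZ'
    obtain ⟨u, v, rfl⟩ := Submodule.mem_span_pair.1 hZ
    obtain ⟨u', v', rfl⟩ := Submodule.mem_span_pair.1 hZ'
    rw [J0_e5]
    simp [e5, e6, Matrix.trace_fin_three]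
  · obtain ⟨a, ha⟩ := hall p
    obtain ⟨ψ, hψ, hp, h⟩ := exists_chart_f5 hf (outerDiffeo.trans (smulDiffeo a)) (p := p) (by
      filter_upwards [ha.eventually] with x hx
      obtain ⟨Z, hZ, hfx, -⟩ := hx
      obtain ⟨u, v, rfl⟩ := Submodule.mem_span_pair.1 hZ
      have h1 : -(u • e5 + v • J0 e5).transpose = u • e3 + v • J0 e3 := by
        rw [J0_e5, J0_e3]
        ext i j
        fin_cases i <;> fin_cases j <;> simp [e3, e4, e5, e6]
      have htr : (u • e5 + v • J0 e5).trace = 0 := by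
        rw [J0_e5]; simp [e5, e6, Matrix.trace_fin_three]
      obtain ⟨y, hy⟩ := exists_f5_eq (Z := u • e3 + v • J0 e3)
        (Submodule.mem_span_pair.2 ⟨u, v, rfl⟩)
      refine ⟨y, ?_⟩
      rw [hfx, ← hy, ← h1, ← outer_expSL htr]
      change _ = a • outerQ (cls _)
      rw [outerQ_cls, outer_outer]; rfl)
    exact ⟨_, isIsom_outer.trans (isIsom_smul a), ψ, hψ, hp, h⟩

end Conclusion

/-! ### The flat orbit -/

/-- The value of the row `(c, d, 1)` on the third column. -/
noncomputable def colForm (c d : ℝ) : Mat3 →L[ℝ] ℝ := c • entryL 0 2 + d • entryL 1 2 + entryL 2 2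

theorem colForm_apply (c d : ℝ) (A : Mat3) : colForm c d A = c * A 0 2 + d * A 1 2 + A 2 2 := rfl

/-- A left eigenvector of `Z` is a left eigenvector of `exp Z`. -/
theorem colForm_exp {c d l : ℝ} {Z : Mat3} (h0 : c * Z 0 0 + d * Z 1 0 + Z 2 0 = l * c)
    (h1 : c * Z 0 1 + d * Z 1 1 + Z 2 1 = l * d) (h2 : c * Z 0 2 + d * Z 1 2 + Z 2 2 = l) :
    colForm c d (NormedSpace.exp Z) = Real.exp l := by
  have h : ∀ M : Mat3, colForm c d (Z * M) = l * colForm c d M := by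
    intro M
    simp only [colForm_apply, Matrix.mul_apply, Fin.sum_univ_three]
    linear_combination M 0 2 * h0 + M 1 2 * h1 + M 2 2 * h2
  have hring : ∀ x y : ℝ, x * -l * y + x * (l * y) = 0 := fun x y => by ring
  have hd : ∀ t : ℝ, HasDerivAt (fun t : ℝ =>
      Real.exp (-(l * t)) * colForm c d (NormedSpace.exp (t • Z))) 0 t := by
    intro t
    have d1 := (((hasDerivAt_id t).const_mul l).neg).exp
    have d2 := (colForm c d).hasFDerivAt.comp_hasDerivAt t
      (hasDerivAt_exp_smul_const' (𝕂 := ℝ) Z t)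
    refine (d1.mul d2).congr_deriv ?_
    have := h (NormedSpace.exp (t • Z))
    simp only [Function.comp, id, mul_one]
    refine (congrArg (fun z => _ + Real.exp (-(l * t)) * z) this).trans ?_
    change Real.exp (-(l * t)) * -l * _ + _ = 0
    exact hring _ _
  have hconst := is_const_of_deriv_eq_zero (fun t => (hd t).differentiableAt)
    (fun t => (hd t).deriv) 1 0
  have h1 : colForm c d (1 : Mat3) = 1 := by simp [colForm_apply]
  simp [h1] at hconst
  rw [Real.exp_neg, inv_mul_eq_one₀ (Real.exp_pos _).ne'] at hconst
  exact hconst.symm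

theorem X4_mat : X4 = !![1 / √3, 0, √2; 0, -(1 / √3), 0; √2 / 3, 0, 0] := by
  ext i j; fin_cases i <;> fin_cases j <;> simp [X4, e1, e3, e5, div_eq_inv_mul]

theorem J0_X4_mat : J0 X4 = !![0, -(1 / √3), 0; -(1 / √3), 0, √2; 0, √2 / 3, 0] := by
  rw [J0_eq, X4_mat]
  ext i j; fin_cases i <;> fin_cases j <;> simp

theorem trace_X4 : X4.trace = 0 := by rw [X4_mat]; simp [Matrix.trace_fin_three]

theorem trace_J0_X4 : (J0 X4).trace = 0 := by rw [J0_X4_mat]; simp [Matrix.trace_fin_three]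

/-- Commutation makes `(u, v) ↦ exp (u X + v J X)` a homomorphism on `ℝ²`, whose orbit is the fourth
example. -/
theorem commute_X4 : Commute X4 (J0 X4) := by
  change X4 * J0 X4 = J0 X4 * X4
  rw [J0_X4_mat, X4_mat]
  ext i j
  have s2 : √2 ^ 2 = 2 := Real.sq_sqrt (by norm_num)
  have s3 : (√3)⁻¹ ^ 2 = 1 / 3 := by rw [inv_pow, Real.sq_sqrt (by norm_num)]; norm_num
  fin_cases i <;> fin_cases j <;> simp [Matrix.mul_apply, Fin.sum_univ_three] <;> ring_nf <;>
    rw [s2, s3] <;> norm_num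

theorem coe_expSL_X4 (u v : ℝ) :
    (expSL (u • X4 + v • J0 X4) : Mat3) = NormedSpace.exp (u • X4 + v • J0 X4) :=
  coe_expSL (by simp [trace_X4, trace_J0_X4])

/-- `X4` and `J0 X4` have common left eigenvectors `(√2/√3, 0, 1)` and `(-1/√6, ±1/√2, 1)`. On `u X4
+ v J0 X4` their eigenvalues are `2u/√3` and `-u/√3 ± v`; this lemma treats the first of them and
`colForm_signed_expSL` the other two. -/
theorem colForm_zero_expSL (u v : ℝ) :
    colForm (√2 / √3) 0 (expSL (u • X4 + v • J0 X4) : Mat3) = Real.exp (2 * u / √3) := by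
  rw [coe_expSL_X4]
  have h3 : √3 ≠ 0 := by positivity
  have s2 : √2 ^ 2 = 2 := Real.sq_sqrt (by norm_num)
  have s3 : √3 ^ 2 = 3 := Real.sq_sqrt (by norm_num)
  rw [J0_X4_mat, X4_mat]
  refine colForm_exp ?_ ?_ ?_ <;> simp <;> field_simp <;> ring_nf <;> (try simp only [s2, s3]) <;>
    ring_nf

theorem colForm_signed_expSL {ε : ℝ} (hε : ε ^ 2 = 1) (u v : ℝ) :
    colForm (-(1 / (√2 * √3))) (ε / √2) (expSL (u • X4 + v • J0 X4) : Mat3) =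
      Real.exp (-(u / √3) + ε * v) := by
  rw [coe_expSL_X4]
  have h3 : √3 ≠ 0 := by positivity
  have h2 : √2 ≠ 0 := by positivity
  have s2 : √2 ^ 2 = 2 := Real.sq_sqrt (by norm_num)
  have s3 : √3 ^ 2 = 3 := Real.sq_sqrt (by norm_num)
  rw [J0_X4_mat, X4_mat]
  refine colForm_exp ?_ ?_ ?_ <;> simp <;> field_simp <;> ring_nf <;> (try simp only [s2, s3, hε]) <;>
    ring_nf

/-- The logarithmic coordinates of the third column. -/
noncomputable def logMap (A : Mat3) : E 2 :=
  !₂[√3 / 6 * (2 * Real.log (colForm (√2 / √3) 0 A) -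
      Real.log (colForm (-(1 / (√2 * √3))) (1 / √2) A) -
      Real.log (colForm (-(1 / (√2 * √3))) (-1 / √2) A)),
    (Real.log (colForm (-(1 / (√2 * √3))) (1 / √2) A) -
      Real.log (colForm (-(1 / (√2 * √3))) (-1 / √2) A)) / 2]

/-- The domain of `logMap`. -/
def logDomain : Set SL3 := {a | 0 < colForm (√2 / √3) 0 (a : Mat3) ∧
  0 < colForm (-(1 / (√2 * √3))) (1 / √2) (a : Mat3) ∧
  0 < colForm (-(1 / (√2 * √3))) (-1 / √2) (a : Mat3)}

theorem expSL_mem_logDomain (u v : ℝ) : expSL (u • X4 + v • J0 X4) ∈ logDomain := by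
  refine ⟨?_, ?_, ?_⟩
  · rw [colForm_zero_expSL]; exact Real.exp_pos _
  · rw [colForm_signed_expSL (by norm_num)]; exact Real.exp_pos _
  · rw [colForm_signed_expSL (by norm_num)]; exact Real.exp_pos _

/-- The coefficients of `logMap` solve for `u` and `v` in terms of the three eigenvalues: twice the
first minus the other two is `6u/√3`, and the difference of the other two is `2v`. -/
theorem logMap_expSL (u v : ℝ) : logMap (expSL (u • X4 + v • J0 X4) : Mat3) = !₂[u, v] := by
  rw [logMap, colForm_zero_expSL, colForm_signed_expSL (by norm_num),
    colForm_signed_expSL (by norm_num), Real.log_exp, Real.log_exp, Real.log_exp]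
  have h3 : √3 ≠ 0 := by positivity
  ext i
  fin_cases i
  · simp; field_simp; ring
  · simp

/-- An element of `H` multiplies all three forms by the same positive number. In each coordinate of
`logMap` the coefficients of the logarithms sum to zero, so the common term cancels. -/
theorem isInvariantMap_logMap : IsInvariantMap logDomain logMap := by
  have key : ∀ (a : SL3), ∀ h ∈ H, ∃ γ : ℝ, 0 < γ ∧
      ∀ c d, colForm c d ((a * h : SL3) : Mat3) = colForm c d (a : Mat3) * γ := by
    intro a h hh
    obtain ⟨α, β, γ, hd, hm⟩ := exists_of_mem_H hh
    refine ⟨γ, ?_, fun c d => ?_⟩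
    · by_contra hc
      nlinarith [sq_nonneg α, sq_nonneg β]
    · rw [Matrix.SpecialLinearGroup.coe_mul, hm]
      simp [colForm_apply, Matrix.mul_apply, Fin.sum_univ_three]
      ring
  have hc : ∀ c d, Continuous fun a : SL3 => colForm c d (a : Mat3) := fun c d =>
    ((continuous_const.mul (continuous_entry 0 2)).add
      (continuous_const.mul (continuous_entry 1 2))).add (continuous_entry 2 2)
  refine ⟨?_, ?_, ?_, ?_⟩
  · exact (isOpen_lt continuous_const (hc _ _)).inter
      ((isOpen_lt continuous_const (hc _ _)).inter (isOpen_lt continuous_const (hc _ _)))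
  · intro a ha
    have hs : ∀ c d, 0 < colForm c d (a : Mat3) →
        ContDiffAt ℝ ∞ (fun A : Mat3 => Real.log (colForm c d A)) (a : Mat3) :=
      fun c d h => (colForm c d).contDiff.contDiffAt.log h.ne'
    have h0 := hs _ _ ha.1
    have h1 := hs _ _ ha.2.1
    have h2 := hs _ _ ha.2.2
    rw [contDiffAt_euclidean]
    intro i
    fin_cases i
    · exact contDiffAt_const.mul (((contDiffAt_const.mul h0).sub h1).sub h2)
    · exact (h1.sub h2).div_const 2
  · intro a ha h hh
    obtain ⟨γ, hγ, h1⟩ := key a h hh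
    refine ⟨?_, ?_, ?_⟩
    · rw [h1]; exact mul_pos ha.1 hγ
    · rw [h1]; exact mul_pos ha.2.1 hγ
    · rw [h1]; exact mul_pos ha.2.2 hγ
  · intro a ha h hh
    obtain ⟨γ, hγ, h1⟩ := key a h hh
    rw [logMap, logMap, h1, h1, h1, Real.log_mul ha.1.ne' hγ.ne', Real.log_mul ha.2.1.ne' hγ.ne',
      Real.log_mul ha.2.2.ne' hγ.ne']
    ext i
    fin_cases i
    · simp; ring
    · simp

theorem range_f4 : Set.range f4 = orbit K4 :=
  range_eq_orbit_expSpan trace_X4 trace_J0_X4 commute_X4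

theorem nonempty_K4 : Nonempty (Multiplicative (ℝ × ℝ) ≃ₜ* K4) :=
  nonempty_continuousMulEquiv trace_X4 trace_J0_X4 commute_X4 isInvariantMap_logMap
    expSL_mem_logDomain logMap_expSL

theorem descend_logMap_expSL (u v : ℝ) :
    descend logMap (cls (expSL (u • X4 + v • J0 X4))) = !₂[u, v] := by
  rw [isInvariantMap_logMap.descend_cls (expSL_mem_logDomain u v), logMap_expSL]

theorem mem_K4_iff {b : SL3} : b ∈ K4 ↔ ∃ u v : ℝ, b = expSL (u • X4 + v • J0 X4) :=
  mem_expSpan_iff trace_X4 trace_J0_X4 commute_X4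

theorem descend_logMap_f4 (y : E 2) : descend logMap (f4 y) = y := by
  refine (descend_logMap_expSL (y 0) (y 1)).trans ?_
  ext i
  fin_cases i <;> rfl

theorem contMDiff_f4 : ContMDiff (𝓡 2) (𝓡 6) ∞ f4 := by
  have h0 : ContDiff ℝ ∞ (fun y : E 2 => y 0) := (EuclideanSpace.proj 0 : E 2 →L[ℝ] ℝ).contDiff
  have h1 : ContDiff ℝ ∞ (fun y : E 2 => y 1) := (EuclideanSpace.proj 1 : E 2 →L[ℝ] ℝ).contDiff
  exact contMDiff_cls_expSL ((h0.smul contDiff_const).add (h1.smul contDiff_const)) fun y => by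
    simp [trace_X4, trace_J0_X4]

/-- In the coordinates `logMap` the group acts by translations, so the curve is a straight line with
velocity `(z, w)`. -/
theorem hasDerivAt_logMap (u v z w : ℝ) :
    HasDerivAt (fun t : ℝ => descend logMap (cls (expSL (u • X4 + v • J0 X4) *
      expSL (t • (z • X4 + w • J0 X4))))) !₂[z, w] 0 := by
  have hfun : (fun t : ℝ => descend logMap (cls (expSL (u • X4 + v • J0 X4) *
      expSL (t • (z • X4 + w • J0 X4))))) = fun t : ℝ => !₂[u + t * z, v + t * w] := by
    funext t
    have := (expHom trace_X4 trace_J0_X4 commute_X4).map_mul (Multiplicative.ofAdd (u, v))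
      (Multiplicative.ofAdd (t * z, t * w))
    rw [smul_add, smul_smul, smul_smul, ← descend_logMap_expSL]
    exact congrArg (fun b => descend logMap (cls b)) this.symm
  rw [hfun]
  refine hasDerivAt_euclidean_of fun i => ?_
  fin_cases i
  · simpa using ((hasDerivAt_id (0 : ℝ)).mul_const z).const_add u
  · simpa using ((hasDerivAt_id (0 : ℝ)).mul_const w).const_add v

theorem conclusion_f4 {S : Type*} [TopologicalSpace S] [ChartedSpace (E 2) S]
    [IsManifold (𝓡 2) ∞ S] {f : S → NKSpace} (hf : IsSmoothImmersion (m := 2) (n := 6) f)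
    (hall : ∀ p, ∃ a, IsAdapted f p a (cplane X4)) :
    IsLocallyIsometricTo (m := 2) (pullback g f) 2 (Set.univ : Set (E 2)) ∧
      IsLocallyCongruent g f f4 := by
  have hmem : ∀ b ∈ K4, b ∈ logDomain := by
    intro b hb
    obtain ⟨u, v, rfl⟩ := mem_K4_iff.1 hb
    exact expSL_mem_logDomain u v
  -- The first row of a vector in the plane reads off its coefficients; this gives the differential
  -- `D` as a function of the vector alone.
  have hcoord : ∀ z w : ℝ, √3 * (z • X4 + w • J0 X4) 0 0 = z ∧
      -(√3 * (z • X4 + w • J0 X4) 0 1) = w := by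
    intro z w
    have h3 : √3 ≠ 0 := by positivity
    rw [J0_X4_mat, X4_mat]
    constructor <;> simp <;> field_simp
  refine conclusion_of_model hf hall contMDiff_f4 (K := K4) ?_ K4.one_mem
    (n := descend logMap) ?_ ?_ (Ψ := descend logMap) (V := Set.univ) ?_ Filter.univ_mem ?_ ?_
    (D := fun _ Z => !₂[√3 * Z 0 0, -(√3 * Z 0 1)]) ?_ ?_
  · intro Z hZ
    obtain ⟨u, v, rfl⟩ := Submodule.mem_span_pair.1 hZ
    exact mem_K4_iff.2 ⟨u, v, rfl⟩
  · exact isInvariantMap_logMap.eventually_contMDiffAt (hmem 1 K4.one_mem)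
  · refine Filter.Eventually.of_forall ?_
    rintro q ⟨b, hb, rfl⟩
    obtain ⟨u, v, rfl⟩ := mem_K4_iff.1 hb
    rw [descend_logMap_expSL]
    rfl
  · exact fun b hb => isInvariantMap_logMap.contMDiffAt_descend (hmem b hb)
  · intro y _ y' _ h
    simpa only [descend_logMap_f4] using h
  · intro V' _ hV'
    refine ⟨V', hV', ?_⟩
    simp only [descend_logMap_f4, Set.image_id', Set.inter_univ]
  · intro b hb Z hZ
    obtain ⟨u, v, rfl⟩ := mem_K4_iff.1 hb
    obtain ⟨z, w, rfl⟩ := Submodule.mem_span_pair.1 hZ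
    rw [(hcoord z w).1, (hcoord z w).2]
    exact hasDerivAt_logMap u v z w
  · intro b _ Z hZ Z' hZ'
    obtain ⟨z, w, rfl⟩ := Submodule.mem_span_pair.1 hZ
    obtain ⟨z', w', rfl⟩ := Submodule.mem_span_pair.1 hZ'
    rw [(hcoord z w).1, (hcoord z w).2, (hcoord z' w').1, (hcoord z' w').2, J0_X4_mat, X4_mat]
    have s2 : √2 ^ 2 = 2 := Real.sq_sqrt (by norm_num)
    have s3 : √3 ^ 2 = 3 := Real.sq_sqrt (by norm_num)
    have h3 : √3 ≠ 0 := by positivity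
    simp [semiEuclid, Fin.sum_univ_two, Matrix.trace_fin_three]
    field_simp
    ring_nf
    simp only [s2, s3]
    ring_nf

/-! ### From the tangent plane at one point to the whole surface -/

section Main

variable {S : Type*} [TopologicalSpace S] [ChartedSpace (E 2) S] {f : S → NKSpace}

theorem IsAdapted.of_tanPlane_eq {p : S} {a₀ a : SL3} {W V : Submodule ℝ Mat3}
    (h : IsAdapted f p a₀ W) (hW : IsComplexPlane W) (ha : cls a = f p)
    (hV : tanPlane f a p = V) : IsAdapted f p a V := by
  have hk : a⁻¹ * a₀ ∈ H := QuotientGroup.eq.1 (ha.trans h.cls_eq.symm)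
  have h1 := h.conj hW hk
  have h2 : a₀ * (a⁻¹ * a₀)⁻¹ = a := by group
  rw [h2] at h1
  have h3 := h1.tanPlane_eq
  rw [hV] at h3
  rwa [← h3] at h1

/-- The classification is applied at a single point. The set of points whose plane is conjugate to
the resulting one is clopen, so by connectedness it is everything. -/
theorem exists_model [IsManifold (𝓡 2) ∞ S] [ConnectedSpace S]
    (hf : IsSmoothImmersion (m := 2) (n := 6) f)
    (hgeod : IsTotallyGeodesic (m := 2) g f) (hac : IsAlmostComplex (m := 2) J f) :
    ∃ X, (X = e1 ∨ X = (1 / √2) • (e3 + e5) ∨ X = (1 / √2) • (e3 - e5) ∨ X = X4 ∨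
      X = e3 ∨ X = e5) ∧ ∀ p, ∃ a, IsAdapted f p a (cplane X) := by
  have hall : ∀ p, ∃ a W, IsAdapted f p a W ∧ IsComplexPlane W := fun p => by
    obtain ⟨a, W, h, hW, -⟩ := exists_isAdapted hf hgeod hac p
    exact ⟨a, W, h, hW⟩
  obtain ⟨p⟩ := ‹ConnectedSpace S›.toNonempty
  obtain ⟨a, W, h, hW, hL⟩ := exists_isAdapted hf hgeod hac p
  obtain ⟨k, hk, X, hX, hWX⟩ := hW.classification hL
  have h1 := h.conj hW hk
  rw [hWX] at h1
  have huniv := (isClopen_isAdapted_of hall (cplane X)).eq_univ ⟨p, _, h1.cls_eq, h1.tanPlane_eq⟩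
  refine ⟨X, hX, fun q => ?_⟩
  obtain ⟨b, hb, hV⟩ := huniv.ge (Set.mem_univ q)
  obtain ⟨a', W', h', hW'⟩ := hall q
  exact ⟨b, h'.of_tanPlane_eq hW' hb hV⟩

end Main

end SL3NK

theorem theoremA {S : Type*} [TopologicalSpace S] [ChartedSpace (E 2) S] [IsManifold (𝓡 2) ∞ S]
    [ConnectedSpace S] (f : S → NKSpace) (hf : IsSmoothImmersion (m := 2) (n := 6) f)
    (hgeod : IsTotallyGeodesic (m := 2) g f) (hac : IsAlmostComplex (m := 2) J f) :
    (Set.range f1 = orbit K1 ∧ Set.range f2 = orbit K2 ∧ Set.range f3 = orbit K3 ∧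
      (Set.range f4 = orbit K4 ∧ Nonempty (Multiplicative (ℝ × ℝ) ≃ₜ* K4)) ∧
      (Set.range f5 = orbit K5 ∧ Nonempty (Multiplicative (ℝ × ℝ) ≃ₜ* K5))) ∧
    ((IsLocallyIsometricTo (m := 2) (pullback g f) 2 (pseudosphere 2 2 (1 / 2)) ∧
        IsLocallyCongruent g f f1) ∨
      (IsLocallyIsometricTo (m := 2) (pullback g f) 0 (pseudosphere 2 0 1) ∧
        IsLocallyCongruent g f f2) ∨
      (IsLocallyIsometricTo (m := 2) (pullback g f) 2 (pseudosphere 2 2 1) ∧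
        IsLocallyCongruent g f f3) ∨
      (IsLocallyIsometricTo (m := 2) (pullback g f) 2 (Set.univ : Set (E 2)) ∧
        IsLocallyCongruent g f f4) ∨
      (IsDegenerate (m := 2) (pullback g f) ∧ IsLocallyCongruent g f f5)) := by
  refine ⟨⟨range_f1, range_f2, range_f3, ⟨range_f4, nonempty_K4⟩, range_f5, nonempty_K5⟩, ?_⟩
  obtain ⟨X, rfl | rfl | rfl | rfl | rfl | rfl, hall⟩ := exists_model hf hgeod hac
  · exact Or.inl (conclusion_f1 hf hall)
  · exact Or.inr (Or.inl (conclusion_f2 hf hall))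
  · exact Or.inr (Or.inr (Or.inl (conclusion_f3 hf hall)))
  · exact Or.inr (Or.inr (Or.inr (Or.inl (conclusion_f4 hf hall))))
  · exact Or.inr (Or.inr (Or.inr (Or.inr (conclusion_e3 hf hall))))
  -- The sixth line of the classification yields the same conclusion as the fifth, by the outer
  -- automorphism.
  · exact Or.inr (Or.inr (Or.inr (Or.inr (conclusion_e5 hf hall))))
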